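/- Let $(M^n,d,g,x)$ be a compact Riemannian manifold with a single conical singularity at $x$: $(M,d)$ is a compact metric space, $(M\setminus\{x\},g)$ is a smooth $n$-dimensional Riemannian manifold whose Riemannian distance is $d$, and there are a neighbourhood $U$ of $x$, a number $\varepsilon>0$, a compact smooth $(n-1)$-manifold $N$ and a smooth family $(h_r)_{0<r<\varepsilon}$ of Riemannian metrics on $N$ such that $(U\setminus\{x\},g)$ is isometric to $((0,\varepsilon)\times N,\,dr^2+r^2h_r)$, with $r\to0$ corresponding to the point $x$, and $h_r=h_0+o(r^\alpha)$ uniformly on $N$ as $r\to0$, for some $\alpha>0$ and some smooth Riemannian metric $h_0$ on $N$. For an integer $k\ge 0$ and real $p\ge1$ put $$\|u\|_{W^{k,p}(M)}=\Big(\int_M\sum_{i=0}^k|\nabla^iu|_g^p\,d\mathrm{vol}_g\Big)^{1/p},\qquad u\in C_0^\infty(M\setminus\{x\}),$$ where $\nabla^i u$ is the $i$-th iterated covariant derivative and $C_0^\infty(M\setminus\{x\})$ is the space of smooth real functions with compact support in $M\setminus\{x\}$. These are (finite) norms, and $W^{k,p}(M)$ denotes the completion of $C_0^\infty(M\setminus\{x\})$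 with respect to $\|\cdot\|_{W^{k,p}(M)}$. Let $1<p<n$ and let $k\ge 0$ be an integer. There is a constant $C=C(M,g,p,k)>0$ such that for every integer $0\le l<k$ with $\frac1{q_l}:=\frac1p-\frac{k-l}{n}>0$ and every real $1\le q\le q_l$: 1. $\|u\|_{W^{l,q}(M)}\le C\,\|u\|_{W^{k,p}(M)}$ for all $u\in C_0^\infty(M\setminus\{x\})$; 2. hence there is a continuous embedding $W^{k,p}(M)\subset W^{l,q}(M)$, that is, an injective continuous linear map $W^{k,p}(M)\to W^{l,q}(M)$ which is the identity on $C_0^\infty(M\setminus\{x\})$. -/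

import Mathlib

open Set Filter MeasureTheory Bundle Manifold
open scoped Topology ENNReal ContDiff

noncomputable section

namespace ConicalSobolev

/-! ### Riemannian manifolds: Levi-Civita connection, iterated covariant derivatives, volume -/

section Riemannian

variable {n : ℕ} {X : Type*} [TopologicalSpace X] [ChartedSpace (EuclideanSpace ℝ (Fin n)) X]
  [IsManifold (𝓡 n) ∞ X] [RiemannianBundle (fun y : X => TangentSpace (𝓡 n) y)]

/-- The right-hand side of the Koszul formula at `y`:
`X⟨Y,Z⟩ + Y⟨Z,X⟩ - Z⟨X,Y⟩ + ⟨[X,Y],Z⟩ - ⟨[X,Z],Y⟩ - ⟨[Y,Z],X⟩`. -/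
def koszul (U V W : Π y : X, TangentSpace (𝓡 n) y) (y : X) : ℝ :=
  mvfderiv (𝓡 n) (fun z => inner ℝ (V z) (W z)) y (U y)
    + mvfderiv (𝓡 n) (fun z => inner ℝ (W z) (U z)) y (V y)
    - mvfderiv (𝓡 n) (fun z => inner ℝ (U z) (V z)) y (W y)
    + inner ℝ (VectorField.mlieBracket (𝓡 n) U V y) (W y)
    - inner ℝ (VectorField.mlieBracket (𝓡 n) U W y) (V y)
    - inner ℝ (VectorField.mlieBracket (𝓡 n) V W y) (U y)

/-- An orthonormal basis of the tangent space at `y`. -/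
def tangentONB (y : X) :
    OrthonormalBasis (Fin (Module.finrank ℝ (TangentSpace (𝓡 n) y))) ℝ (TangentSpace (𝓡 n) y) :=
  haveI : FiniteDimensional ℝ (TangentSpace (𝓡 n) y) :=
    inferInstanceAs (FiniteDimensional ℝ (EuclideanSpace ℝ (Fin n)))
  stdOrthonormalBasis ℝ (TangentSpace (𝓡 n) y)

/-- A vector field extending `v ∈ T_yX`, smooth near `y`
(it is constant in the coordinates of the preferred chart at `y`). -/
def extendVec {y : X} (v : TangentSpace (𝓡 n) y) (z : X) : TangentSpace (𝓡 n) z :=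
  FiberBundle.extend (EuclideanSpace ℝ (Fin n)) v z

/-- The Levi-Civita covariant derivative `∇_v V` of a vector field `V` in the direction
`v ∈ T_yX`: the vector with `2⟨∇_v V, w⟩ = koszul v V w` for all `w ∈ T_yX`. -/
def leviCivita (V : Π y : X, TangentSpace (𝓡 n) y) (y : X) (v : TangentSpace (𝓡 n) y) :
    TangentSpace (𝓡 n) y :=
  ∑ a, ((1 / 2 : ℝ) * koszul (extendVec v) V (extendVec (tangentONB y a)) y) • tangentONB y a

/-- The iterated covariant derivative `∇^i u` of a function, as a covariant `i`-tensor: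
`(∇^0 u) = u` and
`(∇^{i+1}u)(v₀,v₁,…,vᵢ) = v₀((∇^i u)(V₁,…,Vᵢ)) - ∑ⱼ (∇^i u)(v₁,…,∇_{v₀}Vⱼ,…,vᵢ)`,
where `Vⱼ` is a vector field extending `vⱼ`. -/
def nablaIter (u : X → ℝ) : (i : ℕ) → (y : X) → (Fin i → TangentSpace (𝓡 n) y) → ℝ
  | 0, y, _ => u y
  | i + 1, y, v =>
      mvfderiv (𝓡 n) (fun z => nablaIter u i z (fun j => extendVec (v j.succ) z)) y (v 0)
        - ∑ j : Fin i, nablaIter u i y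
            (Function.update (fun j => v j.succ) j (leviCivita (extendVec (v j.succ)) y (v 0)))

variable (n) in
/-- The pointwise norm `|∇^i u|_g`. -/
def nablaNorm (u : X → ℝ) (i : ℕ) (y : X) : ℝ :=
  √(∑ a : Fin i → Fin (Module.finrank ℝ (TangentSpace (𝓡 n) y)),
      (nablaIter (n := n) u i y (fun j => tangentONB y (a j))) ^ 2)

/-- The density `√(det g_{ij})` of the Riemannian volume in the coordinates of a chart `e`. -/
def chartDensity (e : OpenPartialHomeomorph X (EuclideanSpace ℝ (Fin n)))
    (z : EuclideanSpace ℝ (Fin n)) : ℝ :=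
  √(Matrix.det (Matrix.of fun i j : Fin n =>
    (inner ℝ
      (mfderiv (𝓡 n) (𝓡 n) e.symm z (EuclideanSpace.single i (1 : ℝ)) :
        TangentSpace (𝓡 n) (e.symm z))
      (mfderiv (𝓡 n) (𝓡 n) e.symm z (EuclideanSpace.single j (1 : ℝ)) :
        TangentSpace (𝓡 n) (e.symm z)) : ℝ)))

variable [MeasurableSpace X] [BorelSpace X]

/-- The Riemannian volume of the domain of a chart `e`: the image under `e⁻¹` of
`√(det g_{ij}) dz` on the target of `e`. -/
def chartVolume (e : OpenPartialHomeomorph X (EuclideanSpace ℝ (Fin n))) : Measure X :=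
  ((volume.restrict e.target).withDensity fun z => ENNReal.ofReal (chartDensity e z)).map e.symm

variable (n X) in
/-- The Riemannian volume measure of a second countable manifold. The measures `chartVolume e`
agree on overlaps of charts, and their supremum is the measure which restricts to
`chartVolume e` on the domain of each chart `e`. -/
def riemannianVolume : Measure X :=
  ⨆ y : X, chartVolume (chartAt (EuclideanSpace ℝ (Fin n)) y)

/-! ### Sobolev norms and Sobolev spaces -/

variable (n) in
/-- The Sobolev norm `(∫ ∑_{i ≤ k} |∇^i u|^p dvol_g)^{1/p}`. -/
def sobolevNorm (k : ℕ) (p : ℝ) (u : X → ℝ) : ℝ≥0∞ :=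
  (∫⁻ y, ∑ i ∈ Finset.range (k + 1), ENNReal.ofReal (nablaNorm n u i y ^ p)
    ∂(riemannianVolume n X)) ^ (1 / p)

end Riemannian

/-- The space `C_0^∞(X)` of smooth compactly supported real functions. -/
def TestFun (n : ℕ) (X : Type*) [TopologicalSpace X] [ChartedSpace (EuclideanSpace ℝ (Fin n)) X] :
    Submodule ℝ (X → ℝ) where
  carrier := {u | ContMDiff (𝓡 n) 𝓘(ℝ, ℝ) ∞ u ∧ HasCompactSupport u}
  add_mem' hu hv := ⟨hu.1.add hv.1, hu.2.add hv.2⟩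
  zero_mem' := ⟨contMDiff_const, HasCompactSupport.zero⟩
  smul_mem' c _ hu := ⟨contMDiff_const.mul hu.1, hu.2.smul_left (f := fun _ => c)⟩

/-- A real vector space `E`, regarded as a normed space with the seminorm `s`. -/
def WithSeminorm {E : Type*} [AddCommGroup E] [Module ℝ E] (_s : Seminorm ℝ E) : Type _ := E

section WithSeminorm

variable {E : Type*} [AddCommGroup E] [Module ℝ E] (s : Seminorm ℝ E)

instance : SeminormedAddCommGroup (WithSeminorm s) :=
  AddGroupSeminorm.toSeminormedAddCommGroup (E := E) s.toAddGroupSeminorm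

instance : Module ℝ (WithSeminorm s) := inferInstanceAs (Module ℝ E)

instance : NormedSpace ℝ (WithSeminorm s) where
  norm_smul_le c u := (map_smul_eq_mul s c (show E from u)).le

end WithSeminorm

section SobolevSpace

variable (n : ℕ) (X : Type*) [TopologicalSpace X] [ChartedSpace (EuclideanSpace ℝ (Fin n)) X]
  [IsManifold (𝓡 n) ∞ X] [RiemannianBundle (fun y : X => TangentSpace (𝓡 n) y)]
  [MeasurableSpace X] [BorelSpace X] (k : ℕ) (p : ℝ)

open Classical in
/-- The Sobolev norm as a seminorm on `C_0^∞(X)`. For `p ≥ 1` the Sobolev norm is finite and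
satisfies the triangle inequality on `C_0^∞(X)`, so that the first case applies. -/
def sobolevSeminorm : Seminorm ℝ (TestFun n X) :=
  if h : ∃ s : Seminorm ℝ (TestFun n X),
      ∀ u, ENNReal.ofReal (s u) = sobolevNorm n k p (u : X → ℝ) then h.choose else 0

/-- The Sobolev space `W^{k,p}(X)`: the completion of `C_0^∞(X)` for the `W^{k,p}`-norm. -/
abbrev SobolevSpace : Type _ :=
  UniformSpace.Completion (WithSeminorm (sobolevSeminorm n X k p))

variable {n X}

/-- The canonical map `C_0^∞(X) → W^{k,p}(X)`. -/
def toSobolev (u : TestFun n X) : SobolevSpace n X k p :=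
  ((show WithSeminorm (sobolevSeminorm n X k p) from u : WithSeminorm (sobolevSeminorm n X k p)) :
    UniformSpace.Completion _)

end SobolevSpace

/-! ### Conical singularities -/

/-- A conical neighbourhood, with cross section `N`, of the point `x` of the metric space `M`,
where `M ∖ {x}` is an `n`-dimensional Riemannian manifold: a neighbourhood `U` of `x` such that
`U ∖ {x}` is isometric to `((0, ε) × N, dr² + r² h_r)`, where `r → 0` corresponds to the point `x`
and `h_r` is a smooth family of Riemannian metrics on `N` with `h_r = h_0 + o(r^α)` as `r → 0`,
for some `α > 0` and some smooth Riemannian metric `h_0` on `N`. -/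
structure ConicalNeighborhood (n : ℕ) {M : Type*} [MetricSpace M] (x : M)
    [ChartedSpace (EuclideanSpace ℝ (Fin n)) {y : M // y ≠ x}]
    [IsManifold (𝓡 n) ∞ {y : M // y ≠ x}]
    [RiemannianBundle (fun y : {y : M // y ≠ x} => TangentSpace (𝓡 n) y)]
    (N : Type*) [TopologicalSpace N] [ChartedSpace (EuclideanSpace ℝ (Fin (n - 1))) N]
    [IsManifold (𝓡 (n - 1)) ∞ N] where
  /-- the radial size of the neighbourhood -/
  ε : ℝ
  ε_pos : 0 < ε
  /-- the diffeomorphism `(r, θ) ↦ φ (r, θ)` from `(0, ε) × N` onto `U ∖ {x}` -/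
  φ : OpenPartialHomeomorph (ℝ × N) {y : M // y ≠ x}
  source_eq : φ.source = Ioo 0 ε ×ˢ univ
  contMDiffOn_φ : ContMDiffOn (𝓘(ℝ, ℝ).prod (𝓡 (n - 1))) (𝓡 n) ∞ φ φ.source
  contMDiffOn_symm : ContMDiffOn (𝓡 n) (𝓘(ℝ, ℝ).prod (𝓡 (n - 1))) ∞ φ.symm φ.target
  /-- `U` is a neighbourhood of `x` -/
  mem_nhds : insert x (Subtype.val '' φ.target) ∈ 𝓝 x
  /-- `φ (r, θ) → x` as `r → 0`, uniformly in `θ` -/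
  tendsto_tip : Tendsto (fun z : ℝ × N => (φ z : M)) (comap Prod.fst (𝓝[>] 0)) (𝓝 x)
  /-- the metrics `h_r` for `0 < r < ε`, and the limit metric `h_0` -/
  h : ℝ → ContMDiffRiemannianMetric (𝓡 (n - 1)) ∞ (EuclideanSpace ℝ (Fin (n - 1)))
    (fun θ : N => TangentSpace (𝓡 (n - 1)) θ)
  /-- `h_r` depends smoothly on `r ∈ (0, ε)`: for all smooth vector fields `V`, `W` on `N`,
  the function `(r, θ) ↦ h_r(V, W)(θ)` is smooth -/
  h_smooth : ∀ V W : Π θ : N, TangentSpace (𝓡 (n - 1)) θ,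
    ContMDiff (𝓡 (n - 1)) (𝓡 (n - 1)).tangent ∞
      (fun θ => (⟨θ, V θ⟩ : TangentBundle (𝓡 (n - 1)) N)) →
    ContMDiff (𝓡 (n - 1)) (𝓡 (n - 1)).tangent ∞
      (fun θ => (⟨θ, W θ⟩ : TangentBundle (𝓡 (n - 1)) N)) →
    ContMDiffOn (𝓘(ℝ, ℝ).prod (𝓡 (n - 1))) 𝓘(ℝ, ℝ) ∞
      (fun z : ℝ × N => (h z.1).inner z.2 (V z.2) (W z.2)) (Ioo 0 ε ×ˢ univ)
  /-- `φ^* g = dr² + r² h_r` -/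
  isometry : ∀ r ∈ Ioo 0 ε, ∀ θ : N, ∀ a b : ℝ, ∀ v w : TangentSpace (𝓡 (n - 1)) θ,
    inner ℝ
      (mfderiv (𝓘(ℝ, ℝ).prod (𝓡 (n - 1))) (𝓡 n) φ (r, θ) (a, v) :
        TangentSpace (𝓡 n) (φ (r, θ)))
      (mfderiv (𝓘(ℝ, ℝ).prod (𝓡 (n - 1))) (𝓡 n) φ (r, θ) (b, w) :
        TangentSpace (𝓡 n) (φ (r, θ)))
    = a * b + r ^ 2 * (h r).inner θ v w
  /-- `h_r = h_0 + o(r^α)` for some `α > 0`, uniformly on `N` -/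
  asymptotic : ∃ α > 0, ∀ c > 0, ∀ᶠ r in 𝓝[>] (0 : ℝ), ∀ θ : N,
    ∀ v : TangentSpace (𝓡 (n - 1)) θ,
      |(h r).inner θ v v - (h 0).inner θ v v| ≤ c * r ^ α * (h 0).inner θ v v

end ConicalSobolev
end

/-! The inequality is local once `M ∖ {x}` is covered by finitely many open cubes, each lying in a
smooth chart and carrying a metric bounded above and below by the Euclidean one (`IsTameCube`,
`IsTamelyCovered`). No bound on derivatives of the metric is required. Away from the tip such cubes
exist by continuity of the metric and compactness of `M`. At the tip, over a small patch of `N` with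
coordinate `s` near `s₀`, the coordinates `(r, r (s - s₀))` turn `dr² + r² h_r` into a metric
comparable to the Euclidean one uniformly as `r → 0`, because `h_r → h_0` uniformly. A linear change
of variables puts a corner of a cube at the tip, with the truncated sector inside the cube
(`exists_isTameCube_sector`). Compactness of `N` makes the number of sectors finite. That the
truncated cone is a neighbourhood of the tip follows from a Lipschitz cutoff
(`insert_truncation_mem_nhds`); with compactness of `M` this gives `isTamelyCovered`.

On a cube the Gagliardo–Nirenberg–Sobolev inequality from `W^{1,1}` to `L^{n/(n-1)}` holds without
boundary conditions, at the cost of a zeroth order term (`lintegral_rpow_le_of_cube`). Hence neither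
cutoffs nor a partition of unity are needed, and summing over the cubes gives the inequality on the
whole manifold (`exists_lintegral_rpow_le`). It is applied to `|∇^i u|^γ` with `γ > 1`: this power
is `C¹` and, by Kato's inequality, its differential is at most `γ |∇^i u|^(γ-1) |∇^{i+1} u|`.
Hölder's inequality then gives the `L^p` to `L^q` estimate with `1/q = 1/p - 1/n`
(`exists_nablaLp_le`). Iteration gains several derivatives, and finite volume gives all smaller
exponents (`exists_sobolevNorm_le`).

The embedding of completions is the extension by density. Its injectivity is a closability statement
(`tendsto_sobolevNorm`): if a sequence of test functions is Cauchy in `W^{k,p}` and tends to zero in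
`W^{l,q}`, then integration by parts in each cube shows that every `∇^i u_m`, `i ≤ k`, tends to zero
in `L¹`, and Fatou's lemma improves this to `L^p`. -/

noncomputable section

namespace ConicalSobolev

set_option maxSynthPendingDepth 3
set_option linter.unusedSectionVars false

/-- The model space `ℝⁿ`. -/
abbrev Eu (n : ℕ) : Type := EuclideanSpace ℝ (Fin n)

lemma mlieBracket_model {n : ℕ} (V W : Π y : Eu n, TangentSpace (𝓡 n) y) (z : Eu n) :
    VectorField.mlieBracket (𝓡 n) V W z =
      VectorField.lieBracket ℝ (V : Eu n → Eu n) (W : Eu n → Eu n) z := by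
  rw [← VectorField.mlieBracketWithin_univ, VectorField.mlieBracketWithin_eq_lieBracketWithin]
  exact congrFun (VectorField.lieBracketWithin_univ (𝕜 := ℝ)) z

/-! ### Vector fields and brackets in smooth charts -/

section Charts

variable {n : ℕ} {X : Type*} [TopologicalSpace X] [ChartedSpace (EuclideanSpace ℝ (Fin n)) X]

/-- A diffeomorphism from an open subset of `X` onto an open subset of `ℝⁿ`. -/
structure IsSmoothChart (e : OpenPartialHomeomorph X (Eu n)) : Prop where
  contMDiffOn : ContMDiffOn (𝓡 n) (𝓡 n) ∞ e e.source
  contMDiffOn_symm : ContMDiffOn (𝓡 n) (𝓡 n) ∞ e.symm e.target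

/-- The differential of the inverse of a chart. -/
def frame (e : OpenPartialHomeomorph X (Eu n)) (z : Eu n) :
    Eu n →L[ℝ] TangentSpace (𝓡 n) (e.symm z) :=
  mfderiv (𝓡 n) (𝓡 n) e.symm z

/-- The differential of a chart. -/
def coframe (e : OpenPartialHomeomorph X (Eu n)) (y : X) : TangentSpace (𝓡 n) y →L[ℝ] Eu n :=
  mfderiv (𝓡 n) (𝓡 n) e y

/-- A vector field in the coordinates of a chart. -/
def fieldRepr (e : OpenPartialHomeomorph X (Eu n)) (V : Π y : X, TangentSpace (𝓡 n) y)
    (z : Eu n) : Eu n :=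
  coframe e (e.symm z) (V (e.symm z))

namespace IsSmoothChart

variable {e : OpenPartialHomeomorph X (Eu n)} (he : IsSmoothChart e)
include he

lemma contMDiffAt {y : X} (hy : y ∈ e.source) : ContMDiffAt (𝓡 n) (𝓡 n) ∞ e y :=
  he.contMDiffOn.contMDiffAt (e.open_source.mem_nhds hy)

lemma contMDiffAt_symm {z : Eu n} (hz : z ∈ e.target) : ContMDiffAt (𝓡 n) (𝓡 n) ∞ e.symm z :=
  he.contMDiffOn_symm.contMDiffAt (e.open_target.mem_nhds hz)

lemma coframe_comp_frame {z : Eu n} (hz : z ∈ e.target) :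
    (coframe e (e.symm z)).comp (frame e z) = ContinuousLinearMap.id ℝ (Eu n) := by
  have h1 := (he.contMDiffAt (e.map_target hz)).mdifferentiableAt (by simp)
  have h2 := (he.contMDiffAt_symm hz).mdifferentiableAt (by simp)
  have h3 := mfderiv_comp z h1 h2
  have h4 : mfderiv (𝓡 n) (𝓡 n) (e ∘ e.symm) z = mfderiv (𝓡 n) (𝓡 n) id z := by
    apply Filter.EventuallyEq.mfderiv_eq
    filter_upwards [e.open_target.mem_nhds hz] with w hw
    exact e.right_inv hw
  rw [mfderiv_id] at h4
  exact h3.symm.trans h4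

lemma frame_comp_coframe {z : Eu n} (hz : z ∈ e.target) :
    (frame e z).comp (coframe e (e.symm z)) = ContinuousLinearMap.id ℝ _ := by
  have hy := e.map_target hz
  have h1 := (he.contMDiffAt hy).mdifferentiableAt (by simp)
  have h2 : MDifferentiableAt (𝓡 n) (𝓡 n) e.symm (e (e.symm z)) :=
    (he.contMDiffAt_symm (e.map_source hy)).mdifferentiableAt (by simp)
  have h3 := mfderiv_comp (e.symm z) h2 h1
  have h4 : mfderiv (𝓡 n) (𝓡 n) (e.symm ∘ e) (e.symm z) = mfderiv (𝓡 n) (𝓡 n) id (e.symm z) := by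
    apply Filter.EventuallyEq.mfderiv_eq
    filter_upwards [e.open_source.mem_nhds hy] with w hw
    exact e.left_inv hw
  rw [mfderiv_id] at h4
  have h5 := h3.symm.trans h4
  rw [e.right_inv hz] at h5
  exact h5

@[simp] lemma coframe_frame {z : Eu n} (hz : z ∈ e.target) (w : Eu n) :
    coframe e (e.symm z) (frame e z w) = w :=
  DFunLike.congr_fun (he.coframe_comp_frame hz) w

@[simp] lemma frame_coframe {z : Eu n} (hz : z ∈ e.target) (v : TangentSpace (𝓡 n) (e.symm z)) :
    frame e z (coframe e (e.symm z) v) = v :=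
  DFunLike.congr_fun (he.frame_comp_coframe hz) v

lemma isInvertible_mfderiv_symm {z : Eu n} (hz : z ∈ e.target) :
    (mfderiv (𝓡 n) (𝓡 n) e.symm z).IsInvertible :=
  ContinuousLinearMap.IsInvertible.of_inverse (he.frame_comp_coframe hz) (he.coframe_comp_frame hz)

lemma inverse_mfderiv_symm {z : Eu n} (hz : z ∈ e.target) :
    (mfderiv (𝓡 n) (𝓡 n) e.symm z).inverse = coframe e (e.symm z) :=
  ContinuousLinearMap.inverse_eq (he.frame_comp_coframe hz) (he.coframe_comp_frame hz)

/-- Since the frame is invertible, reading a field in coordinates is pulling it back along `e.symm`.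
Smoothness and Lie brackets of coordinate representatives are then inherited from the calculus of
pullbacks. -/
lemma mpullback_eq_fieldRepr (V : Π y : X, TangentSpace (𝓡 n) y) {z : Eu n} (hz : z ∈ e.target) :
    VectorField.mpullback (𝓡 n) (𝓡 n) e.symm V z = fieldRepr e V z := by
  rw [VectorField.mpullback_apply, he.inverse_mfderiv_symm hz]
  rfl

lemma contDiffAt_fieldRepr [IsManifold (𝓡 n) ∞ X] {V : Π y : X, TangentSpace (𝓡 n) y} {z : Eu n}
    (hz : z ∈ e.target)
    (hV : ContMDiffAt (𝓡 n) (𝓡 n).tangent ∞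
      (fun y => (⟨y, V y⟩ : TangentBundle (𝓡 n) X)) (e.symm z)) :
    ContDiffAt ℝ ∞ (fieldRepr e V) z := by
  have h := ContMDiffAt.mpullback_vectorField_preimage hV (he.contMDiffAt_symm hz)
    (he.isInvertible_mfderiv_symm hz) (by simp)
  rw [contMDiffAt_vectorSpace_iff_contDiffAt] at h
  refine h.congr_of_eventuallyEq ?_
  filter_upwards [e.open_target.mem_nhds hz] with w hw
  exact (he.mpullback_eq_fieldRepr V hw).symm

lemma fieldRepr_mlieBracket [IsManifold (𝓡 n) ∞ X] {V W : Π y : X, TangentSpace (𝓡 n) y} {z : Eu n}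
    (hz : z ∈ e.target)
    (hV : MDifferentiableAt (𝓡 n) (𝓡 n).tangent
      (fun y => (⟨y, V y⟩ : TangentBundle (𝓡 n) X)) (e.symm z))
    (hW : MDifferentiableAt (𝓡 n) (𝓡 n).tangent
      (fun y => (⟨y, W y⟩ : TangentBundle (𝓡 n) X)) (e.symm z)) :
    fieldRepr e (VectorField.mlieBracket (𝓡 n) V W) z =
      fderiv ℝ (fieldRepr e W) z (fieldRepr e V z) -
        fderiv ℝ (fieldRepr e V) z (fieldRepr e W z) := by
  have : IsManifold (𝓡 n) (minSmoothness ℝ 3) X := by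
    simp only [minSmoothness_of_isRCLikeNormedField]
    exact IsManifold.of_le (n := ∞) (WithTop.coe_le_coe.2 le_top)
  have h := VectorField.mpullback_mlieBracket hV hW (he.contMDiffAt_symm hz)
    (by simp only [minSmoothness_of_isRCLikeNormedField]; exact WithTop.coe_le_coe.2 le_top)
  rw [he.mpullback_eq_fieldRepr _ hz] at h
  refine h.trans ?_
  have hc : ∀ U : Π y : X, TangentSpace (𝓡 n) y,
      VectorField.mpullback (𝓡 n) (𝓡 n) e.symm U =ᶠ[𝓝 z] fieldRepr e U := by
    intro U
    filter_upwards [e.open_target.mem_nhds hz] with w hw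
    exact he.mpullback_eq_fieldRepr U hw
  refine ((hc V).mlieBracket_vectorField_eq (hc W)).trans ?_
  exact mlieBracket_model _ _ z

/-- The derivative of a function along a vector field, in the coordinates of a chart. -/
lemma mvfderiv_apply {F : Type*} [NormedAddCommGroup F] [NormedSpace ℝ F] {f : X → F} {z : Eu n} (hz : z ∈ e.target)
    (hf : DifferentiableAt ℝ (f ∘ e.symm) z) (v : TangentSpace (𝓡 n) (e.symm z)) :
    mvfderiv (𝓡 n) f (e.symm z) v = fderiv ℝ (f ∘ e.symm) z (coframe e (e.symm z) v) := by
  have hy := e.map_target hz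
  have h1 := (he.contMDiffAt hy).mdifferentiableAt (by simp)
  have h2 : MDifferentiableAt (𝓡 n) 𝓘(ℝ, F) (f ∘ e.symm) (e (e.symm z)) := by
    rw [e.right_inv hz]; exact hf.mdifferentiableAt
  have h3 := mfderiv_comp (e.symm z) h2 h1
  have h4 : mfderiv (𝓡 n) 𝓘(ℝ, F) ((f ∘ e.symm) ∘ e) (e.symm z) =
      mfderiv (𝓡 n) 𝓘(ℝ, F) f (e.symm z) := by
    apply Filter.EventuallyEq.mfderiv_eq
    filter_upwards [e.open_source.mem_nhds hy] with w hw
    simp [e.left_inv hw]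
  rw [e.right_inv hz, mfderiv_eq_fderiv] at h3
  have h5 := h4.symm.trans h3
  exact DFunLike.congr_fun h5 v

end IsSmoothChart

lemma isSmoothChart_chartAt [IsManifold (𝓡 n) ∞ X] (y : X) : IsSmoothChart (chartAt (Eu n) y) :=
  ⟨contMDiffOn_chart, contMDiffOn_chart_symm⟩

end Charts

/-! ### The connection form determined by a metric and its derivative -/

section ChristoffelForm

attribute [-instance] Bundle.instInnerProductSpaceReal
  Bundle.instNormedAddCommGroupOfRiemannianBundleOfIsTopologicalAddGroupOfContinuousConstSMulReal

variable {E : Type*} [NormedAddCommGroup E] [NormedSpace ℝ E]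

/-- The trilinear form `(a, b, c) ↦ (B a b c + B b c a - B c a b) / 2`. -/
def koszulForm (B : E →L[ℝ] E →L[ℝ] E →L[ℝ] ℝ) : E →L[ℝ] E →L[ℝ] E →L[ℝ] ℝ :=
  (1 / 2 : ℝ) • (B
    + ((ContinuousLinearMap.flipₗᵢ ℝ E E ℝ :
        (E →L[ℝ] E →L[ℝ] ℝ) →L[ℝ] (E →L[ℝ] E →L[ℝ] ℝ)).comp B).flip
    - (ContinuousLinearMap.flipₗᵢ ℝ E E ℝ :
        (E →L[ℝ] E →L[ℝ] ℝ) →L[ℝ] (E →L[ℝ] E →L[ℝ] ℝ)).comp B.flip)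

/-- The bilinear map `Γ` with `G (Γ a b) = koszulForm B a b`. -/
def connectionForm (G : E →L[ℝ] E →L[ℝ] ℝ) (B : E →L[ℝ] E →L[ℝ] E →L[ℝ] ℝ) :
    E →L[ℝ] E →L[ℝ] E :=
  (ContinuousLinearMap.compL ℝ E (E →L[ℝ] ℝ) E G.inverse).comp (koszulForm B)

/-- Inversion of operators is smooth at invertible ones, and the form is bilinear in `G.inverse` and
`B`. -/
lemma contDiffAt_connectionForm [CompleteSpace E] {H : Type*} [NormedAddCommGroup H] [NormedSpace ℝ H]
    {G : H → E →L[ℝ] E →L[ℝ] ℝ} {B : H → E →L[ℝ] E →L[ℝ] E →L[ℝ] ℝ} {z : H}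
    {m : WithTop ℕ∞} (hG : ContDiffAt ℝ m G z) (hG' : (G z).IsInvertible)
    (hB : ContDiffAt ℝ m B z) :
    ContDiffAt ℝ m (fun z => connectionForm (G z) (B z)) z := by
  have hflip : ∀ {f : H → E →L[ℝ] E →L[ℝ] E →L[ℝ] ℝ}, ContDiffAt ℝ m f z →
      ContDiffAt ℝ m (fun z => (f z).flip) z := fun hf =>
    (ContinuousLinearMap.flipₗᵢ ℝ E E (E →L[ℝ] ℝ)).contDiff.contDiffAt.comp z hf
  have h2 : ContDiffAt ℝ m (fun z => koszulForm (B z)) z := by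
    refine ContDiffAt.const_smul _ ((hB.add ?_).sub ?_)
    · exact hflip (contDiffAt_const.clm_comp hB)
    · exact contDiffAt_const.clm_comp (hflip hB)
  exact ((ContinuousLinearMap.compL ℝ E (E →L[ℝ] ℝ) E).contDiff.contDiffAt.comp z
    (hG'.contDiffAt_map_inverse.comp z hG)).clm_comp h2

end ChristoffelForm

/-! ### Metric, Christoffel symbols and Levi-Civita connection in coordinates -/

section Metric

variable {n : ℕ} {X : Type*} [TopologicalSpace X] [ChartedSpace (EuclideanSpace ℝ (Fin n)) X]
  [IsManifold (𝓡 n) ∞ X] [RiemannianBundle (fun y : X => TangentSpace (𝓡 n) y)]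

/-- The metric in the coordinates of a chart. -/
def gram (e : OpenPartialHomeomorph X (Eu n)) (z : Eu n) : Eu n →L[ℝ] Eu n →L[ℝ] ℝ :=
  (innerSL ℝ (E := TangentSpace (𝓡 n) (e.symm z))).bilinearComp (frame e z) (frame e z)

@[simp] lemma gram_apply (e : OpenPartialHomeomorph X (Eu n)) (z a b : Eu n) :
    gram e z a b = inner ℝ (frame e z a) (frame e z b) := rfl

lemma gram_symm (e : OpenPartialHomeomorph X (Eu n)) (z a b : Eu n) :
    gram e z a b = gram e z b a := by
  simp only [gram_apply]; exact real_inner_comm _ _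

lemma gram_eq_inner {e : OpenPartialHomeomorph X (Eu n)} (he : IsSmoothChart e) {z : Eu n}
    (hz : z ∈ e.target) (v w : TangentSpace (𝓡 n) (e.symm z)) :
    gram e z (coframe e (e.symm z) v) (coframe e (e.symm z) w) = inner ℝ v w := by
  rw [gram_apply, he.frame_coframe hz, he.frame_coframe hz]

/-- The coordinate fields `frame e · a` are smooth, being the tangent map of `e.symm` evaluated on
constant fields; smoothness of the bundle metric then applies entry by entry. -/
lemma contDiffAt_gram [IsContMDiffRiemannianBundle (𝓡 n) ∞ (EuclideanSpace ℝ (Fin n))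
    (fun y : X => TangentSpace (𝓡 n) y)] {e : OpenPartialHomeomorph X (Eu n)}
    (he : IsSmoothChart e) {z : Eu n} (hz : z ∈ e.target) : ContDiffAt ℝ ∞ (gram e) z := by
  suffices H : ContDiffOn ℝ ∞ (gram e) e.target from H.contDiffAt (e.open_target.mem_nhds hz)
  have hv : ∀ a : Eu n, ContMDiffOn (𝓡 n) (𝓡 n).tangent ∞
      (fun w => (⟨e.symm w, frame e w a⟩ : TangentBundle (𝓡 n) X)) e.target := by
    intro a
    have h1 := he.contMDiffOn_symm.contMDiffOn_tangentMapWithin (m := ∞) (by simp)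
      e.open_target.uniqueMDiffOn
    have h2 : ContMDiff (𝓡 n) (𝓡 n).tangent ∞
        (fun w : Eu n => (⟨w, a⟩ : TangentBundle (𝓡 n) (Eu n))) := by
      intro w
      rw [contMDiffAt_vectorSpace_iff_contDiffAt (V := fun _ : Eu n => a)]
      exact contDiffAt_const
    refine (h1.comp h2.contMDiffOn (fun w hw => hw)).congr fun w hw => ?_
    simp only [Function.comp, tangentMapWithin]
    congr 1
    rw [mfderivWithin_of_isOpen e.open_target hw]
    rfl
  refine contDiffOn_clm_apply.2 fun a => contDiffOn_clm_apply.2 fun b => ?_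
  rw [← contMDiffOn_iff_contDiffOn]
  exact ContMDiffOn.inner_bundle (hv a) (hv b)

lemma isInvertible_gram {e : OpenPartialHomeomorph X (Eu n)} (he : IsSmoothChart e) {z : Eu n}
    (hz : z ∈ e.target) : (gram e z).IsInvertible := by
  have hinj : Function.Injective (gram e z) := by
    refine (injective_iff_map_eq_zero _).2 fun a ha => ?_
    have h1 : inner ℝ (frame e z a) (frame e z a) = 0 := by
      rw [← gram_apply, ha]; rfl
    rw [inner_self_eq_zero] at h1
    rw [← he.coframe_frame hz a, h1, map_zero]
  have hfin : Module.finrank ℝ (Eu n) = Module.finrank ℝ (Eu n →L[ℝ] ℝ) :=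
    (Subspace.dual_finrank_eq (K := ℝ) (V := Eu n)).symm.trans
      (LinearMap.toContinuousLinearMap (𝕜 := ℝ) (E := Eu n) (F' := ℝ)).finrank_eq
  refine ⟨(LinearEquiv.ofInjectiveOfFinrankEq (gram e z : Eu n →ₗ[ℝ] (Eu n →L[ℝ] ℝ))
    hinj hfin).toContinuousLinearEquiv, ?_⟩
  ext a b
  rfl

/-- The Christoffel symbols: the connection form of the Levi-Civita connection in a chart. -/
def christoffel (e : OpenPartialHomeomorph X (Eu n)) (z : Eu n) : Eu n →L[ℝ] Eu n →L[ℝ] Eu n :=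
  connectionForm (gram e z) (fderiv ℝ (gram e) z)

lemma gram_christoffel {e : OpenPartialHomeomorph X (Eu n)} (he : IsSmoothChart e) {z : Eu n}
    (hz : z ∈ e.target) (a b c : Eu n) :
    gram e z (christoffel e z a b) c = (1 / 2 : ℝ) * (fderiv ℝ (gram e) z a b c
      + fderiv ℝ (gram e) z b c a - fderiv ℝ (gram e) z c a b) := by
  have : gram e z ((gram e z).inverse (koszulForm (fderiv ℝ (gram e) z) a b)) = _ :=
    (isInvertible_gram he hz).self_apply_inverse _
  exact DFunLike.congr_fun this c

lemma contMDiffAt_extendVec {y : X} (v : TangentSpace (𝓡 n) y) :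
    ContMDiffAt (𝓡 n) (𝓡 n).tangent ∞
      (fun w => (⟨w, extendVec v w⟩ : TangentBundle (𝓡 n) X)) y :=
  FiberBundle.contMDiffAt_extend (𝓡 n) (EuclideanSpace ℝ (Fin n)) v

variable [IsContMDiffRiemannianBundle (𝓡 n) ∞ (EuclideanSpace ℝ (Fin n))
    (fun y : X => TangentSpace (𝓡 n) y)] {e : OpenPartialHomeomorph X (Eu n)}
    (he : IsSmoothChart e) {z : Eu n} (hz : z ∈ e.target)
include he hz

lemma contDiffAt_fderiv_gram : ContDiffAt ℝ ∞ (fderiv ℝ (gram e)) z :=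
  (contDiffAt_gram he hz).fderiv_right (m := ∞) (by simp)

lemma contDiffAt_christoffel : ContDiffAt ℝ ∞ (christoffel e) z :=
  contDiffAt_connectionForm (contDiffAt_gram he hz) (isInvertible_gram he hz)
    (contDiffAt_fderiv_gram he hz)

/-- Metric compatibility of the Christoffel symbols. -/
lemma fderiv_gram_apply (a b c : Eu n) :
    fderiv ℝ (gram e) z a b c =
      gram e z (christoffel e z a b) c + gram e z b (christoffel e z a c) := by
  -- The metric is symmetric at every point, so its derivative is symmetric in the last two slots.
  have hs : ∀ a b c, fderiv ℝ (gram e) z a b c = fderiv ℝ (gram e) z a c b := by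
    intro a b c
    have hd := ((contDiffAt_gram he hz).differentiableAt (by simp)).hasFDerivAt
    have e1 : HasFDerivAt (fun z => gram e z b c) _ z :=
      (hd.clm_apply (hasFDerivAt_const b z)).clm_apply (hasFDerivAt_const c z)
    have e2 : HasFDerivAt (fun z => gram e z c b) _ z :=
      (hd.clm_apply (hasFDerivAt_const c z)).clm_apply (hasFDerivAt_const b z)
    have e3 : (fun z => gram e z b c) = fun z => gram e z c b := by
      ext z; exact gram_symm e z b c
    rw [e3] at e1
    have := DFunLike.congr_fun (e1.unique e2) a
    simpa using this
  rw [gram_symm e z b, gram_christoffel he hz, gram_christoffel he hz, hs b c a, hs c b a, hs a c b]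
  ring

lemma mvfderiv_inner {V W : Π y : X, TangentSpace (𝓡 n) y}
    (hV : DifferentiableAt ℝ (fieldRepr e V) z) (hW : DifferentiableAt ℝ (fieldRepr e W) z)
    (v : TangentSpace (𝓡 n) (e.symm z)) :
    mvfderiv (𝓡 n) (fun y => inner ℝ (V y) (W y)) (e.symm z) v =
      fderiv ℝ (gram e) z (coframe e (e.symm z) v) (fieldRepr e V z) (fieldRepr e W z)
      + gram e z (fderiv ℝ (fieldRepr e V) z (coframe e (e.symm z) v)) (fieldRepr e W z)
      + gram e z (fieldRepr e V z) (fderiv ℝ (fieldRepr e W) z (coframe e (e.symm z) v)) := by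
  have h1 : (fun y : X => (inner ℝ (V y) (W y) : ℝ)) ∘ e.symm =ᶠ[𝓝 z]
      fun w => gram e w (fieldRepr e V w) (fieldRepr e W w) := by
    filter_upwards [e.open_target.mem_nhds hz] with w hw
    exact (gram_eq_inner he hw _ _).symm
  have h2 : HasFDerivAt (fun w => gram e w (fieldRepr e V w) (fieldRepr e W w)) _ z :=
    (((contDiffAt_gram he hz).differentiableAt (by simp)).hasFDerivAt.clm_apply
      hV.hasFDerivAt).clm_apply hW.hasFDerivAt
  have h3 := h2.congr_of_eventuallyEq h1
  rw [he.mvfderiv_apply hz h3.differentiableAt, h3.fderiv]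
  simp only [add_apply, ContinuousLinearMap.coe_comp, Function.comp_apply,
    ContinuousLinearMap.flip_apply]
  ring

/-- The derivatives of the metric assemble into the Christoffel form. Among the derivatives of the
fields, the brackets cancel everything except two copies of the derivative of `V` along `U`. -/
lemma koszul_eq {U V W : Π y : X, TangentSpace (𝓡 n) y}
    (hU : ContMDiffAt (𝓡 n) (𝓡 n).tangent ∞
      (fun y => (⟨y, U y⟩ : TangentBundle (𝓡 n) X)) (e.symm z))
    (hV : ContMDiffAt (𝓡 n) (𝓡 n).tangent ∞
      (fun y => (⟨y, V y⟩ : TangentBundle (𝓡 n) X)) (e.symm z))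
    (hW : ContMDiffAt (𝓡 n) (𝓡 n).tangent ∞
      (fun y => (⟨y, W y⟩ : TangentBundle (𝓡 n) X)) (e.symm z)) :
    koszul U V W (e.symm z) =
      2 * gram e z (fderiv ℝ (fieldRepr e V) z (fieldRepr e U z)
        + christoffel e z (fieldRepr e U z) (fieldRepr e V z)) (fieldRepr e W z) := by
  have dU := (he.contDiffAt_fieldRepr hz hU).differentiableAt (by simp)
  have dV := (he.contDiffAt_fieldRepr hz hV).differentiableAt (by simp)
  have dW := (he.contDiffAt_fieldRepr hz hW).differentiableAt (by simp)
  have hb : ∀ {A B C : Π y : X, TangentSpace (𝓡 n) y},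
      ContMDiffAt (𝓡 n) (𝓡 n).tangent ∞
        (fun y => (⟨y, A y⟩ : TangentBundle (𝓡 n) X)) (e.symm z) →
      ContMDiffAt (𝓡 n) (𝓡 n).tangent ∞
        (fun y => (⟨y, B y⟩ : TangentBundle (𝓡 n) X)) (e.symm z) →
      inner ℝ (VectorField.mlieBracket (𝓡 n) A B (e.symm z)) (C (e.symm z)) =
        gram e z (fderiv ℝ (fieldRepr e B) z (fieldRepr e A z)) (fieldRepr e C z)
          - gram e z (fderiv ℝ (fieldRepr e A) z (fieldRepr e B z)) (fieldRepr e C z) := by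
    intro A B C hA hB
    have h := he.fieldRepr_mlieBracket hz (hA.mdifferentiableAt (by simp))
      (hB.mdifferentiableAt (by simp))
    rw [← gram_eq_inner he hz]
    change gram e z (fieldRepr e (VectorField.mlieBracket (𝓡 n) A B) z) (fieldRepr e C z) = _
    rw [h, map_sub]
    rfl
  rw [koszul, mvfderiv_inner he hz dV dW, mvfderiv_inner he hz dW dU, mvfderiv_inner he hz dU dV,
    hb hU hV, hb hU hW, hb hV hW, map_add]
  change _ = 2 * (gram e z _ _ + gram e z (christoffel e z _ _) _)
  rw [gram_christoffel he hz]
  change fderiv ℝ (gram e) z (fieldRepr e U z) _ _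
    + gram e z (fderiv ℝ (fieldRepr e V) z (fieldRepr e U z)) _
    + gram e z _ (fderiv ℝ (fieldRepr e W) z (fieldRepr e U z))
    + (fderiv ℝ (gram e) z (fieldRepr e V z) _ _
    + gram e z (fderiv ℝ (fieldRepr e W) z (fieldRepr e V z)) _
    + gram e z _ (fderiv ℝ (fieldRepr e U) z (fieldRepr e V z)))
    - (fderiv ℝ (gram e) z (fieldRepr e W z) _ _
    + gram e z (fderiv ℝ (fieldRepr e U) z (fieldRepr e W z)) _
    + gram e z _ (fderiv ℝ (fieldRepr e V) z (fieldRepr e W z))) + _ - _ - _ = _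
  simp only [gram_symm e z (fieldRepr e U z) _, gram_symm e z (fieldRepr e V z) _,
    gram_symm e z (fieldRepr e W z) _]
  ring

/-- By `koszul_eq` half the Koszul expression is the inner product of the extended vector with a
fixed vector, and the orthonormal expansion in the definition recovers that vector. The choices of
extensions and of basis thus drop out. -/
lemma coframe_leviCivita {V : Π y : X, TangentSpace (𝓡 n) y}
    (hV : ContMDiffAt (𝓡 n) (𝓡 n).tangent ∞
      (fun y => (⟨y, V y⟩ : TangentBundle (𝓡 n) X)) (e.symm z))
    (v : TangentSpace (𝓡 n) (e.symm z)) :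
    coframe e (e.symm z) (leviCivita V (e.symm z) v) =
      fderiv ℝ (fieldRepr e V) z (coframe e (e.symm z) v)
        + christoffel e z (coframe e (e.symm z) v) (fieldRepr e V z) := by
  set R := fderiv ℝ (fieldRepr e V) z (coframe e (e.symm z) v)
        + christoffel e z (coframe e (e.symm z) v) (fieldRepr e V z) with hR
  suffices H : leviCivita V (e.symm z) v = frame e z R by rw [H, he.coframe_frame hz]
  have key : ∀ w : TangentSpace (𝓡 n) (e.symm z),
      (1 / 2 : ℝ) * koszul (extendVec v) V (extendVec w) (e.symm z) = inner ℝ w (frame e z R) := by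
    intro w
    have hv1 : fieldRepr e (extendVec v) z = coframe e (e.symm z) v := by
      rw [fieldRepr, extendVec, FiberBundle.extend_apply_self]
    have hw1 : fieldRepr e (extendVec w) z = coframe e (e.symm z) w := by
      rw [fieldRepr, extendVec, FiberBundle.extend_apply_self]
    rw [koszul_eq he hz (contMDiffAt_extendVec v) hV (contMDiffAt_extendVec w),
      hv1, hw1, ← hR, gram_apply, he.frame_coframe hz, real_inner_comm]
    ring
  rw [leviCivita]
  simp_rw [key]
  exact (tangentONB (e.symm z)).sum_repr' _

end Metric

/-! ### Covariant derivatives of tensor fields on a normed space -/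

section CovariantTensor

attribute [-instance] Bundle.instInnerProductSpaceReal
  Bundle.instNormedAddCommGroupOfRiemannianBundleOfIsTopologicalAddGroupOfContinuousConstSMulReal

variable {E : Type*} [NormedAddCommGroup E] [NormedSpace ℝ E]

/-- Covariant tensors of rank `i`. -/
abbrev CovTensor (E : Type*) [NormedAddCommGroup E] [NormedSpace ℝ E] (i : ℕ) : Type _ :=
  ContinuousMultilinearMap ℝ (fun _ : Fin i => E) ℝ

/-- The derivation of the tensor algebra induced by an endomorphism. -/
def tensorDerivation (E : Type*) [NormedAddCommGroup E] [NormedSpace ℝ E] (i : ℕ) :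
    (E →L[ℝ] E) →L[ℝ] CovTensor E i →L[ℝ] CovTensor E i :=
  -- The pullback of tensors is multilinear in the family of endomorphisms; the derivation is its
  -- linearization at the identity, restricted to constant families.
  ((ContinuousMultilinearMap.compContinuousLinearMapContinuousMultilinear ℝ
    (fun _ : Fin i => E) (fun _ : Fin i => E) ℝ).linearDeriv
      (fun _ => ContinuousLinearMap.id ℝ E)).comp
    (ContinuousLinearMap.pi fun _ => ContinuousLinearMap.id ℝ (E →L[ℝ] E))

lemma tensorDerivation_apply {i : ℕ} (A : E →L[ℝ] E) (T : CovTensor E i) (w : Fin i → E) :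
    tensorDerivation E i A T w = ∑ j, T (Function.update w j (A (w j))) := by
  simp only [tensorDerivation, ContinuousLinearMap.comp_apply,
    ContinuousMultilinearMap.linearDeriv_apply, sum_apply]
  refine Finset.sum_congr rfl fun j _ => ?_
  simp only [ContinuousMultilinearMap.compContinuousLinearMapContinuousMultilinear_apply_apply]
  change T (fun k => Function.update (fun _ => ContinuousLinearMap.id ℝ E) j A k (w k)) = _
  congr 1
  ext k : 1
  by_cases h : k = j
  · subst h; simp
  · simp [h]

/-- The covariant derivative of a tensor field on `E` for the connection form `Γ`. -/
def covDeriv {i : ℕ} (Γ : E → E →L[ℝ] E →L[ℝ] E) (T : E → CovTensor E i) (z : E) :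
    CovTensor E (i + 1) :=
  (continuousMultilinearCurryLeftEquiv ℝ (fun _ : Fin (i + 1) => E) ℝ).symm
    (fderiv ℝ T z - ((tensorDerivation E i).flip (T z)).comp (Γ z))

lemma covDeriv_apply {i : ℕ} (Γ : E → E →L[ℝ] E →L[ℝ] E) (T : E → CovTensor E i) (z : E)
    (w : Fin (i + 1) → E) :
    covDeriv Γ T z w = fderiv ℝ T z (w 0) (fun j => w j.succ)
      - ∑ j : Fin i, T z (Function.update (fun j => w j.succ) j (Γ z (w 0) (w j.succ))) := by
  rw [covDeriv, continuousMultilinearCurryLeftEquiv_symm_apply]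
  change fderiv ℝ T z (w 0) (fun j => w j.succ)
    - tensorDerivation E i (Γ z (w 0)) (T z) (fun j => w j.succ) = _
  rw [tensorDerivation_apply]

lemma contDiffAt_covDeriv {i : ℕ} {Γ : E → E →L[ℝ] E →L[ℝ] E} {T : E → CovTensor E i} {z : E}
    (hΓ : ContDiffAt ℝ ∞ Γ z) (hT : ContDiffAt ℝ ∞ T z) : ContDiffAt ℝ ∞ (covDeriv Γ T) z := by
  refine (LinearIsometryEquiv.contDiff _).contDiffAt.comp z ?_
  refine (hT.fderiv_right (m := ∞) (by simp)).sub (ContDiffAt.clm_comp ?_ hΓ)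
  exact (ContinuousLinearMap.contDiff _).contDiffAt.comp z hT

/-- The derivative of the contraction of a tensor field with vector fields. -/
lemma hasFDerivAt_tensor_apply {i : ℕ} {T : E → CovTensor E i} {V : Fin i → E → E} {z : E}
    (Γ : E → E →L[ℝ] E →L[ℝ] E)
    (hT : DifferentiableAt ℝ T z) (hV : ∀ j, DifferentiableAt ℝ (V j) z) :
    DifferentiableAt ℝ (fun w => T w (fun j => V j w)) z ∧ ∀ v,
      fderiv ℝ (fun w => T w (fun j => V j w)) z v = covDeriv Γ T z (Fin.cons v (fun j => V j z))
        + ∑ j, T z (Function.update (fun j => V j z) j (fderiv ℝ (V j) z v + Γ z v (V j z))) := by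
  have h := hT.hasFDerivAt.continuousMultilinearMap_apply (fun j => (hV j).hasFDerivAt)
  refine ⟨h.differentiableAt, fun v => ?_⟩
  rw [h.fderiv, covDeriv_apply]
  simp only [Fin.cons_zero, Fin.cons_succ, ContinuousMultilinearMap.map_update_add,
    Finset.sum_add_distrib]
  simp only [add_apply, sum_apply,
    ContinuousLinearMap.comp_apply, ContinuousMultilinearMap.toContinuousLinearMap_apply]
  simp only [ContinuousMultilinearMap.apply_apply]
  ring

end CovariantTensor

/-! ### Iterated covariant derivatives in coordinates -/

section NablaRepr

variable {n : ℕ} {X : Type*} [TopologicalSpace X] [ChartedSpace (EuclideanSpace ℝ (Fin n)) X]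
  [IsManifold (𝓡 n) ∞ X] [RiemannianBundle (fun y : X => TangentSpace (𝓡 n) y)]

/-- The iterated covariant derivative of a function in the coordinates of a chart. -/
def nablaRepr (e : OpenPartialHomeomorph X (Eu n)) (u : X → ℝ) : (i : ℕ) → Eu n → CovTensor (Eu n) i
  | 0 => fun z => ContinuousMultilinearMap.uncurry0 ℝ (Eu n) (u (e.symm z))
  | i + 1 => covDeriv (christoffel e) (nablaRepr e u i)

variable [IsContMDiffRiemannianBundle (𝓡 n) ∞ (EuclideanSpace ℝ (Fin n))
    (fun y : X => TangentSpace (𝓡 n) y)] {e : OpenPartialHomeomorph X (Eu n)}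
    (he : IsSmoothChart e) {u : X → ℝ}
include he

lemma contDiffAt_nablaRepr {z : Eu n} (hz : z ∈ e.target)
    (hu : ContMDiffAt (𝓡 n) 𝓘(ℝ, ℝ) ∞ u (e.symm z)) (i : ℕ) :
    ContDiffAt ℝ ∞ (nablaRepr e u i) z := by
  induction i with
  | zero =>
    have h1 : ContDiffAt ℝ ∞ (u ∘ e.symm) z :=
      contMDiffAt_iff_contDiffAt.1 (hu.comp z (he.contMDiffAt_symm hz))
    exact (continuousMultilinearCurryFin0 ℝ (Eu n) ℝ).symm.contDiff.contDiffAt.comp z h1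
  | succ i ih => exact contDiffAt_covDeriv (contDiffAt_christoffel he hz) ih

/-- This is where the recursive definition is seen to be tensorial: differentiating the contraction
with extended vectors also differentiates the extensions, and the subtracted terms remove exactly
those contributions, by the coordinate formula for the connection. -/
theorem nablaIter_eq (hu : ContMDiff (𝓡 n) 𝓘(ℝ, ℝ) ∞ u) (i : ℕ) :
    ∀ z ∈ e.target, ∀ v : Fin i → TangentSpace (𝓡 n) (e.symm z),
      nablaIter u i (e.symm z) v = nablaRepr e u i z (fun j => coframe e (e.symm z) (v j)) := by
  induction i with
  | zero => intro z _ v; rfl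
  | succ i ih =>
    intro z hz v
    have hV : ∀ j : Fin i, ContMDiffAt (𝓡 n) (𝓡 n).tangent ∞
        (fun w => (⟨w, extendVec (v j.succ) w⟩ : TangentBundle (𝓡 n) X)) (e.symm z) :=
      fun j => contMDiffAt_extendVec _
    have hext : ∀ j : Fin i, fieldRepr e (extendVec (v j.succ)) z =
        coframe e (e.symm z) (v j.succ) := by
      intro j
      rw [fieldRepr, extendVec, FiberBundle.extend_apply_self]
    have hf : (fun y => nablaIter u i y (fun j => extendVec (v j.succ) y)) ∘ e.symm =ᶠ[𝓝 z]
        fun w => nablaRepr e u i w (fun j => fieldRepr e (extendVec (v j.succ)) w) := by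
      filter_upwards [e.open_target.mem_nhds hz] with w hw
      exact ih w hw _
    obtain ⟨h1, h2⟩ := hasFDerivAt_tensor_apply (christoffel e)
      ((contDiffAt_nablaRepr he hz hu.contMDiffAt i).differentiableAt (by simp))
      (fun j => (he.contDiffAt_fieldRepr hz (hV j)).differentiableAt (by simp))
    rw [nablaIter, he.mvfderiv_apply hz (h1.congr_of_eventuallyEq hf), hf.fderiv_eq, h2]
    have h3 : ∀ j : Fin i, nablaIter u i (e.symm z) (Function.update (fun j => v j.succ) j
        (leviCivita (extendVec (v j.succ)) (e.symm z) (v 0))) =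
        nablaRepr e u i z (Function.update (fun j => fieldRepr e (extendVec (v j.succ)) z) j
          (fderiv ℝ (fieldRepr e (extendVec (v j.succ))) z (coframe e (e.symm z) (v 0)) +
            christoffel e z (coframe e (e.symm z) (v 0))
              (fieldRepr e (extendVec (v j.succ)) z))) := by
      intro j
      rw [ih z hz, ← coframe_leviCivita he hz (hV j)]
      congr 1
      ext k : 1
      by_cases hk : k = j
      · subst hk; simp
      · simp [hk, hext]
    -- The sum over `j` from the product rule cancels the correction terms.
    rw [Finset.sum_congr rfl fun j _ => h3 j, add_sub_cancel_right]
    change covDeriv (christoffel e) (nablaRepr e u i) z _ =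
      covDeriv (christoffel e) (nablaRepr e u i) z _
    congr 1
    ext k : 1
    refine Fin.cases ?_ (fun k => ?_) k
    · rfl
    · exact hext k

end NablaRepr

/-! ### Dual frames and the derivative of the squared norm of a tensor -/

section DualFrames

attribute [-instance] Bundle.instInnerProductSpaceReal
  Bundle.instNormedAddCommGroupOfRiemannianBundleOfIsTopologicalAddGroupOfContinuousConstSMulReal

variable {E : Type*} [NormedAddCommGroup E] [NormedSpace ℝ E] {ι κ : Type*} [Fintype ι] [Fintype κ]

/-- The families `b` and `b'` are dual to each other for the bilinear form `G`. -/
def IsDualPair (G : E →L[ℝ] E →L[ℝ] ℝ) (b b' : ι → E) : Prop :=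
  ∀ w, ∑ j, G w (b' j) • b j = w

/-- The contraction of two covariant tensors does not depend on the choice of dual frames. -/
lemma IsDualPair.sum_eq [DecidableEq ι] [DecidableEq κ] {G : E →L[ℝ] E →L[ℝ] ℝ} {e : κ → E}
    {b b' : ι → E} (hG : ∀ a c, G a c = G c a) (he : IsDualPair G e e) (hb : IsDualPair G b b')
    {i : ℕ} (T S : CovTensor E i) :
    ∑ a : Fin i → κ, T (fun s => e (a s)) * S (fun s => e (a s)) =
      ∑ J : Fin i → ι, T (fun s => b (J s)) * S (fun s => b' (J s)) := by
  -- Expanding `T` in the frame `b` and `S` in the frame `e` turns both sides into the same double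
  -- sum, with kernel `∏ s, G (e (a s)) (b' (J s))`.
  have h1 : ∀ a : Fin i → κ, T (fun s => e (a s)) =
      ∑ J : Fin i → ι, (∏ s, G (e (a s)) (b' (J s))) * T (fun s => b (J s)) := by
    intro a
    conv_lhs => rw [show (fun s => e (a s)) = fun s => ∑ j, G (e (a s)) (b' j) • b j from
      funext fun s => (hb (e (a s))).symm]
    rw [T.map_sum]
    refine Finset.sum_congr rfl fun J _ => ?_
    rw [T.map_smul_univ, smul_eq_mul]
  have h2 : ∀ J : Fin i → ι, S (fun s => b' (J s)) =
      ∑ a : Fin i → κ, (∏ s, G (e (a s)) (b' (J s))) * S (fun s => e (a s)) := by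
    intro J
    conv_lhs => rw [show (fun s => b' (J s)) = fun s => ∑ j, G (b' (J s)) (e j) • e j from
      funext fun s => (he (b' (J s))).symm]
    rw [S.map_sum]
    refine Finset.sum_congr rfl fun a _ => ?_
    rw [S.map_smul_univ, smul_eq_mul]
    simp_rw [hG (b' _)]
  simp_rw [h1, h2, Finset.sum_mul, Finset.mul_sum]
  rw [Finset.sum_comm]
  refine Finset.sum_congr rfl fun J _ => Finset.sum_congr rfl fun a _ => ?_
  ring

/-- Pairing with a family of vectors. -/
def framePairing (G : E →L[ℝ] E →L[ℝ] ℝ) (b : ι → E) : E →L[ℝ] (ι → ℝ) :=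
  ContinuousLinearMap.pi fun k => G.flip (b k)

@[simp] lemma framePairing_apply (G : E →L[ℝ] E →L[ℝ] ℝ) (b : ι → E) (w : E) (k : ι) :
    framePairing G b w k = G w (b k) := rfl

/-- The frame dual to `b`. -/
def dualFrame [DecidableEq ι] (G : E →L[ℝ] E →L[ℝ] ℝ) (b : ι → E) (j : ι) : E :=
  (framePairing G b).inverse (Pi.single j 1)

variable [DecidableEq ι] {G : E →L[ℝ] E →L[ℝ] ℝ} {b : ι → E}

lemma apply_dualFrame (hP : (framePairing G b).IsInvertible) (j k : ι) :
    G (dualFrame G b j) (b k) = if k = j then 1 else 0 := by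
  have := congrFun (hP.self_apply_inverse (Pi.single j (1 : ℝ))) k
  rw [framePairing_apply] at this
  rw [dualFrame, this, Pi.single_apply]

/-- The construction directly gives the expansion of `x` in the dual frame with coefficients `G x (b
k)`; symmetry and nondegeneracy of `G` allow the two frames to be exchanged. -/
lemma isDualPair_dualFrame (hG : ∀ a c, G a c = G c a) (hG' : Function.Injective G)
    (hP : (framePairing G b).IsInvertible) : IsDualPair G b (dualFrame G b) := by
  have h1 : ∀ x, x = ∑ k, G x (b k) • dualFrame G b k := by
    intro x
    conv_lhs => rw [← hP.inverse_apply_self x, ← Finset.univ_sum_single (framePairing G b x)]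
    rw [map_sum]
    refine Finset.sum_congr rfl fun k _ => ?_
    rw [dualFrame, ← map_smul, ← Pi.single_smul, framePairing_apply, smul_eq_mul, mul_one]
  intro w
  apply hG'
  ext x
  rw [hG _ x, hG w x]
  conv_rhs => rw [h1 x]
  simp only [map_sum, map_smul, sum_apply, smul_apply, smul_eq_mul]
  refine Finset.sum_congr rfl fun k _ => ?_
  rw [hG w]
  ring

lemma isInvertible_framePairing_of_isDualPair {e : ι → E} (he : IsDualPair G e e)
    (he' : ∀ j k, G (e j) (e k) = if k = j then 1 else 0) :
    (framePairing G e).IsInvertible := by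
  refine ContinuousLinearMap.IsInvertible.of_inverse
    (g := ∑ j, (ContinuousLinearMap.proj (R := ℝ) (φ := fun _ : ι => ℝ) j).smulRight (e j)) ?_ ?_
  · ext x k
    simp [sum_apply, he']
  · ext w
    simpa [sum_apply] using he w

section Derivative

variable [CompleteSpace E] {G : E → E →L[ℝ] E →L[ℝ] ℝ} {b : ι → E → E} {z : E}

lemma contDiffAt_framePairing {m : WithTop ℕ∞} (hG : ContDiffAt ℝ m G z)
    (hb : ∀ j, ContDiffAt ℝ m (b j) z) :
    ContDiffAt ℝ m (fun w => framePairing (G w) (fun j => b j w)) z := by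
  have h1 : ∀ j, ContDiffAt ℝ m (fun w => (G w).flip (b j w)) z := fun j =>
    ContDiffAt.clm_apply ((ContinuousLinearMap.flipₗᵢ ℝ E E ℝ).contDiff.contDiffAt.comp z hG) (hb j)
  have h2 : (fun w => framePairing (G w) (fun j => b j w)) =
      fun w => ∑ j, ((G w).flip (b j w)).smulRight (Pi.single j (1 : ℝ) : ι → ℝ) := by
    ext w x k
    simp [sum_apply, Pi.single_apply]
  rw [h2]
  exact ContDiffAt.sum fun j _ => (h1 j).smulRight contDiffAt_const

lemma contDiffAt_dualFrame {m : WithTop ℕ∞} (hG : ContDiffAt ℝ m G z)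
    (hb : ∀ j, ContDiffAt ℝ m (b j) z)
    (hP : (framePairing (G z) (fun j => b j z)).IsInvertible) (j : ι) :
    ContDiffAt ℝ m (fun w => dualFrame (G w) (fun j => b j w) j) z :=
  (hP.contDiffAt_map_inverse.comp z (contDiffAt_framePairing hG hb)).clm_apply contDiffAt_const

lemma contDiffAt_tensor_apply {i : ℕ} {m : WithTop ℕ∞} {T : E → CovTensor E i} {V : Fin i → E → E}
    (hT : ContDiffAt ℝ m T z) (hV : ∀ j, ContDiffAt ℝ m (V j) z) :
    ContDiffAt ℝ m (fun w => T w (fun j => V j w)) z := by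
  have h := ((ContinuousLinearMap.id ℝ (CovTensor E i)).analyticOnNhd_uncurry_of_multilinear
    (s := univ)).contDiff (n := m)
  exact h.contDiffAt.comp z (hT.prodMk (contDiffAt_pi.2 hV))

/-- A frame with vanishing covariant derivative at `z`. -/
def normalFrame (Γ : E →L[ℝ] E →L[ℝ] E) (z : E) (e : ι → E) (j : ι) (w : E) : E :=
  e j - Γ (w - z) (e j)

/-- The squared norm of a tensor field is smooth; its derivative is computed by means of a frame
with vanishing covariant derivative at a point. -/
theorem contDiffAt_tensor_sq {i : ℕ} {T : E → CovTensor E i} {Γ : E → E →L[ℝ] E →L[ℝ] E}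
    {e : ι → E} {Q : E → ℝ} (hG : ContDiffAt ℝ ∞ G z)
    (hsymm : ∀ w a c, G w a c = G w c a)
    (hinj : ∀ᶠ w in 𝓝 z, Function.Injective (G w))
    (hΓ : ∀ a b c, fderiv ℝ G z a b c = G z (Γ z a b) c + G z b (Γ z a c))
    (he : IsDualPair (G z) e e) (he' : ∀ j k, G z (e j) (e k) = if k = j then 1 else 0)
    (hT : ContDiffAt ℝ ∞ T z)
    (hQ : ∀ᶠ w in 𝓝 z, ∀ b b' : ι → E, IsDualPair (G w) b b' →
      Q w = ∑ J : Fin i → ι, T w (fun s => b (J s)) * T w (fun s => b' (J s))) :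
    ContDiffAt ℝ ∞ Q z ∧ ∀ v, fderiv ℝ Q z v =
      2 * ∑ J : Fin i → ι, T z (fun s => e (J s)) *
        covDeriv Γ T z (Fin.cons v (fun s => e (J s))) := by
  -- Both `b` and its dual `b'` equal `e` at `z` and are parallel there. Contracting with them
  -- computes `Q` near `z`, and differentiating at `z` leaves only the covariant derivative of `T`.
  -- An orthonormal frame near `z` is not needed.
  set b : ι → E → E := normalFrame (Γ z) z e with hb
  set b' : ι → E → E := fun j w => dualFrame (G w) (fun j => b j w) j with hb'
  have hbz : ∀ j, b j z = e j := fun j => by simp [hb, normalFrame]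
  have hbd : ∀ j, HasFDerivAt (b j) (-(Γ z).flip (e j)) z := by
    intro j
    have : HasFDerivAt (fun w => e j - (Γ z).flip (e j) (w - z)) (0 - ((Γ z).flip (e j)).comp
        (ContinuousLinearMap.id ℝ E)) z :=
      (hasFDerivAt_const _ _).sub
        (((Γ z).flip (e j)).hasFDerivAt.comp z ((hasFDerivAt_id z).sub_const z))
    rw [zero_sub, ContinuousLinearMap.comp_id] at this
    exact this
  have hbs : ∀ j, ContDiffAt ℝ ∞ (b j) z := by
    intro j
    have : ContDiffAt ℝ ∞ (fun w => e j - (Γ z).flip (e j) (w - z)) z :=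
      contDiffAt_const.sub
        (((Γ z).flip (e j)).contDiff.contDiffAt.comp z (contDiffAt_id.sub contDiffAt_const))
    exact this
  have hbz' : (fun j => b j z) = e := funext hbz
  have hP : (framePairing (G z) (fun j => b j z)).IsInvertible := by
    rw [hbz']; exact isInvertible_framePairing_of_isDualPair he he'
  have hPev : ∀ᶠ w in 𝓝 z, (framePairing (G w) (fun j => b j w)).IsInvertible := by
    obtain ⟨A, hA⟩ := hP
    have hc := (contDiffAt_framePairing hG hbs).continuousAt
    have hn : range ((↑) : (E ≃L[ℝ] (ι → ℝ)) → E →L[ℝ] (ι → ℝ)) ∈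
        𝓝 (framePairing (G z) (fun j => b j z)) := by
      rw [← hA]; exact ContinuousLinearEquiv.nhds A
    filter_upwards [hc.preimage_mem_nhds hn] with w ⟨B, hB⟩
    exact ⟨B, hB⟩
  have hbs' : ∀ j, ContDiffAt ℝ ∞ (b' j) z := fun j => contDiffAt_dualFrame hG hbs hP j
  have hbz'' : ∀ j, b' j z = e j := by
    intro j
    rw [← he (b' j z)]
    have h1 : ∀ k, G z (b' j z) (e k) = if k = j then 1 else 0 := by
      intro k
      rw [← hbz k]
      exact apply_dualFrame hP j k
    simp [h1]
  -- The pairing of `b' j` with `b k` is constant; differentiating it and using the compatibility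
  -- `hΓ`, the terms involving the derivative of `b k` cancel.
  have hbd' : ∀ j v, fderiv ℝ (b' j) z v + Γ z v (b' j z) = 0 := by
    intro j v
    have h1 : ∀ k, G z (fderiv ℝ (b' j) z v + Γ z v (b' j z)) (e k) = 0 := by
      intro k
      have h2 : HasFDerivAt (fun w => G w (b' j w) (b k w)) _ z :=
        ((hG.differentiableAt (by simp)).hasFDerivAt.clm_apply
          ((hbs' j).differentiableAt (by simp)).hasFDerivAt).clm_apply (hbd k)
      have h3 : (fun w => G w (b' j w) (b k w)) =ᶠ[𝓝 z] fun _ => if k = j then 1 else 0 := by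
        filter_upwards [hPev] with w hw
        exact apply_dualFrame hw j k
      have h4 := h2.unique ((hasFDerivAt_const _ z).congr_of_eventuallyEq h3)
      have h5 := DFunLike.congr_fun h4 v
      simp only [add_apply, ContinuousLinearMap.comp_apply, ContinuousLinearMap.flip_apply,
        neg_apply, map_neg, hΓ, hbz, zero_apply] at h5
      rw [map_add, add_apply]
      linarith
    rw [← he (fderiv ℝ (b' j) z v + Γ z v (b' j z))]
    simp only [h1, zero_smul, Finset.sum_const_zero]
  have hev : Q =ᶠ[𝓝 z] fun w => ∑ J : Fin i → ι,
      T w (fun s => b (J s) w) * T w (fun s => b' (J s) w) := by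
    filter_upwards [hPev, hinj, hQ] with w h1 h2 h3
    exact h3 _ _ (isDualPair_dualFrame (hsymm w) h2 h1)
  have hs : ContDiffAt ℝ ∞ (fun w => ∑ J : Fin i → ι,
      T w (fun s => b (J s) w) * T w (fun s => b' (J s) w)) z :=
    ContDiffAt.sum fun J _ => (contDiffAt_tensor_apply hT fun s => hbs _).mul
      (contDiffAt_tensor_apply hT fun s => hbs' _)
  refine ⟨hs.congr_of_eventuallyEq hev, fun v => ?_⟩
  have hTd := hT.differentiableAt (by simp : (∞ : WithTop ℕ∞) ≠ 0)
  have d1 : ∀ J : Fin i → ι, DifferentiableAt ℝ (fun w => T w (fun s => b (J s) w)) z ∧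
      fderiv ℝ (fun w => T w (fun s => b (J s) w)) z v =
        covDeriv Γ T z (Fin.cons v (fun s => e (J s))) := by
    intro J
    obtain ⟨h1, h2⟩ := hasFDerivAt_tensor_apply (V := fun s => b (J s)) Γ hTd
      (fun s => (hbs _).differentiableAt (by simp))
    refine ⟨h1, ?_⟩
    rw [h2 v, Finset.sum_eq_zero, add_zero]
    · simp_rw [hbz]
    · intro s _
      rw [(hbd _).fderiv, hbz]
      exact (T z).map_coord_zero s (by simp)
  have d2 : ∀ J : Fin i → ι, DifferentiableAt ℝ (fun w => T w (fun s => b' (J s) w)) z ∧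
      fderiv ℝ (fun w => T w (fun s => b' (J s) w)) z v =
        covDeriv Γ T z (Fin.cons v (fun s => e (J s))) := by
    intro J
    obtain ⟨h1, h2⟩ := hasFDerivAt_tensor_apply (V := fun s => b' (J s)) Γ hTd
      (fun s => (hbs' _).differentiableAt (by simp))
    refine ⟨h1, ?_⟩
    rw [h2 v, Finset.sum_eq_zero, add_zero]
    · simp_rw [hbz'']
    · intro s _
      rw [hbd']
      exact (T z).map_coord_zero s (by simp)
  have h6 : HasFDerivAt (fun w => ∑ J : Fin i → ι,
      T w (fun s => b (J s) w) * T w (fun s => b' (J s) w)) _ z :=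
    HasFDerivAt.fun_sum fun J _ => (d1 J).1.hasFDerivAt.mul (d2 J).1.hasFDerivAt
  rw [hev.fderiv_eq, h6.fderiv]
  simp only [sum_apply, add_apply, smul_apply, smul_eq_mul, (d1 _).2, (d2 _).2, hbz, hbz'',
    Finset.mul_sum]
  refine Finset.sum_congr rfl fun J _ => ?_
  ring

end Derivative

end DualFrames

/-! ### Differentiability of powers of nonnegative functions -/

section Powers

attribute [-instance] Bundle.instInnerProductSpaceReal
  Bundle.instNormedAddCommGroupOfRiemannianBundleOfIsTopologicalAddGroupOfContinuousConstSMulReal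

variable {E : Type*} [NormedAddCommGroup E] [NormedSpace ℝ E] {Q : E → ℝ} {γ : ℝ} {z : E}

lemma fderiv_eq_zero_of_nonneg (h0 : ∀ᶠ w in 𝓝 z, 0 ≤ Q w) (hz : Q z = 0) :
    fderiv ℝ Q z = 0 := by
  refine IsLocalMin.fderiv_eq_zero ?_
  filter_upwards [h0] with w hw
  rw [hz]; exact hw

/-- A power `> 1` of the square root of a nonnegative smooth function is differentiable. -/
lemma hasFDerivAt_rpow_of_nonneg (hQ : ContDiffAt ℝ ∞ Q z) (h0 : ∀ᶠ w in 𝓝 z, 0 ≤ Q w)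
    (hγ : 1 < γ) :
    HasFDerivAt (fun w => Q w ^ (γ / 2)) ((γ / 2 * Q z ^ (γ / 2 - 1)) • fderiv ℝ Q z) z := by
  have hd := (hQ.differentiableAt (by simp)).hasFDerivAt
  rcases eq_or_ne (Q z) 0 with hz | hz
  -- At a zero, which is a minimum, the derivative vanishes; being locally Lipschitz, it forces `Q w
  -- ≤ K ‖w - z‖²`. The power is therefore `O(‖w - z‖ ^ γ)`, which is `o(‖w - z‖)` as `γ > 1`.
  · have hz' := fderiv_eq_zero_of_nonneg h0 hz
    rw [hz', smul_zero]
    have h1 : ContDiffAt ℝ 1 (fderiv ℝ Q) z :=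
      hQ.fderiv_right (m := 1) (by exact WithTop.coe_le_coe.2 le_top)
    obtain ⟨K, t, ht, hK⟩ := h1.exists_lipschitzOnWith
    have h2 : ∀ᶠ w in 𝓝 z, DifferentiableAt ℝ Q w := by
      have h3 : ∀ᶠ w in 𝓝 z, ContDiffAt ℝ 1 Q w :=
        (hQ.of_le (m := 1) (by exact WithTop.coe_le_coe.2 le_top)).eventually (by simp)
      filter_upwards [h3] with w hw using hw.differentiableAt (by simp)
    obtain ⟨r, hr, hball⟩ := Metric.mem_nhds_iff.1 (inter_mem ht (inter_mem h0 h2))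
    have h4 : ∀ w ∈ Metric.ball z r, Q w ≤ K * ‖w - z‖ ^ 2 := by
      intro w hw
      have h5 : ∀ x ∈ Metric.closedBall z ‖w - z‖, ‖fderiv ℝ Q x‖ ≤ K * ‖w - z‖ := by
        intro x hx
        have hxr : x ∈ Metric.ball z r := by
          rw [Metric.mem_closedBall, dist_eq_norm] at hx
          rw [Metric.mem_ball, dist_eq_norm] at hw ⊢
          linarith
        have := hK.dist_le_mul x (hball hxr).1 z (hball (Metric.mem_ball_self hr)).1
        rw [hz', dist_zero_right] at this
        exact this.trans (mul_le_mul_of_nonneg_left hx K.2)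
      have h6 := (convex_closedBall z ‖w - z‖).norm_image_sub_le_of_norm_fderiv_le (𝕜 := ℝ)
        (f := Q) (C := K * ‖w - z‖) (x := z) (y := w) (fun x hx => by
          have hxr : x ∈ Metric.ball z r := by
            rw [Metric.mem_closedBall, dist_eq_norm] at hx
            rw [Metric.mem_ball, dist_eq_norm] at hw ⊢
            linarith
          exact (hball hxr).2.2) h5 (by simp) (by simp [dist_eq_norm])
      rw [hz, sub_zero] at h6
      have := (le_abs_self _).trans h6
      nlinarith [this]
    rw [hasFDerivAt_iff_isLittleO_nhds_zero]
    simp only [hz, Real.zero_rpow (by linarith : γ / 2 ≠ 0), zero_apply, sub_zero]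
    have h7 : (fun h : E => Q (z + h) ^ (γ / 2)) =O[𝓝 0] fun h => ‖h‖ ^ γ := by
      refine Asymptotics.IsBigO.of_bound ((K : ℝ) ^ (γ / 2)) ?_
      filter_upwards [Metric.ball_mem_nhds (0 : E) hr] with h hh
      have hm : z + h ∈ Metric.ball z r := by simpa [dist_eq_norm] using hh
      have h8 := h4 _ hm
      have h9 : 0 ≤ Q (z + h) := (hball hm).2.1
      rw [Real.norm_of_nonneg (by positivity), Real.norm_of_nonneg (by positivity)]
      refine (Real.rpow_le_rpow h9 h8 (by linarith)).trans (le_of_eq ?_)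
      rw [add_sub_cancel_left, Real.mul_rpow K.coe_nonneg (by positivity), ← Real.rpow_natCast,
        ← Real.rpow_mul (norm_nonneg _)]
      congr 2
      push_cast; ring
    refine h7.trans_isLittleO ?_
    have h10 : (fun h : E => ‖h‖ ^ γ) = fun h => ‖h‖ ^ (γ - 1) * ‖h‖ := by
      ext h
      rcases eq_or_ne h 0 with rfl | hh
      · simp [Real.zero_rpow (by linarith : γ ≠ 0)]
      · rw [← Real.rpow_add_one (norm_ne_zero_iff.2 hh), sub_add_cancel]
    rw [h10]
    have h11 : (fun h : E => ‖h‖ ^ (γ - 1)) =o[𝓝 0] fun _ => (1 : ℝ) := by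
      rw [Asymptotics.isLittleO_one_iff]
      have : Tendsto (fun h : E => ‖h‖ ^ (γ - 1)) (𝓝 0) (𝓝 (‖(0 : E)‖ ^ (γ - 1))) :=
        (continuous_norm.tendsto 0).rpow_const (Or.inr (by linarith))
      simpa [Real.zero_rpow (by linarith : γ - 1 ≠ 0)] using this
    have h12 := h11.mul_isBigO (Asymptotics.isBigO_refl (fun h : E => ‖h‖) (𝓝 0))
    simp only [one_mul] at h12
    exact h12.of_norm_right
  · exact hd.rpow_const (Or.inl hz)

/-- A power `> 1` of the square root of a nonnegative smooth function is `C¹`. -/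
lemma contDiffAt_rpow_of_nonneg {s : Set E} (hs : IsOpen s) (hQ : ∀ w ∈ s, ContDiffAt ℝ ∞ Q w)
    (h0 : ∀ w ∈ s, 0 ≤ Q w) (hγ : 1 < γ) {K : E → ℝ} (hK : ContinuousOn K s)
    (hQK : ∀ w ∈ s, ‖fderiv ℝ Q w‖ ≤ K w * √(Q w)) (hz : z ∈ s) :
    ContDiffAt ℝ 1 (fun w => Q w ^ (γ / 2)) z := by
  have hev : ∀ w ∈ s, ∀ᶠ x in 𝓝 w, 0 ≤ Q x := fun w hw => by
    filter_upwards [hs.mem_nhds hw] with x hx using h0 x hx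
  rw [contDiffAt_one_iff]
  refine ⟨fun w => (γ / 2 * Q w ^ (γ / 2 - 1)) • fderiv ℝ Q w, s, hs.mem_nhds hz, ?_,
    fun w hw => hasFDerivAt_rpow_of_nonneg (hQ w hw) (hev w hw) hγ⟩
  intro w hw
  refine ContinuousAt.continuousWithinAt ?_
  have hc : ContinuousAt Q w := (hQ w hw).continuousAt
  have hc' : ContinuousAt (fderiv ℝ Q) w :=
    ((hQ w hw).fderiv_right (m := 1) (by exact WithTop.coe_le_coe.2 le_top)).continuousAt
  rcases eq_or_ne (Q w) 0 with h | h
  -- Near a zero of `Q` the factor `Q ^ (γ / 2 - 1)` may blow up, but the hypothesis `‖dQ‖ ≤ K √Q`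
  -- bounds the derivative by `γ / 2 * K * Q ^ ((γ - 1) / 2)`, which tends to zero.
  · have hz' := fderiv_eq_zero_of_nonneg (hev w hw) h
    have hv : (γ / 2 * Q w ^ (γ / 2 - 1)) • fderiv ℝ Q w = 0 := by rw [hz', smul_zero]
    rw [ContinuousAt, hv]
    have hb : Tendsto (fun x => γ / 2 * K x * Q x ^ ((γ - 1) / 2)) (𝓝 w) (𝓝 0) := by
      have h1 := ((hK.continuousAt (hs.mem_nhds hw)).const_mul (γ / 2)).mul
        (hc.rpow_const (p := (γ - 1) / 2) (Or.inr (by linarith)))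
      have h2 : Tendsto _ _ (𝓝 (γ / 2 * K w * Q w ^ ((γ - 1) / 2))) := h1
      rw [h, Real.zero_rpow (by linarith : (γ - 1) / 2 ≠ 0), mul_zero] at h2
      exact h2
    refine squeeze_zero_norm' ?_ hb
    filter_upwards [hs.mem_nhds hw] with x hx
    rw [norm_smul, Real.norm_of_nonneg
      (mul_nonneg (by linarith) (Real.rpow_nonneg (h0 x hx) _))]
    rcases eq_or_ne (Q x) 0 with hx0 | hx0
    · rw [fderiv_eq_zero_of_nonneg (hev x hx) hx0, norm_zero, mul_zero, hx0,
        Real.zero_rpow (by linarith), mul_zero]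
    · refine (mul_le_mul_of_nonneg_left (hQK x hx)
        (mul_nonneg (by linarith) (Real.rpow_nonneg (h0 x hx) _))).trans (le_of_eq ?_)
      have hpos : 0 < Q x := lt_of_le_of_ne (h0 x hx) (Ne.symm hx0)
      have : Q x ^ ((γ - 1) / 2) = Q x ^ (γ / 2 - 1) * √(Q x) := by
        rw [Real.sqrt_eq_rpow, ← Real.rpow_add hpos]
        congr 1; ring
      rw [this]; ring
  · exact ((hc.rpow_const (Or.inl h)).const_mul _).smul hc'

end Powers

/-! ### Kato's inequality -/

section Kato

variable {n : ℕ} {X : Type*} [TopologicalSpace X] [ChartedSpace (EuclideanSpace ℝ (Fin n)) X]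
  [IsManifold (𝓡 n) ∞ X] [RiemannianBundle (fun y : X => TangentSpace (𝓡 n) y)]

/-- The orthonormal basis `tangentONB` in the coordinates of a chart. -/
def onbRepr (e : OpenPartialHomeomorph X (Eu n)) (z : Eu n)
    (a : Fin (Module.finrank ℝ (TangentSpace (𝓡 n) (e.symm z)))) : Eu n :=
  coframe e (e.symm z) (tangentONB (e.symm z) a)

variable {e : OpenPartialHomeomorph X (Eu n)} (he : IsSmoothChart e) {z : Eu n} (hz : z ∈ e.target)
include he hz

lemma gram_onbRepr (w : Eu n) (a) :
    gram e z w (onbRepr e z a) = inner ℝ (frame e z w) (tangentONB (e.symm z) a) := by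
  rw [gram_apply, onbRepr, he.frame_coframe hz]

lemma isDualPair_onbRepr : IsDualPair (gram e z) (onbRepr e z) (onbRepr e z) := by
  intro w
  have h := (tangentONB (e.symm z)).sum_repr' (frame e z w)
  have h2 := congrArg (coframe e (e.symm z)) h
  rw [he.coframe_frame hz, map_sum] at h2
  conv_rhs => rw [← h2]
  refine Finset.sum_congr rfl fun a _ => ?_
  rw [map_smul, gram_onbRepr he hz, real_inner_comm]
  rfl

lemma gram_onbRepr_onbRepr (a c) :
    gram e z (onbRepr e z a) (onbRepr e z c) = if c = a then 1 else 0 := by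
  rw [gram_onbRepr he hz, onbRepr, he.frame_coframe hz,
    orthonormal_iff_ite.1 (tangentONB (e.symm z)).orthonormal]
  simp [eq_comm]

variable [IsContMDiffRiemannianBundle (𝓡 n) ∞ (EuclideanSpace ℝ (Fin n))
    (fun y : X => TangentSpace (𝓡 n) y)] {u : X → ℝ}

lemma nablaNorm_sq (hu : ContMDiff (𝓡 n) 𝓘(ℝ, ℝ) ∞ u) (i : ℕ) :
    nablaNorm n u i (e.symm z) ^ 2 = ∑ J : Fin i → Fin _,
      nablaRepr e u i z (fun s => onbRepr e z (J s)) ^ 2 := by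
  rw [nablaNorm, Real.sq_sqrt (Finset.sum_nonneg fun _ _ => sq_nonneg _)]
  refine Finset.sum_congr rfl fun J _ => ?_
  rw [nablaIter_eq he hu i z hz]
  rfl

lemma nablaNorm_sq_eq (hu : ContMDiff (𝓡 n) 𝓘(ℝ, ℝ) ∞ u) (i : ℕ) {ι : Type*} [Fintype ι]
    {b b' : ι → Eu n} (hb : IsDualPair (gram e z) b b') :
    nablaNorm n u i (e.symm z) ^ 2 = ∑ J : Fin i → ι,
      nablaRepr e u i z (fun s => b (J s)) * nablaRepr e u i z (fun s => b' (J s)) := by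
  classical
  rw [nablaNorm_sq he hz hu, ← (isDualPair_onbRepr he hz).sum_eq (gram_symm e z) hb]
  exact Finset.sum_congr rfl fun J _ => sq _

lemma contDiffAt_nablaNorm_sq_aux (hu : ContMDiff (𝓡 n) 𝓘(ℝ, ℝ) ∞ u) (i : ℕ) :
    ContDiffAt ℝ ∞ (fun w => nablaNorm n u i (e.symm w) ^ 2) z ∧ ∀ v,
      fderiv ℝ (fun w => nablaNorm n u i (e.symm w) ^ 2) z v =
      2 * ∑ J : Fin i → Fin _, nablaRepr e u i z (fun s => onbRepr e z (J s)) *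
        nablaRepr e u (i + 1) z (Fin.cons v (fun s => onbRepr e z (J s))) := by
  have hev := e.open_target.mem_nhds hz
  refine contDiffAt_tensor_sq (contDiffAt_gram he hz) (gram_symm e) ?_
    (fderiv_gram_apply he hz) (isDualPair_onbRepr he hz) (gram_onbRepr_onbRepr he hz)
    (contDiffAt_nablaRepr he hz hu.contMDiffAt i) ?_
  · filter_upwards [hev] with w hw using (isInvertible_gram he hw).injective
  · filter_upwards [hev] with w hw b b' hb using nablaNorm_sq_eq he hw hu i hb

lemma contDiffAt_nablaNorm_sq (hu : ContMDiff (𝓡 n) 𝓘(ℝ, ℝ) ∞ u) (i : ℕ) :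
    ContDiffAt ℝ ∞ (fun w => nablaNorm n u i (e.symm w) ^ 2) z :=
  (contDiffAt_nablaNorm_sq_aux he hz hu i).1

omit he hz
  [IsContMDiffRiemannianBundle (𝓡 n) ∞ (EuclideanSpace ℝ (Fin n))
    (fun y : X => TangentSpace (𝓡 n) y)] in
lemma nablaNorm_nonneg (i : ℕ) (y : X) : 0 ≤ nablaNorm n u i y := Real.sqrt_nonneg _

/-- Kato's inequality. -/
theorem abs_fderiv_nablaNorm_sq_le (hu : ContMDiff (𝓡 n) 𝓘(ℝ, ℝ) ∞ u) (i : ℕ) (v : Eu n) :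
    |fderiv ℝ (fun w => nablaNorm n u i (e.symm w) ^ 2) z v| ≤
      2 * (nablaNorm n u i (e.symm z) * (nablaNorm n u (i + 1) (e.symm z) * ‖frame e z v‖)) := by
  set A := nablaRepr e u i z
  set B := nablaRepr e u (i + 1) z
  set o := onbRepr e z
  rw [(contDiffAt_nablaNorm_sq_aux he hz hu i).2, abs_mul, abs_two]
  refine mul_le_mul_of_nonneg_left ?_ zero_le_two
  -- The direction `v` is expanded in the orthonormal basis. Cauchy–Schwarz is then used twice: over
  -- the multi-indices `J`, and over the first slot of `B`.
  have h1 : ∀ J : Fin i → Fin _, B (Fin.cons v (fun s => o (J s))) =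
      ∑ a, gram e z v (o a) * B (Fin.cons (o a) (fun s => o (J s))) := by
    intro J
    conv_lhs => rw [← isDualPair_onbRepr he hz v]
    have : ∀ w, B (Fin.cons w (fun s => o (J s))) =
        (continuousMultilinearCurryLeftEquiv ℝ (fun _ : Fin (i + 1) => Eu n) ℝ) B w
          (fun s => o (J s)) := fun w => rfl
    simp only [this, map_sum, map_smul, sum_apply, smul_apply, smul_eq_mul]
    rfl
  have h2 : ‖frame e z v‖ ^ 2 = ∑ a, gram e z v (o a) ^ 2 := by
    rw [← (tangentONB (e.symm z)).sum_sq_norm_inner_left (frame e z v)]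
    refine Finset.sum_congr rfl fun a _ => ?_
    rw [gram_onbRepr he hz, Real.norm_eq_abs, sq_abs]
  have h3 : nablaNorm n u (i + 1) (e.symm z) ^ 2 =
      ∑ J : Fin i → Fin _, ∑ a, B (Fin.cons (o a) (fun s => o (J s))) ^ 2 := by
    rw [nablaNorm_sq he hz hu, ← (Fin.consEquiv fun _ => _).sum_comp, Fintype.sum_prod_type,
      Finset.sum_comm]
    refine Finset.sum_congr rfl fun J _ => Finset.sum_congr rfl fun a _ => ?_
    congr 2
    ext s : 1
    refine Fin.cases rfl (fun s => rfl) s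
  have h4 := nablaNorm_sq he hz hu i
  refine abs_le_of_sq_le_sq ?_ (mul_nonneg (nablaNorm_nonneg _ _)
    (mul_nonneg (nablaNorm_nonneg _ _) (norm_nonneg _)))
  refine (Finset.sum_mul_sq_le_sq_mul_sq _ _ _).trans ?_
  rw [mul_pow, mul_pow, h4]
  refine mul_le_mul_of_nonneg_left ?_ (Finset.sum_nonneg fun _ _ => sq_nonneg _)
  rw [h3, Finset.sum_mul]
  refine Finset.sum_le_sum fun J _ => ?_
  rw [h1 J, h2, mul_comm (∑ a, _)]
  exact Finset.sum_mul_sq_le_sq_mul_sq _ _ _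

end Kato

/-! ### Regularity of `|∇^i u|` and linearity of the coordinate tensors -/

section NablaNorm

variable {n : ℕ} {X : Type*} [TopologicalSpace X] [ChartedSpace (EuclideanSpace ℝ (Fin n)) X]
  [IsManifold (𝓡 n) ∞ X] [RiemannianBundle (fun y : X => TangentSpace (𝓡 n) y)]
  [IsContMDiffRiemannianBundle (𝓡 n) ∞ (EuclideanSpace ℝ (Fin n))
    (fun y : X => TangentSpace (𝓡 n) y)]

variable (n) in
/-- The function `f` is `C¹` and its differential is bounded by `G`. -/
def HasSlopeBound (f G : X → ℝ) : Prop :=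
  ∀ e : OpenPartialHomeomorph X (Eu n), IsSmoothChart e → ∀ z ∈ e.target,
    ContDiffAt ℝ 1 (f ∘ e.symm) z ∧
      ∀ w, |fderiv ℝ (f ∘ e.symm) z w| ≤ G (e.symm z) * ‖frame e z w‖

lemma continuous_of_comp_symm {F : Type*} [TopologicalSpace F] {f : X → F}
    (h : ∀ e : OpenPartialHomeomorph X (Eu n), IsSmoothChart e → ∀ z ∈ e.target,
      ContinuousAt (f ∘ e.symm) z) : Continuous f := by
  rw [continuous_iff_continuousAt]
  intro y
  have hy := mem_chart_source (Eu n) y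
  have h1 := h _ (isSmoothChart_chartAt y) _ ((chartAt (Eu n) y).map_source hy)
  have h2 := h1.comp ((chartAt (Eu n) y).continuousAt hy)
  refine h2.congr ?_
  filter_upwards [(chartAt (Eu n) y).open_source.mem_nhds hy] with w hw
  simp [(chartAt (Eu n) y).left_inv hw]

variable {u v : X → ℝ}

lemma continuous_nablaNorm (hu : ContMDiff (𝓡 n) 𝓘(ℝ, ℝ) ∞ u) (i : ℕ) :
    Continuous (nablaNorm n u i) := by
  have h : Continuous (fun y => nablaNorm n u i y ^ 2) :=
    continuous_of_comp_symm fun e he z hz => (contDiffAt_nablaNorm_sq he hz hu i).continuousAt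
  have h2 := h.sqrt
  simpa only [Real.sqrt_sq (nablaNorm_nonneg _ _)] using h2

lemma norm_frame_le {e : OpenPartialHomeomorph X (Eu n)} (z w : Eu n) :
    ‖frame e z w‖ ≤ √‖gram e z‖ * ‖w‖ := by
  have h1 : ‖frame e z w‖ ^ 2 = gram e z w w := by
    rw [gram_apply, real_inner_self_eq_norm_sq]
  have h2 : gram e z w w ≤ ‖gram e z‖ * ‖w‖ * ‖w‖ :=
    (le_abs_self _).trans ((gram e z).le_opNorm₂ w w)
  refine abs_le_of_sq_le_sq' ?_ (by positivity) |>.2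
  rw [h1, mul_pow, Real.sq_sqrt (norm_nonneg _)]
  linarith

/-- The norm itself need not be differentiable at its zeros, but a power `γ > 1` is `C¹`, the
required bound on the derivative of the square being Kato's inequality. These powers are the
functions to which the `W^{1,1}` inequality is applied. -/
theorem hasSlopeBound_nablaNorm_rpow (hu : ContMDiff (𝓡 n) 𝓘(ℝ, ℝ) ∞ u) (i : ℕ) {γ : ℝ}
    (hγ : 1 < γ) :
    HasSlopeBound n (fun y => nablaNorm n u i y ^ γ)
      (fun y => γ * nablaNorm n u i y ^ (γ - 1) * nablaNorm n u (i + 1) y) := by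
  intro e he z hz
  set Q : Eu n → ℝ := fun w => nablaNorm n u i (e.symm w) ^ 2 with hQ
  have hsq : ∀ w, √(Q w) = nablaNorm n u i (e.symm w) := fun w =>
    Real.sqrt_sq (nablaNorm_nonneg _ _)
  have h0 : ∀ w, 0 ≤ Q w := fun w => sq_nonneg _
  have heq : (fun y => nablaNorm n u i y ^ γ) ∘ e.symm = fun w => Q w ^ (γ / 2) := by
    ext w
    simp only [hQ, Function.comp_apply]
    rw [← Real.rpow_natCast, ← Real.rpow_mul (nablaNorm_nonneg _ _)]
    congr 1; push_cast; ring
  rw [heq]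
  have hc1 : ContinuousOn (fun w => nablaNorm n u (i + 1) (e.symm w)) e.target :=
    (continuous_nablaNorm hu (i + 1)).comp_continuousOn e.continuousOn_symm
  have hc2 : ContinuousOn (fun w => √‖gram e w‖) e.target := fun w hw =>
    ((contDiffAt_gram he hw).continuousAt.norm.sqrt).continuousWithinAt
  constructor
  · refine contDiffAt_rpow_of_nonneg (K := fun w =>
      2 * (nablaNorm n u (i + 1) (e.symm w) * √‖gram e w‖)) e.open_target
      (fun w hw => contDiffAt_nablaNorm_sq he hw hu i) (fun w _ => h0 w) hγ
      (continuousOn_const.mul (hc1.mul hc2)) ?_ hz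
    intro w hw
    have hp : 0 ≤ nablaNorm n u (i + 1) (e.symm w) := nablaNorm_nonneg _ _
    refine ContinuousLinearMap.opNorm_le_bound _ (by positivity) fun v => ?_
    rw [Real.norm_eq_abs, hsq]
    refine (abs_fderiv_nablaNorm_sq_le he hw hu i v).trans ?_
    have hp' : 0 ≤ nablaNorm n u i (e.symm w) := nablaNorm_nonneg _ _
    calc 2 * (nablaNorm n u i (e.symm w) * (nablaNorm n u (i + 1) (e.symm w) * ‖frame e w v‖))
        ≤ 2 * (nablaNorm n u i (e.symm w) * (nablaNorm n u (i + 1) (e.symm w) *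
          (√‖gram e w‖ * ‖v‖))) := by gcongr; exact norm_frame_le w v
      _ = _ := by ring
  · intro w
    have hd := hasFDerivAt_rpow_of_nonneg (contDiffAt_nablaNorm_sq he hz hu i)
      (Eventually.of_forall h0) hγ
    rw [hd.fderiv, smul_apply, smul_eq_mul, abs_mul]
    have hp : 0 ≤ nablaNorm n u i (e.symm z) := nablaNorm_nonneg _ _
    have hk := abs_fderiv_nablaNorm_sq_le he hz hu i w
    rw [abs_of_nonneg (mul_nonneg (by linarith) (Real.rpow_nonneg (sq_nonneg _) _))]
    rcases eq_or_ne (nablaNorm n u i (e.symm z)) 0 with h | h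
    · rw [h, zero_mul, mul_zero] at hk
      rw [le_antisymm hk (abs_nonneg _), mul_zero]
      have : 0 ≤ nablaNorm n u (i + 1) (e.symm z) := nablaNorm_nonneg _ _
      have := Real.rpow_nonneg hp (γ - 1)
      positivity
    · refine (mul_le_mul_of_nonneg_left hk
        (mul_nonneg (by linarith) (Real.rpow_nonneg (sq_nonneg _) _))).trans (le_of_eq ?_)
      have hpos := lt_of_le_of_ne hp (Ne.symm h)
      have : nablaNorm n u i (e.symm z) ^ (γ - 1) =
          (nablaNorm n u i (e.symm z) ^ 2) ^ (γ / 2 - 1) * nablaNorm n u i (e.symm z) := by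
        rw [← Real.rpow_natCast, ← Real.rpow_mul hp, ← Real.rpow_add_one h]
        congr 1; push_cast; ring
      simp only [this]; ring

variable {e : OpenPartialHomeomorph X (Eu n)} (he : IsSmoothChart e)
include he

lemma nablaRepr_add (hu : ContMDiff (𝓡 n) 𝓘(ℝ, ℝ) ∞ u) (hv : ContMDiff (𝓡 n) 𝓘(ℝ, ℝ) ∞ v)
    (i : ℕ) : ∀ z ∈ e.target,
      nablaRepr e (u + v) i z = nablaRepr e u i z + nablaRepr e v i z := by
  induction i with
  | zero => intro z _; ext w; rfl
  | succ i ih =>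
    intro z hz
    have hev : nablaRepr e (u + v) i =ᶠ[𝓝 z] nablaRepr e u i + nablaRepr e v i := by
      filter_upwards [e.open_target.mem_nhds hz] with w hw using ih w hw
    have h1 := (contDiffAt_nablaRepr he hz hu.contMDiffAt i).differentiableAt (by simp)
    have h2 := (contDiffAt_nablaRepr he hz hv.contMDiffAt i).differentiableAt (by simp)
    simp only [nablaRepr, covDeriv]
    rw [hev.fderiv_eq, fderiv_add h1 h2, ih z hz, ← map_add, map_add, ContinuousLinearMap.add_comp]
    congr 1
    abel

lemma nablaRepr_smul (c : ℝ) (hu : ContMDiff (𝓡 n) 𝓘(ℝ, ℝ) ∞ u) (i : ℕ) : ∀ z ∈ e.target,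
      nablaRepr e (c • u) i z = c • nablaRepr e u i z := by
  induction i with
  | zero => intro z _; ext w; rfl
  | succ i ih =>
    intro z hz
    have hev : nablaRepr e (c • u) i =ᶠ[𝓝 z] c • nablaRepr e u i := by
      filter_upwards [e.open_target.mem_nhds hz] with w hw using ih w hw
    have h1 := (contDiffAt_nablaRepr he hz hu.contMDiffAt i).differentiableAt (by simp)
    simp only [nablaRepr, covDeriv]
    rw [hev.fderiv_eq, fderiv_const_smul h1, ih z hz, ← map_smul, map_smul,
      ContinuousLinearMap.smul_comp, smul_sub]

omit he in
lemma nablaRepr_eventuallyEq_zero {z : Eu n} (h : ∀ᶠ w in 𝓝 z, u (e.symm w) = 0) (i : ℕ) :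
    nablaRepr e u i =ᶠ[𝓝 z] 0 := by
  induction i with
  | zero =>
    filter_upwards [h] with w hw
    ext v
    simpa [nablaRepr] using hw
  | succ i ih =>
    filter_upwards [ih.eventuallyEq_nhds] with w hw
    simp only [nablaRepr, covDeriv]
    rw [hw.fderiv_eq, hw.eq_of_nhds]
    simp [Pi.zero_def]

end NablaNorm

/-! ### Pointwise estimates for covariant derivatives -/

section Pointwise

variable {n : ℕ} {X : Type*} [TopologicalSpace X] [ChartedSpace (EuclideanSpace ℝ (Fin n)) X]
  [IsManifold (𝓡 n) ∞ X] [RiemannianBundle (fun y : X => TangentSpace (𝓡 n) y)]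
  [IsContMDiffRiemannianBundle (𝓡 n) ∞ (EuclideanSpace ℝ (Fin n))
    (fun y : X => TangentSpace (𝓡 n) y)] {u v : X → ℝ}

lemma nablaNorm_eq_zero_of_notMem_tsupport (hu : ContMDiff (𝓡 n) 𝓘(ℝ, ℝ) ∞ u) (i : ℕ) {y : X}
    (hy : y ∉ tsupport u) : nablaNorm n u i y = 0 := by
  have he := isSmoothChart_chartAt (n := n) y
  set e := chartAt (Eu n) y
  have hys : y ∈ e.source := mem_chart_source _ y
  have hz : e y ∈ e.target := e.map_source hys
  have hev : ∀ᶠ w in 𝓝 (e y), u (e.symm w) = 0 := by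
    have h1 : ∀ᶠ x in 𝓝 y, u x = 0 := notMem_tsupport_iff_eventuallyEq.1 hy
    have h2 : Tendsto e.symm (𝓝 (e y)) (𝓝 y) := by
      have := (e.continuousAt_symm hz).tendsto
      rwa [e.left_inv hys] at this
    exact h2.eventually h1
  have h3 := nablaNorm_sq he hz hu i
  rw [(nablaRepr_eventuallyEq_zero hev i).eq_of_nhds, e.left_inv hys] at h3
  simpa using h3

lemma hasCompactSupport_nablaNorm (hu : ContMDiff (𝓡 n) 𝓘(ℝ, ℝ) ∞ u) (hc : HasCompactSupport u)
    (i : ℕ) : HasCompactSupport (nablaNorm n u i) :=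
  hc.mono' fun y hy => by
    by_contra h
    exact hy (nablaNorm_eq_zero_of_notMem_tsupport hu i h)

lemma exists_isSmoothChart (y : X) :
    ∃ e : OpenPartialHomeomorph X (Eu n), IsSmoothChart e ∧ ∃ z ∈ e.target, e.symm z = y :=
  ⟨_, isSmoothChart_chartAt y, _, (chartAt (Eu n) y).map_source (mem_chart_source _ y),
    (chartAt (Eu n) y).left_inv (mem_chart_source _ y)⟩

lemma nablaIter_add (hu : ContMDiff (𝓡 n) 𝓘(ℝ, ℝ) ∞ u) (hv : ContMDiff (𝓡 n) 𝓘(ℝ, ℝ) ∞ v)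
    (i : ℕ) (y : X) (w : Fin i → TangentSpace (𝓡 n) y) :
    nablaIter (u + v) i y w = nablaIter u i y w + nablaIter v i y w := by
  obtain ⟨e, he, z, hz, rfl⟩ := exists_isSmoothChart (n := n) y
  rw [nablaIter_eq he (hu.add hv) i z hz, nablaIter_eq he hu i z hz, nablaIter_eq he hv i z hz,
    nablaRepr_add he hu hv i z hz]
  rfl

lemma nablaIter_smul (c : ℝ) (hu : ContMDiff (𝓡 n) 𝓘(ℝ, ℝ) ∞ u)
    (i : ℕ) (y : X) (w : Fin i → TangentSpace (𝓡 n) y) :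
    nablaIter (c • u) i y w = c * nablaIter u i y w := by
  obtain ⟨e, he, z, hz, rfl⟩ := exists_isSmoothChart (n := n) y
  have hcu : ContMDiff (𝓡 n) 𝓘(ℝ, ℝ) ∞ (c • u) := contMDiff_const.mul hu
  rw [nablaIter_eq he hcu i z hz, nablaIter_eq he hu i z hz,
    nablaRepr_smul he c hu i z hz]
  rfl

lemma nablaNorm_eq_norm (u : X → ℝ) (i : ℕ) (y : X) :
    nablaNorm n u i y = ‖(WithLp.toLp 2 fun a : Fin i → Fin _ =>
      nablaIter (n := n) u i y (fun j => tangentONB y (a j)) :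
        EuclideanSpace ℝ (Fin i → Fin (Module.finrank ℝ (TangentSpace (𝓡 n) y))))‖ := by
  rw [EuclideanSpace.norm_eq, nablaNorm]
  simp only [Real.norm_eq_abs, sq_abs]

lemma nablaNorm_add_le (hu : ContMDiff (𝓡 n) 𝓘(ℝ, ℝ) ∞ u) (hv : ContMDiff (𝓡 n) 𝓘(ℝ, ℝ) ∞ v)
    (i : ℕ) (y : X) : nablaNorm n (u + v) i y ≤ nablaNorm n u i y + nablaNorm n v i y := by
  simp only [nablaNorm_eq_norm, nablaIter_add hu hv]
  exact norm_add_le (WithLp.toLp 2 _ : EuclideanSpace ℝ (Fin i → Fin _)) (WithLp.toLp 2 _)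

lemma nablaNorm_smul (c : ℝ) (hu : ContMDiff (𝓡 n) 𝓘(ℝ, ℝ) ∞ u) (i : ℕ) (y : X) :
    nablaNorm n (c • u) i y = |c| * nablaNorm n u i y := by
  simp only [nablaNorm_eq_norm, nablaIter_smul c hu]
  exact norm_smul c (WithLp.toLp 2 _ : EuclideanSpace ℝ (Fin i → Fin _))

variable {e : OpenPartialHomeomorph X (Eu n)} (he : IsSmoothChart e)
include he

/-- Each argument is expanded in the orthonormal basis. Cauchy–Schwarz over multi-indices leaves a
sum of products, which factors into the product of the squared lengths. -/
lemma abs_nablaRepr_le (hu : ContMDiff (𝓡 n) 𝓘(ℝ, ℝ) ∞ u) {z : Eu n} (hz : z ∈ e.target) (i : ℕ)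
    (w : Fin i → Eu n) :
    |nablaRepr e u i z w| ≤ (∏ j, ‖frame e z (w j)‖) * nablaNorm n u i (e.symm z) := by
  have h1 : nablaRepr e u i z w = ∑ J : Fin i → Fin _, (∏ s, gram e z (w s) (onbRepr e z (J s))) *
      nablaRepr e u i z (fun s => onbRepr e z (J s)) := by
    conv_lhs => rw [show w = fun s => ∑ j, gram e z (w s) (onbRepr e z j) • onbRepr e z j from
      funext fun s => (isDualPair_onbRepr he hz (w s)).symm]
    rw [ContinuousMultilinearMap.map_sum]
    refine Finset.sum_congr rfl fun J _ => ?_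
    rw [ContinuousMultilinearMap.map_smul_univ, smul_eq_mul]
  have h2 : ∀ v, ‖frame e z v‖ ^ 2 = ∑ a, gram e z v (onbRepr e z a) ^ 2 := by
    intro v
    rw [← (tangentONB (e.symm z)).sum_sq_norm_inner_left (frame e z v)]
    refine Finset.sum_congr rfl fun a _ => ?_
    rw [gram_onbRepr he hz, Real.norm_eq_abs, sq_abs]
  refine abs_le_of_sq_le_sq ?_ (mul_nonneg (Finset.prod_nonneg fun _ _ => norm_nonneg _)
    (nablaNorm_nonneg _ _))
  rw [h1]
  refine (Finset.sum_mul_sq_le_sq_mul_sq _ _ _).trans (le_of_eq ?_)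
  rw [mul_pow, nablaNorm_sq he hz hu, ← Finset.prod_pow]
  simp_rw [h2]
  rw [Finset.prod_univ_sum]
  simp only [Fintype.piFinset_univ, Finset.prod_pow]

/-- An orthonormal vector has Euclidean length at most `lam`, so each orthonormal component costs a
factor `lam ^ i` over the coordinate components; `n ^ i` counts the orthonormal components. -/
lemma nablaNorm_le (hu : ContMDiff (𝓡 n) 𝓘(ℝ, ℝ) ∞ u) {z : Eu n} (hz : z ∈ e.target) (i : ℕ)
    {lam : ℝ} (hlam : ∀ w, ‖w‖ ≤ lam * ‖frame e z w‖) :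
    nablaNorm n u i (e.symm z) ≤ n ^ i * lam ^ i * ∑ J : Fin i → Fin n,
      |nablaRepr e u i z (fun s => EuclideanSpace.single (J s) (1 : ℝ))| := by
  set S := ∑ J : Fin i → Fin n,
      |nablaRepr e u i z (fun s => EuclideanSpace.single (J s) (1 : ℝ))| with hS
  have hS0 : 0 ≤ S := Finset.sum_nonneg fun _ _ => abs_nonneg _
  have ho : ∀ a, ‖onbRepr e z a‖ ≤ lam := by
    intro a
    refine (hlam _).trans (le_of_eq ?_)
    rw [onbRepr, he.frame_coframe hz, (tangentONB (e.symm z)).norm_eq_one, mul_one]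
  have h1 : ∀ a : Fin i → Fin _, |nablaRepr e u i z (fun s => onbRepr e z (a s))| ≤
      lam ^ i * S := by
    intro a
    have h2 : nablaRepr e u i z (fun s => onbRepr e z (a s)) = ∑ J : Fin i → Fin n,
        (∏ s, onbRepr e z (a s) (J s)) *
          nablaRepr e u i z (fun s => EuclideanSpace.single (J s) (1 : ℝ)) := by
      conv_lhs => rw [show (fun s => onbRepr e z (a s)) = fun s => ∑ j,
        onbRepr e z (a s) j • EuclideanSpace.single j (1 : ℝ) from
          funext fun s => by
            have := (EuclideanSpace.basisFun (Fin n) ℝ).sum_repr (onbRepr e z (a s))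
            simpa using this.symm]
      rw [ContinuousMultilinearMap.map_sum]
      refine Finset.sum_congr rfl fun J _ => ?_
      rw [ContinuousMultilinearMap.map_smul_univ, smul_eq_mul]
    rw [h2, hS, Finset.mul_sum]
    refine (Finset.abs_sum_le_sum_abs _ _).trans (Finset.sum_le_sum fun J _ => ?_)
    rw [abs_mul, Finset.abs_prod]
    refine mul_le_mul_of_nonneg_right ?_ (abs_nonneg _)
    calc ∏ s, |onbRepr e z (a s) (J s)| ≤ ∏ _s : Fin i, lam :=
          Finset.prod_le_prod (fun _ _ => abs_nonneg _) fun s _ =>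
            (PiLp.norm_apply_le (onbRepr e z (a s)) (J s)).trans (ho _)
      _ = lam ^ i := by simp
  have h3 : nablaNorm n u i (e.symm z) ≤
      ∑ a : Fin i → Fin _, |nablaRepr e u i z (fun s => onbRepr e z (a s))| := by
    refine abs_le_of_sq_le_sq' ?_ (Finset.sum_nonneg fun _ _ => abs_nonneg _) |>.2
    rw [nablaNorm_sq he hz hu]
    simp_rw [← sq_abs (nablaRepr e u i z _)]
    exact Finset.sum_sq_le_sq_sum_of_nonneg fun _ _ => abs_nonneg _
  refine h3.trans ((Finset.sum_le_sum fun a _ => h1 a).trans (le_of_eq ?_))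
  have hf : Module.finrank ℝ (TangentSpace (𝓡 n) (e.symm z)) = n := finrank_euclideanSpace_fin
  simp [hf]
  ring

end Pointwise

/-! ### Riemannian volume and integration in charts -/

section Volume

variable {n : ℕ} {X : Type*} [TopologicalSpace X] [ChartedSpace (EuclideanSpace ℝ (Fin n)) X]
  [IsManifold (𝓡 n) ∞ X] [RiemannianBundle (fun y : X => TangentSpace (𝓡 n) y)]

/-- The matrix of the metric in the coordinates of a chart. -/
def gramMatrix (e : OpenPartialHomeomorph X (Eu n)) (z : Eu n) : Matrix (Fin n) (Fin n) ℝ :=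
  Matrix.of fun i j => gram e z (EuclideanSpace.single i 1) (EuclideanSpace.single j 1)

lemma chartDensity_eq (e : OpenPartialHomeomorph X (Eu n)) (z : Eu n) :
    chartDensity e z = √(gramMatrix e z).det := rfl

lemma gramMatrix_quadratic (e : OpenPartialHomeomorph X (Eu n)) (z v : Eu n) :
    dotProduct v (Matrix.mulVec (gramMatrix e z) v) = ‖frame e z v‖ ^ 2 := by
  rw [← real_inner_self_eq_norm_sq, ← gram_apply]
  have hv : v = ∑ i, v i • EuclideanSpace.single i (1 : ℝ) := by
    simpa using ((EuclideanSpace.basisFun (Fin n) ℝ).sum_repr v).symm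
  conv_rhs => rw [hv]
  simp only [map_sum, sum_apply, map_smul, smul_apply, smul_eq_mul, dotProduct, Matrix.mulVec,
    gramMatrix, Matrix.of_apply, Finset.mul_sum]
  rw [Finset.sum_comm]
  refine Finset.sum_congr rfl fun i _ => Finset.sum_congr rfl fun j _ => ?_
  ring

lemma isHermitian_gramMatrix (e : OpenPartialHomeomorph X (Eu n)) (z : Eu n) :
    (gramMatrix e z).IsHermitian := by
  ext i j
  simp only [Matrix.conjTranspose_apply, gramMatrix, Matrix.of_apply, star_trivial]
  exact gram_symm e z _ _

lemma eigenvalues_gramMatrix (e : OpenPartialHomeomorph X (Eu n)) (z : Eu n) (i : Fin n) :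
    (isHermitian_gramMatrix e z).eigenvalues i =
      ‖frame e z ((isHermitian_gramMatrix e z).eigenvectorBasis i)‖ ^ 2 := by
  rw [Matrix.IsHermitian.eigenvalues_eq, ← gramMatrix_quadratic]
  simp

lemma det_gramMatrix (e : OpenPartialHomeomorph X (Eu n)) (z : Eu n) :
    (gramMatrix e z).det = ∏ i,
      ‖frame e z ((isHermitian_gramMatrix e z).eigenvectorBasis i)‖ ^ 2 := by
  rw [(isHermitian_gramMatrix e z).det_eq_prod_eigenvalues]
  simp [eigenvalues_gramMatrix]

/-- Diagonalizing the Gram matrix makes two-sided bounds on the lengths of `frame e z w` into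
two-sided bounds on the density. -/
lemma chartDensity_eq_prod (e : OpenPartialHomeomorph X (Eu n)) (z : Eu n) :
    chartDensity e z = ∏ i, ‖frame e z ((isHermitian_gramMatrix e z).eigenvectorBasis i)‖ := by
  rw [chartDensity_eq, det_gramMatrix, Finset.prod_pow,
    Real.sqrt_sq (Finset.prod_nonneg fun _ _ => norm_nonneg _)]

lemma chartDensity_le {e : OpenPartialHomeomorph X (Eu n)} {z : Eu n} {lam : ℝ}
    (h : ∀ w, ‖frame e z w‖ ≤ lam * ‖w‖) : chartDensity e z ≤ lam ^ n := by
  rw [chartDensity_eq_prod]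
  calc _ ≤ ∏ _i : Fin n, lam := Finset.prod_le_prod (fun _ _ => norm_nonneg _) fun i _ => by
        simpa using h ((isHermitian_gramMatrix e z).eigenvectorBasis i)
    _ = lam ^ n := by simp

lemma le_chartDensity {e : OpenPartialHomeomorph X (Eu n)} {z : Eu n} {lam : ℝ} (hl : 0 < lam)
    (h : ∀ w, ‖w‖ ≤ lam * ‖frame e z w‖) : (lam⁻¹) ^ n ≤ chartDensity e z := by
  rw [chartDensity_eq_prod]
  calc _ = ∏ _i : Fin n, lam⁻¹ := by simp
    _ ≤ _ := Finset.prod_le_prod (fun _ _ => by positivity) fun i _ => by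
        have := h ((isHermitian_gramMatrix e z).eigenvectorBasis i)
        rw [((isHermitian_gramMatrix e z).eigenvectorBasis).norm_eq_one] at this
        rw [inv_le_iff_one_le_mul₀ hl]
        linarith

lemma gram_coframe {e : OpenPartialHomeomorph X (Eu n)} (he : IsSmoothChart e) {y : X}
    (hy : y ∈ e.source) (v w : TangentSpace (𝓡 n) y) :
    gram e (e y) (coframe e y v) (coframe e y w) = inner ℝ v w := by
  obtain ⟨z, hz, rfl⟩ : ∃ z ∈ e.target, e.symm z = y := ⟨e y, e.map_source hy, e.left_inv hy⟩
  rw [e.right_inv hz]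
  exact gram_eq_inner he hz v w

section Transition

variable {e e' : OpenPartialHomeomorph X (Eu n)} (he : IsSmoothChart e) (he' : IsSmoothChart e')
  {z : Eu n} (hz : z ∈ e.target) (hz' : e.symm z ∈ e'.source)
include he he' hz hz'

lemma differentiableAt_transition : DifferentiableAt ℝ (e' ∘ e.symm) z :=
  mdifferentiableAt_iff_differentiableAt.1
    (((he'.contMDiffAt hz').mdifferentiableAt (by simp)).comp z
      ((he.contMDiffAt_symm hz).mdifferentiableAt (by simp)))

lemma gram_transition (a b : Eu n) : gram e z a b = gram e' (e' (e.symm z))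
    (fderiv ℝ (e' ∘ e.symm) z a) (fderiv ℝ (e' ∘ e.symm) z b) := by
  have h : ∀ a, fderiv ℝ (e' ∘ e.symm) z a = coframe e' (e.symm z) (frame e z a) := by
    intro a
    have := mfderiv_comp z ((he'.contMDiffAt hz').mdifferentiableAt (by simp))
      ((he.contMDiffAt_symm hz).mdifferentiableAt (by simp))
    rw [mfderiv_eq_fderiv] at this
    exact DFunLike.congr_fun this a
  rw [h, h, gram_coframe he' hz', gram_apply]

/-- The Gram matrices are congruent through the Jacobian matrix `P` of the transition map, so the
determinants differ by `(det P)²`. -/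
lemma chartDensity_transition : chartDensity e z =
    |(fderiv ℝ (e' ∘ e.symm) z).det| * chartDensity e' (e' (e.symm z)) := by
  set D := fderiv ℝ (e' ∘ e.symm) z with hD
  let b := (EuclideanSpace.basisFun (Fin n) ℝ).toBasis
  let P := LinearMap.toMatrix b b (D : Eu n →ₗ[ℝ] Eu n)
  have hP : ∀ i, D (EuclideanSpace.single i 1) = ∑ k, P k i • EuclideanSpace.single k (1 : ℝ) := by
    intro i
    have h1 := (EuclideanSpace.basisFun (Fin n) ℝ).sum_repr (D (EuclideanSpace.single i 1))
    rw [← h1]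
    refine Finset.sum_congr rfl fun k _ => ?_
    simp [P, b, LinearMap.toMatrix_apply]
  have hM : gramMatrix e z = P.transpose * gramMatrix e' (e' (e.symm z)) * P := by
    ext i j
    simp only [gramMatrix, Matrix.of_apply, Matrix.mul_apply, Matrix.transpose_apply]
    rw [gram_transition he he' hz hz', ← hD, hP, hP]
    simp only [map_sum, sum_apply, map_smul, smul_apply, smul_eq_mul, Finset.sum_mul,
      Finset.mul_sum]
    refine Finset.sum_congr rfl fun k _ => Finset.sum_congr rfl fun l _ => ?_
    ring
  have hdet : P.det = D.det := LinearMap.det_toMatrix b _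
  rw [chartDensity_eq, chartDensity_eq, hM, Matrix.det_mul, Matrix.det_mul, Matrix.det_transpose,
    hdet, show D.det * (gramMatrix e' (e' (e.symm z))).det * D.det =
      D.det ^ 2 * (gramMatrix e' (e' (e.symm z))).det by ring,
    Real.sqrt_mul (sq_nonneg _), Real.sqrt_sq_eq_abs]

end Transition

variable [MeasurableSpace X] [BorelSpace X]

omit [IsManifold (𝓡 n) ∞ X] [RiemannianBundle (fun y : X => TangentSpace (𝓡 n) y)] in
lemma measurableSet_target_inter_preimage (e : OpenPartialHomeomorph X (Eu n)) {A : Set X}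
    (hA : MeasurableSet A) : MeasurableSet (e.target ∩ e.symm ⁻¹' A) := by
  have h1 : Measurable (e.target.domRestrict e.symm) :=
    (continuousOn_iff_continuous_domRestrict.1 e.continuousOn_symm).measurable
  have h2 := h1 hA
  have h3 := e.open_target.measurableSet.subtype_image h2
  convert! h3 using 1
  ext z
  simp [domRestrict_apply, and_comm]

omit [IsManifold (𝓡 n) ∞ X] in
lemma aemeasurable_symm (e : OpenPartialHomeomorph X (Eu n)) :
    AEMeasurable e.symm ((volume.restrict e.target).withDensity
      fun z => ENNReal.ofReal (chartDensity e z)) :=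
  (e.continuousOn_symm.aemeasurable e.open_target.measurableSet).mono_ac
    (withDensity_absolutelyContinuous _ _)

omit [IsManifold (𝓡 n) ∞ X] in
lemma chartVolume_apply (e : OpenPartialHomeomorph X (Eu n)) {A : Set X} (hA : MeasurableSet A) :
    chartVolume e A = ∫⁻ z in e.target ∩ e.symm ⁻¹' A, ENNReal.ofReal (chartDensity e z) := by
  have hm := measurableSet_target_inter_preimage e hA
  rw [chartVolume, Measure.map_apply_of_aemeasurable (aemeasurable_symm e) hA,
    ← restrict_withDensity e.open_target.measurableSet,
    Measure.restrict_apply₀', inter_comm, withDensity_apply _ hm]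
  exact e.open_target.measurableSet.nullMeasurableSet

omit [IsManifold (𝓡 n) ∞ X] in
lemma chartVolume_compl_source (e : OpenPartialHomeomorph X (Eu n)) :
    chartVolume e (e.source)ᶜ = 0 := by
  rw [chartVolume_apply e e.open_source.measurableSet.compl]
  have : e.target ∩ e.symm ⁻¹' (e.source)ᶜ = ∅ := by
    ext z
    simp only [mem_inter_iff, mem_preimage, mem_compl_iff, mem_empty_iff_false, iff_false, not_and,
      not_not]
    exact fun hz => e.map_target hz
  rw [this]; simp

omit [IsManifold (𝓡 n) ∞ X] in
lemma chartVolume_inter_source (e : OpenPartialHomeomorph X (Eu n)) (B : Set X) :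
    chartVolume e (B ∩ e.source) = chartVolume e B :=
  measure_inter_conull' (measure_mono_null (fun _ hx => hx.2) (chartVolume_compl_source e))

/-- The volumes of two charts agree on the intersection of their domains. -/
lemma chartVolume_eq {e e' : OpenPartialHomeomorph X (Eu n)} (he : IsSmoothChart e)
    (he' : IsSmoothChart e') {A : Set X} (hA : MeasurableSet A) (h : A ⊆ e.source)
    (h' : A ⊆ e'.source) : chartVolume e A = chartVolume e' A := by
  have hB := measurableSet_target_inter_preimage e hA
  rw [chartVolume_apply e hA, chartVolume_apply e' hA]
  have himg : e'.target ∩ e'.symm ⁻¹' A = (e' ∘ e.symm) '' (e.target ∩ e.symm ⁻¹' A) := by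
    ext w
    constructor
    · rintro ⟨hw, hwA⟩
      refine ⟨e (e'.symm w), ⟨e.map_source (h hwA), ?_⟩, ?_⟩
      · simpa [e.left_inv (h hwA)] using hwA
      · simp [e.left_inv (h hwA), e'.right_inv hw]
    · rintro ⟨z, ⟨hz, hzA⟩, rfl⟩
      refine ⟨e'.map_source (h' hzA), ?_⟩
      simpa [e'.left_inv (h' hzA)] using hzA
  have hinj : InjOn (e' ∘ e.symm) (e.target ∩ e.symm ⁻¹' A) := by
    intro z hz w hw hzw
    exact e.symm.injOn hz.1 hw.1 (e'.injOn (h' hz.2) (h' hw.2) hzw)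
  rw [himg, lintegral_image_eq_lintegral_abs_det_fderiv_mul volume hB
    (fun z hz => (differentiableAt_transition he he' hz.1 (h' hz.2)).hasFDerivAt.hasFDerivWithinAt)
    hinj]
  refine setLIntegral_congr_fun hB fun z hz => ?_
  simp only [Function.comp_apply]
  rw [chartDensity_transition he he' hz.1 (h' hz.2), ENNReal.ofReal_mul (abs_nonneg _)]

lemma chartVolume_le_riemannianVolume (y : X) :
    chartVolume (chartAt (Eu n) y) ≤ riemannianVolume n X :=
  le_iSup (fun y : X => chartVolume (chartAt (Eu n) y)) y

/-- A supremum of measures is estimated by any common upper bound. Here this is `chartVolume e` plus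
the top measure off `e.source`, which is invisible to subsets of the source. -/
lemma riemannianVolume_le_chartVolume {e : OpenPartialHomeomorph X (Eu n)} (he : IsSmoothChart e)
    {A : Set X} (hA : MeasurableSet A) (h : A ⊆ e.source) :
    riemannianVolume n X A ≤ chartVolume e A := by
  have key : riemannianVolume n X ≤
      chartVolume e + (⊤ : Measure X).restrict (e.source)ᶜ := by
    refine iSup_le fun y => Measure.le_iff.2 fun B hB => ?_
    have hs := e.open_source.measurableSet
    set f := chartAt (Eu n) y with hf
    have hfs := f.open_source.measurableSet
    rw [← measure_inter_add_sdiff B hs, Measure.add_apply, Measure.restrict_apply hB]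
    refine add_le_add ?_ (le_top (a := chartVolume f) _)
    have h1 : chartVolume f (B ∩ e.source) = chartVolume f (B ∩ e.source ∩ f.source) :=
      (chartVolume_inter_source f _).symm
    rw [h1, chartVolume_eq (isSmoothChart_chartAt y) he ((hB.inter hs).inter hfs)
      inter_subset_right (fun x hx => hx.1.2)]
    exact measure_mono fun x hx => hx.1.1
  refine (key A).trans (le_of_eq ?_)
  rw [Measure.add_apply, Measure.restrict_apply hA, (disjoint_compl_right_iff_subset.2 h).inter_eq]
  simp

/-- The Riemannian volume in the coordinates of a smooth chart. -/
theorem riemannianVolume_restrict [SecondCountableTopology X]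
    {e : OpenPartialHomeomorph X (Eu n)} (he : IsSmoothChart e) :
    (riemannianVolume n X).restrict e.source = chartVolume e := by
  -- Second countability reduces the equality to the domain of one preferred chart. There the lower
  -- bound holds because the volume of that chart is a term of the supremum.
  obtain ⟨s, hs, hcov⟩ := TopologicalSpace.countable_cover_nhds
    (f := fun y : X => (chartAt (Eu n) y).source) (fun y => chart_source_mem_nhds _ y)
  refine (Measure.ext_iff_of_biUnion_eq_univ hs hcov).2 ?_
  intro y _
  ext A hA
  have hys := (chartAt (Eu n) y).open_source.measurableSet
  rw [Measure.restrict_apply hA, Measure.restrict_apply hA,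
    Measure.restrict_apply (hA.inter hys)]
  have hes := e.open_source.measurableSet
  rw [← chartVolume_inter_source e]
  have hm := (hA.inter hys).inter hes
  refine le_antisymm (riemannianVolume_le_chartVolume he hm inter_subset_right) ?_
  rw [chartVolume_eq he (isSmoothChart_chartAt y) hm inter_subset_right (fun x hx => hx.1.2)]
  exact chartVolume_le_riemannianVolume y _

variable [IsContMDiffRiemannianBundle (𝓡 n) ∞ (EuclideanSpace ℝ (Fin n))
    (fun y : X => TangentSpace (𝓡 n) y)]

omit [MeasurableSpace X] [BorelSpace X] in
lemma continuousOn_chartDensity {e : OpenPartialHomeomorph X (Eu n)} (he : IsSmoothChart e) :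
    ContinuousOn (chartDensity e) e.target := by
  have h : ContinuousOn (gramMatrix e) e.target := by
    refine continuousOn_pi.2 fun i => continuousOn_pi.2 fun j => fun z hz => ?_
    have := (contDiffAt_gram he hz).continuousAt
    exact ((this.clm_apply continuousAt_const).clm_apply continuousAt_const).continuousWithinAt
  exact Real.continuous_sqrt.comp_continuousOn
    ((continuous_id.matrix_det).comp_continuousOn h)

variable [SecondCountableTopology X] {e : OpenPartialHomeomorph X (Eu n)} (he : IsSmoothChart e)
  {S : Set (Eu n)} (hS : MeasurableSet S) (hSe : S ⊆ e.target)
include he hS hSe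

omit [RiemannianBundle (fun y : X => TangentSpace (𝓡 n) y)] [IsManifold (𝓡 n) ∞ X]
  [IsContMDiffRiemannianBundle (𝓡 n) ∞ (EuclideanSpace ℝ (Fin n))
    (fun y : X => TangentSpace (𝓡 n) y)] [SecondCountableTopology X] he in
lemma measurableSet_symm_image : MeasurableSet (e.symm '' S) := by
  rw [e.symm_image_eq_source_inter_preimage hSe]
  have h1 : Measurable (e.source.domRestrict e) :=
    (continuousOn_iff_continuous_domRestrict.1 e.continuousOn).measurable
  have h3 := e.open_source.measurableSet.subtype_image (h1 hS)
  convert! h3 using 1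
  ext z
  simp [domRestrict_apply, and_comm]

/-- Integrals for the Riemannian volume in the coordinates of a chart. -/
lemma lintegral_symm_image {f : X → ℝ≥0∞} (hf : Measurable f) :
    ∫⁻ y in e.symm '' S, f y ∂(riemannianVolume n X) =
      ∫⁻ z in S, ENNReal.ofReal (chartDensity e z) * f (e.symm z) := by
  have hT := measurableSet_symm_image hS hSe
  have hTs : e.symm '' S ⊆ e.source := by
    rintro _ ⟨z, hz, rfl⟩; exact e.map_target (hSe hz)
  have h1 : (riemannianVolume n X).restrict (e.symm '' S) =
      (chartVolume e).restrict (e.symm '' S) := by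
    rw [← riemannianVolume_restrict he, Measure.restrict_restrict hT, inter_eq_left.2 hTs]
  have hm : AEMeasurable (fun z => (e.symm '' S).indicator f (e.symm z))
      (volume.restrict e.target) := (hf.indicator hT).comp_aemeasurable
        (e.continuousOn_symm.aemeasurable e.open_target.measurableSet)
  rw [h1, ← lintegral_indicator hT, chartVolume,
    lintegral_map' (hf.indicator hT).aemeasurable (aemeasurable_symm e),
    lintegral_withDensity_eq_lintegral_mul₀
      ((continuousOn_chartDensity he).aemeasurable e.open_target.measurableSet).ennreal_ofReal
      hm, ← lintegral_indicator e.open_target.measurableSet, ← lintegral_indicator hS]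
  congr 1
  ext z
  by_cases hz : z ∈ S
  · simp [hz, hSe hz, indicator_of_mem (mem_image_of_mem e.symm hz)]
  · by_cases hzt : z ∈ e.target
    · have : e.symm z ∉ e.symm '' S := by
        rintro ⟨w, hw, hwz⟩
        exact hz (e.symm.injOn (hSe hw) hzt hwz ▸ hw)
      simp [hz, hzt, this]
    · simp [hz, hzt]

lemma lintegral_symm_image_le {f : X → ℝ≥0∞} (hf : Measurable f) {lam : ℝ}
    (h : ∀ z ∈ S, ∀ w, ‖frame e z w‖ ≤ lam * ‖w‖) :
    ∫⁻ y in e.symm '' S, f y ∂(riemannianVolume n X) ≤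
      ENNReal.ofReal (lam ^ n) * ∫⁻ z in S, f (e.symm z) := by
  rw [lintegral_symm_image he hS hSe hf, ← lintegral_const_mul' _ _ ENNReal.ofReal_ne_top]
  refine setLIntegral_mono' hS fun z hz => ?_
  gcongr
  exact chartDensity_le (h z hz)

lemma le_lintegral_symm_image {f : X → ℝ≥0∞} (hf : Measurable f) {lam : ℝ} (hl : 0 < lam)
    (h : ∀ z ∈ S, ∀ w, ‖w‖ ≤ lam * ‖frame e z w‖) :
    ∫⁻ z in S, f (e.symm z) ≤ ENNReal.ofReal (lam ^ n) *
      ∫⁻ y in e.symm '' S, f y ∂(riemannianVolume n X) := by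
  rw [lintegral_symm_image he hS hSe hf, ← lintegral_const_mul' _ _ ENNReal.ofReal_ne_top]
  refine setLIntegral_mono' hS fun z hz => ?_
  rw [← mul_assoc, ← ENNReal.ofReal_mul (by positivity)]
  have h1 := le_chartDensity hl (h z hz)
  have h2 : 1 ≤ lam ^ n * chartDensity e z := by
    rw [inv_pow, inv_le_iff_one_le_mul₀ (by positivity)] at h1
    linarith
  calc f (e.symm z) = 1 * f (e.symm z) := (one_mul _).symm
    _ ≤ _ := by gcongr; simpa using ENNReal.ofReal_le_ofReal h2

end Volume

/-! ### The Gagliardo–Nirenberg–Sobolev inequality on a cube -/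

section CubeSobolev

attribute [-instance] Bundle.instInnerProductSpaceReal
  Bundle.instNormedAddCommGroupOfRiemannianBundleOfIsTopologicalAddGroupOfContinuousConstSMulReal

/-- By the fundamental theorem of calculus `|g t|` is at most `|g s|` plus the integral of `h`, for
every `s`. Averaging over `s` replaces the usual vanishing at the boundary and produces the term
with `δ⁻¹`. -/
lemma enorm_le_lintegral_Ioo {a δ : ℝ} (hδ : 0 < δ) {g g' h : ℝ → ℝ}
    (hg : ∀ s ∈ Ioo a (a + δ), HasDerivAt g (g' s) s) (hg' : ContinuousOn g' (Ioo a (a + δ)))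
    (hh : ∀ s ∈ Ioo a (a + δ), |g' s| ≤ h s) {t : ℝ} (ht : t ∈ Ioo a (a + δ)) :
    ‖g t‖ₑ ≤ ∫⁻ s in Ioo a (a + δ), (ENNReal.ofReal (h s) + ENNReal.ofReal δ⁻¹ * ‖g s‖ₑ) := by
  set I := ∫⁻ s in Ioo a (a + δ), ENNReal.ofReal (h s) with hI
  have h1 : ∀ s ∈ Ioo a (a + δ), ‖g t‖ₑ ≤ ‖g s‖ₑ + I := by
    intro s hs
    have hsub : uIcc s t ⊆ Ioo a (a + δ) := ordConnected_Ioo.uIcc_subset hs ht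
    have h2 : ∫ x in s..t, g' x = g t - g s :=
      intervalIntegral.integral_eq_sub_of_hasDerivAt (fun x hx => hg x (hsub hx))
        (hg'.mono hsub).intervalIntegrable
    have h3 : ‖g t - g s‖ₑ ≤ I := by
      rw [← h2, ← ofReal_norm, intervalIntegral.norm_intervalIntegral_eq, ofReal_norm]
      refine (enorm_integral_le_lintegral_enorm _).trans ?_
      refine (lintegral_mono_set (uIoc_subset_uIcc.trans hsub)).trans ?_
      refine setLIntegral_mono' measurableSet_Ioo fun x hx => ?_
      rw [← ofReal_norm]
      exact ENNReal.ofReal_le_ofReal (by simpa using hh x hx)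
    calc ‖g t‖ₑ = ‖g s + (g t - g s)‖ₑ := by congr 1; ring
      _ ≤ ‖g s‖ₑ + ‖g t - g s‖ₑ := enorm_add_le _ _
      _ ≤ _ := by gcongr
  have hvol : volume (Ioo a (a + δ)) = ENNReal.ofReal δ := by simp
  have hδ' : ENNReal.ofReal δ⁻¹ * ENNReal.ofReal δ = 1 := by
    rw [← ENNReal.ofReal_mul (by positivity), inv_mul_cancel₀ hδ.ne', ENNReal.ofReal_one]
  calc ‖g t‖ₑ = ENNReal.ofReal δ⁻¹ * ∫⁻ _ in Ioo a (a + δ), ‖g t‖ₑ := by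
        rw [setLIntegral_const, hvol, mul_comm ‖g t‖ₑ, ← mul_assoc, hδ', one_mul]
    _ ≤ ENNReal.ofReal δ⁻¹ * ∫⁻ s in Ioo a (a + δ), (‖g s‖ₑ + I) := by
        gcongr ENNReal.ofReal δ⁻¹ * ?_
        exact setLIntegral_mono' measurableSet_Ioo h1
    _ = I + ∫⁻ s in Ioo a (a + δ), ENNReal.ofReal δ⁻¹ * ‖g s‖ₑ := by
        rw [lintegral_add_right _ measurable_const, setLIntegral_const, hvol, mul_add, mul_comm I,
          ← mul_assoc, hδ', one_mul, lintegral_const_mul' _ _ ENNReal.ofReal_ne_top, add_comm]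
    _ ≤ _ := le_lintegral_add _ _

variable {n : ℕ}

/-- The Gagliardo–Nirenberg–Sobolev inequality on a cube, without boundary conditions. -/
lemma lintegral_rpow_le_of_cube_pi (hn : 2 ≤ n) {p : ℝ} (hp : Real.HolderConjugate n p)
    {a : Fin n → ℝ} {δ : ℝ} (hδ : 0 < δ) {f H : (Fin n → ℝ) → ℝ}
    (hf : ∀ z ∈ Set.pi univ fun i => Ioo (a i) (a i + δ), ContDiffAt ℝ 1 f z)
    (hH : ContinuousOn H (Set.pi univ fun i => Ioo (a i) (a i + δ)))
    (hfH : ∀ z ∈ Set.pi univ fun i => Ioo (a i) (a i + δ), ∀ i,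
      |fderiv ℝ f z (Pi.single i 1)| ≤ H z) :
    ∫⁻ z in Set.pi univ fun i => Ioo (a i) (a i + δ), ‖f z‖ₑ ^ p ≤
      (∫⁻ z in Set.pi univ fun i => Ioo (a i) (a i + δ),
        (ENNReal.ofReal (H z) + ENNReal.ofReal δ⁻¹ * ‖f z‖ₑ)) ^ p := by
  classical
  set D := Set.pi univ fun i => Ioo (a i) (a i + δ) with hD
  have hDm : MeasurableSet D := MeasurableSet.univ_pi fun i => measurableSet_Ioo
  have hDo : IsOpen D := isOpen_set_pi finite_univ fun i _ => isOpen_Ioo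
  have hfc : ContinuousOn f D := fun z hz => (hf z hz).continuousAt.continuousWithinAt
  have hp0 : 0 < p := hp.symm.pos
  -- Extension by zero: integrals of `Φ` over full coordinate lines are integrals over segments of
  -- the cube.
  set Φ : (Fin n → ℝ) → ℝ≥0∞ :=
    D.indicator fun z => ENNReal.ofReal (H z) + ENNReal.ofReal δ⁻¹ * ‖f z‖ₑ with hΦ
  have hΦm : Measurable Φ := by
    have hc : ContinuousOn (fun z => ENNReal.ofReal (H z) + ENNReal.ofReal δ⁻¹ * ‖f z‖ₑ) D :=
      (ENNReal.continuous_ofReal.comp_continuousOn hH).add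
        ((ENNReal.continuous_const_mul ENNReal.ofReal_ne_top).comp_continuousOn hfc.enorm)
    have := hc.measurable_piecewise (g := 0) continuousOn_const hDm
    rwa [piecewise_eq_indicator] at this
  have key : ∀ z ∈ D, ∀ i, ‖f z‖ₑ ≤ ∫⁻ t, Φ (Function.update z i t) := by
    intro z hz i
    have hmem : ∀ t ∈ Ioo (a i) (a i + δ), Function.update z i t ∈ D := by
      intro t ht j _
      by_cases hj : j = i
      · subst hj; simpa using ht
      · simpa [hj] using hz j (mem_univ j)
    have hupd : Continuous (fun t : ℝ => Function.update z i t) :=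
      continuous_const.update i continuous_id
    have hder : ∀ s ∈ Ioo (a i) (a i + δ), HasDerivAt (fun t => f (Function.update z i t))
        (fderiv ℝ f (Function.update z i s) (Pi.single i 1)) s := fun s hs =>
      ((hf _ (hmem s hs)).differentiableAt (by simp)).hasFDerivAt.comp_hasDerivAt s
        (hasDerivAt_update z i s)
    have hcont : ContinuousOn (fun s => fderiv ℝ f (Function.update z i s) (Pi.single i 1))
        (Ioo (a i) (a i + δ)) := by
      intro s hs
      have h1 : ContinuousAt (fderiv ℝ f) (Function.update z i s) :=
        ((hf _ (hmem s hs)).fderiv_right (m := 0) (by simp)).continuousAt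
      have h2 : ContinuousAt (fun s => fderiv ℝ f (Function.update z i s)) s :=
        ContinuousAt.comp (f := fun s => Function.update z i s) h1 hupd.continuousAt
      exact (h2.clm_apply continuousAt_const).continuousWithinAt
    have := enorm_le_lintegral_Ioo hδ hder hcont (h := fun s => H (Function.update z i s))
      (fun s hs => hfH _ (hmem s hs) i) (t := z i) (hz i (mem_univ i))
    simp only [Function.update_eq_self] at this
    refine this.trans ?_
    rw [← lintegral_indicator measurableSet_Ioo]
    refine lintegral_mono fun t => ?_
    by_cases ht : t ∈ Ioo (a i) (a i + δ)
    · simp [hΦ, ht, hmem t ht]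
    · simp [ht]
  have hn1 : (0 : ℝ) < n - 1 := by
    have : (2 : ℝ) ≤ n := by exact_mod_cast hn
    linarith
  -- As `p = n / (n - 1)`, the power `|f|^p` is a product of `n` factors `|f|^(1/(n-1))`, one for
  -- each direction. Each is bounded by a line integral, and the product of line integrals is
  -- handled by the Loomis–Whitney type lemma behind the classical inequality.
  calc ∫⁻ z in D, ‖f z‖ₑ ^ p ≤ ∫⁻ z in D, ∏ i, (∫⁻ t, Φ (Function.update z i t)) ^
        ((1 : ℝ) / (Fintype.card (Fin n) - 1 : ℝ)) := by
        refine setLIntegral_mono' hDm fun z hz => ?_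
        have h1 : ‖f z‖ₑ ^ p = ∏ _i : Fin n, ‖f z‖ₑ ^ ((1 : ℝ) / (Fintype.card (Fin n) - 1 : ℝ)) := by
          rw [Finset.prod_const, Finset.card_univ, Fintype.card_fin, ← ENNReal.rpow_natCast,
            ← ENNReal.rpow_mul, hp.conjugate_eq]
          congr 1
          field_simp
        rw [h1]
        refine Finset.prod_le_prod' fun i _ => ?_
        refine ENNReal.rpow_le_rpow (key z hz i) ?_
        rw [Fintype.card_fin]; positivity
    _ ≤ ∫⁻ z, ∏ i, (∫⁻ t, Φ (Function.update z i t)) ^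
        ((1 : ℝ) / (Fintype.card (Fin n) - 1 : ℝ)) := lintegral_mono' Measure.restrict_le_self le_rfl
    _ ≤ (∫⁻ z, Φ z) ^ p := by
        refine lintegral_prod_lintegral_pow_le (fun _ => volume) ?_ hΦm
        rwa [Fintype.card_fin]
    _ = _ := by rw [hΦ, lintegral_indicator hDm]

/-- A cube in `ℝⁿ`. -/
def cube (a : Fin n → ℝ) (δ : ℝ) : Set (Eu n) := {z | ∀ i, z i ∈ Ioo (a i) (a i + δ)}

lemma cube_eq_preimage (a : Fin n → ℝ) (δ : ℝ) :
    cube a δ = WithLp.ofLp ⁻¹' Set.pi univ fun i => Ioo (a i) (a i + δ) := by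
  ext z; simp [cube]

lemma isOpen_cube (a : Fin n → ℝ) (δ : ℝ) : IsOpen (cube a δ) := by
  rw [cube_eq_preimage]
  exact (isOpen_set_pi finite_univ fun i _ => isOpen_Ioo).preimage
    (PiLp.continuous_ofLp 2 _)

lemma volume_cube_lt_top (a : Fin n → ℝ) (δ : ℝ) : volume (cube a δ) < (⊤ : ℝ≥0∞) := by
  rw [cube_eq_preimage, (PiLp.volume_preserving_ofLp (Fin n)).measure_preimage
    (MeasurableSet.univ_pi fun i => measurableSet_Ioo).nullMeasurableSet, Real.volume_pi_Ioo]
  exact ENNReal.prod_lt_top fun i _ => ENNReal.ofReal_lt_top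

/-- The Gagliardo–Nirenberg–Sobolev inequality on a cube, without boundary conditions. -/
lemma lintegral_rpow_le_of_cube (hn : 2 ≤ n) {p : ℝ} (hp : Real.HolderConjugate n p)
    {a : Fin n → ℝ} {δ : ℝ} (hδ : 0 < δ) {f H : Eu n → ℝ}
    (hf : ∀ z ∈ cube a δ, ContDiffAt ℝ 1 f z) (hH : ContinuousOn H (cube a δ))
    (hfH : ∀ z ∈ cube a δ, ∀ w, |fderiv ℝ f z w| ≤ H z * ‖w‖) :
    ∫⁻ z in cube a δ, ‖f z‖ₑ ^ p ≤
      (∫⁻ z in cube a δ, (ENNReal.ofReal (H z) + ENNReal.ofReal δ⁻¹ * ‖f z‖ₑ)) ^ p := by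
  have hmp := (EuclideanSpace.volume_preserving_symm_measurableEquiv_toLp (Fin n)).symm
  let L := (PiLp.continuousLinearEquiv 2 ℝ (fun _ : Fin n => ℝ)).symm
  have hmem : ∀ z, L z ∈ cube a δ ↔ z ∈ Set.pi univ fun i => Ioo (a i) (a i + δ) := by
    intro z; simp [cube, L]
  have hpre : L ⁻¹' cube a δ = Set.pi univ fun i => Ioo (a i) (a i + δ) := by
    ext z; exact hmem z
  have hcv : ∀ F : Eu n → ℝ≥0∞, ∫⁻ z in cube a δ, F z =
      ∫⁻ z in Set.pi univ fun i => Ioo (a i) (a i + δ), F (L z) := by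
    intro F
    rw [← hpre]
    exact (hmp.setLIntegral_comp_preimage_emb (MeasurableEquiv.measurableEmbedding _) F _).symm
  rw [hcv, hcv]
  refine lintegral_rpow_le_of_cube_pi hn hp hδ (f := f ∘ L) (H := H ∘ L) ?_ ?_ ?_
  · intro z hz
    exact (hf _ ((hmem z).2 hz)).comp z L.contDiff.contDiffAt
  · exact hH.comp L.continuous.continuousOn fun z hz => (hmem z).2 hz
  · intro z hz i
    have hd := ((hf _ ((hmem z).2 hz)).differentiableAt (by simp)).hasFDerivAt.comp z
      L.hasFDerivAt
    rw [hd.fderiv]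
    have h1 : L (Pi.single i 1) = EuclideanSpace.single i (1 : ℝ) := by
      ext j; simp [L]
    have := hfH _ ((hmem z).2 hz) (L (Pi.single i 1))
    rw [h1] at this
    simp only [PiLp.norm_single, norm_one, mul_one] at this
    rw [← h1] at this
    exact this

end CubeSobolev

/-! ### Tame covers and the global `W^{1,1}` inequality -/

section TameCover

variable {n : ℕ} {X : Type*} [TopologicalSpace X] [ChartedSpace (EuclideanSpace ℝ (Fin n)) X]
  [IsManifold (𝓡 n) ∞ X] [RiemannianBundle (fun y : X => TangentSpace (𝓡 n) y)]

/-- A cube in the target of a smooth chart on which the metric is comparable to the Euclidean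
metric. -/
structure IsTameCube (e : OpenPartialHomeomorph X (Eu n)) (a : Fin n → ℝ) (δ lam : ℝ) : Prop where
  isSmoothChart : IsSmoothChart e
  pos : 0 < δ
  one_le : 1 ≤ lam
  subset_target : cube a δ ⊆ e.target
  norm_frame_le : ∀ z ∈ cube a δ, ∀ w, ‖frame e z w‖ ≤ lam * ‖w‖
  le_norm_frame : ∀ z ∈ cube a δ, ∀ w, ‖w‖ ≤ lam * ‖frame e z w‖

variable (n X) in
/-- The space is a finite union of tame cubes, expressed as an induction principle. -/
def IsTamelyCovered : Prop :=
  ∀ P : Set X → Prop, P ∅ → (∀ s t, s ⊆ t → P t → P s) → (∀ s t, P s → P t → P (s ∪ t)) →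
    (∀ (e : OpenPartialHomeomorph X (Eu n)) (a : Fin n → ℝ) (δ lam : ℝ),
      IsTameCube e a δ lam → P (e.symm '' cube a δ)) → P univ

variable [IsContMDiffRiemannianBundle (𝓡 n) ∞ (EuclideanSpace ℝ (Fin n))
    (fun y : X => TangentSpace (𝓡 n) y)] [MeasurableSpace X] [BorelSpace X]
    [SecondCountableTopology X]

lemma riemannianVolume_univ_lt_top (hX : IsTamelyCovered n X) :
    riemannianVolume n X univ < (⊤ : ℝ≥0∞) := by
  refine hX (fun W => riemannianVolume n X W < (⊤ : ℝ≥0∞)) (by simp)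
    (fun s t hst ht => (measure_mono hst).trans_lt ht)
    (fun s t hs ht => measure_union_lt_top hs ht) fun e a δ lam h => ?_
  have h1 := lintegral_symm_image_le h.isSmoothChart (isOpen_cube a δ).measurableSet
    h.subset_target (f := fun _ => 1) measurable_const h.norm_frame_le
  simp only [lintegral_const, one_mul, Measure.restrict_apply, MeasurableSet.univ,
    univ_inter] at h1
  exact h1.trans_lt (ENNReal.mul_lt_top ENNReal.ofReal_lt_top (volume_cube_lt_top a δ))

lemma HasSlopeBound.continuous {f G : X → ℝ} (h : HasSlopeBound n f G) : Continuous f :=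
  continuous_of_comp_symm fun e he z hz => (h e he z hz).1.continuousAt

/-- The Sobolev inequality for `C¹` functions with exponent one. -/
theorem exists_lintegral_rpow_le (hX : IsTamelyCovered n X) (hn : 2 ≤ n) {p : ℝ}
    (hp : Real.HolderConjugate n p) : ∃ C : ℝ, 0 ≤ C ∧ ∀ f G : X → ℝ, HasSlopeBound n f G →
      Continuous G → (∀ y, 0 ≤ G y) →
      ∫⁻ y, ‖f y‖ₑ ^ p ∂(riemannianVolume n X) ≤
        (ENNReal.ofReal C * ∫⁻ y, (ENNReal.ofReal (G y) + ‖f y‖ₑ) ∂(riemannianVolume n X)) ^ p := by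
  have hp1 : 1 ≤ p := hp.symm.lt.le
  have hp0 : 0 ≤ p := by linarith
  suffices H : ∃ C : ℝ, 0 ≤ C ∧ ∀ f G : X → ℝ, HasSlopeBound n f G →
      Continuous G → (∀ y, 0 ≤ G y) → ∫⁻ y in univ, ‖f y‖ₑ ^ p ∂(riemannianVolume n X) ≤
        (ENNReal.ofReal C * ∫⁻ y, (ENNReal.ofReal (G y) + ‖f y‖ₑ) ∂(riemannianVolume n X)) ^ p by
    simpa only [Measure.restrict_univ] using H
  refine hX (fun W => ∃ C : ℝ, 0 ≤ C ∧ ∀ f G : X → ℝ, HasSlopeBound n f G →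
      Continuous G → (∀ y, 0 ≤ G y) → ∫⁻ y in W, ‖f y‖ₑ ^ p ∂(riemannianVolume n X) ≤
        (ENNReal.ofReal C *
          ∫⁻ y, (ENNReal.ofReal (G y) + ‖f y‖ₑ) ∂(riemannianVolume n X)) ^ p) ?_ ?_ ?_ ?_
  · exact ⟨0, le_rfl, fun f G _ _ _ => by simp⟩
  · rintro s t hst ⟨C, hC, h⟩
    exact ⟨C, hC, fun f G h1 h2 h3 => (lintegral_mono_set hst).trans (h f G h1 h2 h3)⟩
  · rintro s t ⟨C, hC, h⟩ ⟨C', hC', h'⟩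
    -- The constants sit inside the `p`-th power and add, because `a ^ p + b ^ p ≤ (a + b) ^ p` for
    -- `p ≥ 1`.
    refine ⟨C + C', add_nonneg hC hC', fun f G h1 h2 h3 => ?_⟩
    refine (lintegral_union_le _ _ _).trans ((add_le_add (h f G h1 h2 h3) (h' f G h1 h2 h3)).trans
      ((ENNReal.add_rpow_le_rpow_add _ _ hp1).trans (le_of_eq ?_)))
    rw [ENNReal.ofReal_add hC hC', add_mul]
  · intro e a δ lam h
    have hl0 : 0 < lam := lt_of_lt_of_le one_pos h.one_le
    have hδ := h.pos
    -- The two factors `lam ^ n` compare the volumes, from the manifold to the cube and back; the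
    -- first enters the `p`-th power since `lam ≥ 1`. The middle factor combines the slope bound
    -- `lam * G` with the zeroth order term of the cube inequality.
    refine ⟨lam ^ n * ((lam + δ⁻¹) * lam ^ n), by positivity, fun f G h1 h2 h3 => ?_⟩
    have hQm := (isOpen_cube a δ).measurableSet
    have hfc := h1.continuous
    have hm : Measurable fun y => ENNReal.ofReal (G y) + ‖f y‖ₑ :=
      h2.measurable.ennreal_ofReal.add hfc.measurable.enorm
    have s1 := lintegral_symm_image_le h.isSmoothChart hQm h.subset_target
      (f := fun y => ‖f y‖ₑ ^ p) (hfc.measurable.enorm.pow_const p) h.norm_frame_le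
    have s2 := lintegral_rpow_le_of_cube hn hp h.pos (f := f ∘ e.symm)
      (H := fun z => lam * G (e.symm z))
      (fun z hz => (h1 e h.isSmoothChart z (h.subset_target hz)).1)
      (continuousOn_const.mul (h2.comp_continuousOn (e.continuousOn_symm.mono h.subset_target)))
      (fun z hz w => by
        refine ((h1 e h.isSmoothChart z (h.subset_target hz)).2 w).trans ?_
        calc G (e.symm z) * ‖frame e z w‖ ≤ G (e.symm z) * (lam * ‖w‖) :=
              mul_le_mul_of_nonneg_left (h.norm_frame_le z hz w) (h3 _)
          _ = _ := by ring)
    have s3 := le_lintegral_symm_image h.isSmoothChart hQm h.subset_target hm hl0 h.le_norm_frame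
    have s4 : ∫⁻ z in cube a δ, (ENNReal.ofReal (lam * G (e.symm z)) +
        ENNReal.ofReal δ⁻¹ * ‖(f ∘ e.symm) z‖ₑ) ≤ ENNReal.ofReal (lam + δ⁻¹) *
          ∫⁻ z in cube a δ, (ENNReal.ofReal (G (e.symm z)) + ‖f (e.symm z)‖ₑ) := by
      rw [← lintegral_const_mul' _ _ ENNReal.ofReal_ne_top]
      refine lintegral_mono fun z => ?_
      simp only [Function.comp_apply]
      rw [ENNReal.ofReal_mul hl0.le, ENNReal.ofReal_add hl0.le (by positivity), mul_add]
      gcongr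
      · exact le_self_add
      · exact le_add_self
    have hle : ENNReal.ofReal (lam ^ n) ≤ ENNReal.ofReal (lam ^ n) ^ p := by
      have : (1 : ℝ≥0∞) ≤ ENNReal.ofReal (lam ^ n) := by
        rw [ENNReal.one_le_ofReal]; exact one_le_pow₀ h.one_le
      calc _ = ENNReal.ofReal (lam ^ n) ^ (1 : ℝ) := (ENNReal.rpow_one _).symm
        _ ≤ _ := ENNReal.rpow_le_rpow_of_exponent_le this hp1
    calc _ ≤ _ := s1
      _ ≤ ENNReal.ofReal (lam ^ n) ^ p * (ENNReal.ofReal (lam + δ⁻¹) *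
          (ENNReal.ofReal (lam ^ n) * ∫⁻ y in e.symm '' cube a δ,
            (ENNReal.ofReal (G y) + ‖f y‖ₑ) ∂(riemannianVolume n X))) ^ p := by
          refine mul_le_mul' hle (s2.trans (ENNReal.rpow_le_rpow (s4.trans ?_) hp0))
          gcongr
      _ ≤ _ := by
          rw [← ENNReal.mul_rpow_of_nonneg _ _ hp0, ENNReal.ofReal_mul (by positivity),
            ENNReal.ofReal_mul (by positivity)]
          refine ENNReal.rpow_le_rpow ?_ hp0
          simp only [mul_assoc]
          gcongr
          exact Measure.restrict_le_self

end TameCover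

/-! ### Sobolev norms are finite seminorms on test functions -/

section SobolevNorms

variable {n : ℕ} {X : Type*} [TopologicalSpace X] [ChartedSpace (EuclideanSpace ℝ (Fin n)) X]
  [IsManifold (𝓡 n) ∞ X] [RiemannianBundle (fun y : X => TangentSpace (𝓡 n) y)]
  [IsContMDiffRiemannianBundle (𝓡 n) ∞ (EuclideanSpace ℝ (Fin n))
    (fun y : X => TangentSpace (𝓡 n) y)] [MeasurableSpace X] [BorelSpace X]

variable (n) in
/-- The `L^r`-norm of `|∇^i u|`. -/
def nablaLp (r : ℝ) (u : X → ℝ) (i : ℕ) : ℝ≥0∞ := eLpNorm' (nablaNorm n u i) r (riemannianVolume n X)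

lemma nablaLp_eq (r : ℝ) (u : X → ℝ) (i : ℕ) : nablaLp n r u i =
    (∫⁻ y, ENNReal.ofReal (nablaNorm n u i y) ^ r ∂(riemannianVolume n X)) ^ (1 / r) := by
  rw [nablaLp, eLpNorm'_eq_lintegral_enorm]
  simp only [Real.enorm_of_nonneg (nablaNorm_nonneg _ _)]

lemma nablaLp_rpow {r : ℝ} (hr : 0 < r) (u : X → ℝ) (i : ℕ) : nablaLp n r u i ^ r =
    ∫⁻ y, ENNReal.ofReal (nablaNorm n u i y) ^ r ∂(riemannianVolume n X) := by
  rw [nablaLp_eq, ← ENNReal.rpow_mul, one_div_mul_cancel hr.ne', ENNReal.rpow_one]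

variable {u v : X → ℝ}

lemma measurable_nablaNorm (hu : ContMDiff (𝓡 n) 𝓘(ℝ, ℝ) ∞ u) (i : ℕ) :
    Measurable (nablaNorm n u i) := (continuous_nablaNorm hu i).measurable

lemma sobolevNorm_eq_lintegral {r : ℝ} (hr : 0 < r) (u : X → ℝ) (k : ℕ) : sobolevNorm n k r u =
    (∫⁻ y, ∑ i ∈ Finset.range (k + 1), ENNReal.ofReal (nablaNorm n u i y) ^ r
      ∂(riemannianVolume n X)) ^ (1 / r) := by
  simp only [sobolevNorm, ENNReal.ofReal_rpow_of_nonneg (nablaNorm_nonneg _ _) hr.le]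

lemma sobolevNorm_eq {r : ℝ} (hr : 0 < r) (hu : ContMDiff (𝓡 n) 𝓘(ℝ, ℝ) ∞ u) (k : ℕ) :
    sobolevNorm n k r u = (∑ i ∈ Finset.range (k + 1), nablaLp n r u i ^ r) ^ (1 / r) := by
  rw [sobolevNorm_eq_lintegral hr, lintegral_finsetSum]
  · simp only [nablaLp_rpow hr]
  · exact fun i _ => (measurable_nablaNorm hu i).ennreal_ofReal.pow_const r

lemma nablaLp_le_sobolevNorm {r : ℝ} (hr : 0 < r) (hu : ContMDiff (𝓡 n) 𝓘(ℝ, ℝ) ∞ u) {i k : ℕ}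
    (hik : i ≤ k) : nablaLp n r u i ≤ sobolevNorm n k r u := by
  rw [sobolevNorm_eq hr hu]
  calc nablaLp n r u i = (nablaLp n r u i ^ r) ^ (1 / r) := by
        rw [← ENNReal.rpow_mul, mul_one_div_cancel hr.ne', ENNReal.rpow_one]
    _ ≤ _ := ENNReal.rpow_le_rpow
        (Finset.single_le_sum (f := fun i => nablaLp n r u i ^ r) (fun _ _ => zero_le)
          (Finset.mem_range.2 (by omega)))
        (by positivity)

lemma sum_rpow_le_rpow_sum {ι : Type*} (s : Finset ι) (f : ι → ℝ≥0∞) {r : ℝ} (hr : 1 ≤ r) :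
    ∑ i ∈ s, f i ^ r ≤ (∑ i ∈ s, f i) ^ r := by
  classical
  induction s using Finset.induction_on with
  | empty => simp
  | insert a s ha ih =>
    rw [Finset.sum_insert ha, Finset.sum_insert ha]
    exact (add_le_add le_rfl ih).trans (ENNReal.add_rpow_le_rpow_add _ _ hr)

lemma sobolevNorm_le_sum {r : ℝ} (hr : 1 ≤ r) (hu : ContMDiff (𝓡 n) 𝓘(ℝ, ℝ) ∞ u) (k : ℕ) :
    sobolevNorm n k r u ≤ ∑ i ∈ Finset.range (k + 1), nablaLp n r u i := by
  have hr0 : 0 < r := by linarith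
  rw [sobolevNorm_eq hr0 hu]
  refine (ENNReal.rpow_le_rpow (sum_rpow_le_rpow_sum _ _ hr) (by positivity)).trans (le_of_eq ?_)
  rw [← ENNReal.rpow_mul, mul_one_div_cancel hr0.ne', ENNReal.rpow_one]

lemma lintegral_nablaNorm_rpow_lt_top (hvol : riemannianVolume n X univ < (⊤ : ℝ≥0∞))
    (hu : ContMDiff (𝓡 n) 𝓘(ℝ, ℝ) ∞ u) (hc : HasCompactSupport u) {r : ℝ} (hr : 0 ≤ r) (i : ℕ) :
    ∫⁻ y, ENNReal.ofReal (nablaNorm n u i y) ^ r ∂(riemannianVolume n X) < (⊤ : ℝ≥0∞) := by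
  obtain ⟨C, hC⟩ := (continuous_nablaNorm hu i).bounded_above_of_compact_support
    (hasCompactSupport_nablaNorm hu hc i)
  calc _ ≤ ∫⁻ _, ENNReal.ofReal C ^ r ∂(riemannianVolume n X) := by
        refine lintegral_mono fun y => ENNReal.rpow_le_rpow (ENNReal.ofReal_le_ofReal ?_) hr
        exact (le_abs_self _).trans (hC y)
    _ = ENNReal.ofReal C ^ r * riemannianVolume n X univ := lintegral_const _
    _ < _ := ENNReal.mul_lt_top (ENNReal.rpow_lt_top_of_nonneg hr ENNReal.ofReal_ne_top) hvol

lemma nablaLp_lt_top (hvol : riemannianVolume n X univ < (⊤ : ℝ≥0∞))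
    (hu : ContMDiff (𝓡 n) 𝓘(ℝ, ℝ) ∞ u) (hc : HasCompactSupport u) {r : ℝ} (hr : 0 < r) (i : ℕ) :
    nablaLp n r u i < (⊤ : ℝ≥0∞) := by
  rw [nablaLp_eq]
  exact ENNReal.rpow_lt_top_of_nonneg (by positivity)
    (lintegral_nablaNorm_rpow_lt_top hvol hu hc hr.le i).ne

lemma sobolevNorm_lt_top (hvol : riemannianVolume n X univ < (⊤ : ℝ≥0∞))
    (hu : ContMDiff (𝓡 n) 𝓘(ℝ, ℝ) ∞ u) (hc : HasCompactSupport u) {r : ℝ} (hr : 1 ≤ r) (k : ℕ) :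
    sobolevNorm n k r u < (⊤ : ℝ≥0∞) :=
  (sobolevNorm_le_sum hr hu k).trans_lt (ENNReal.sum_lt_top.2 fun i _ =>
    nablaLp_lt_top hvol hu hc (by linarith) i)

lemma sobolevNorm_add_le {r : ℝ} (hr : 1 ≤ r) (hu : ContMDiff (𝓡 n) 𝓘(ℝ, ℝ) ∞ u)
    (hv : ContMDiff (𝓡 n) 𝓘(ℝ, ℝ) ∞ v) (k : ℕ) :
    sobolevNorm n k r (u + v) ≤ sobolevNorm n k r u + sobolevNorm n k r v := by
  have hr0 : 0 < r := by linarith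
  have hm : ∀ {w : X → ℝ}, ContMDiff (𝓡 n) 𝓘(ℝ, ℝ) ∞ w → AEMeasurable (fun y =>
      (∑ i ∈ Finset.range (k + 1), ENNReal.ofReal (nablaNorm n w i y) ^ r) ^ (1 / r))
      (riemannianVolume n X) := fun hw =>
    ((Finset.measurable_fun_sum _ fun i _ =>
      (measurable_nablaNorm hw i).ennreal_ofReal.pow_const r).pow_const _).aemeasurable
  have hpow : ∀ a : ℝ≥0∞, a = (a ^ (1 / r)) ^ r := fun a => by
    rw [← ENNReal.rpow_mul, one_div_mul_cancel hr0.ne', ENNReal.rpow_one]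
  simp only [sobolevNorm_eq_lintegral hr0]
  -- Minkowski's inequality is used in `L^r` here and in `ℓ^r` over the orders `i` at the end.
  have key := ENNReal.lintegral_Lp_add_le (hm hu) (hm hv) hr
  simp only [← hpow] at key
  refine le_trans (ENNReal.rpow_le_rpow (lintegral_mono fun y => ?_) (by positivity)) key
  rw [hpow (∑ i ∈ Finset.range (k + 1), ENNReal.ofReal (nablaNorm n (u + v) i y) ^ r)]
  refine ENNReal.rpow_le_rpow ?_ hr0.le
  refine le_trans (ENNReal.rpow_le_rpow (Finset.sum_le_sum fun i _ =>
    ENNReal.rpow_le_rpow (ENNReal.ofReal_le_ofReal (nablaNorm_add_le hu hv i y)) hr0.le)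
    (by positivity)) ?_
  simp only [ENNReal.ofReal_add (nablaNorm_nonneg _ _) (nablaNorm_nonneg _ _)]
  exact ENNReal.Lp_add_le _ _ _ hr

lemma sobolevNorm_smul {r : ℝ} (hr : 1 ≤ r) (c : ℝ) (hu : ContMDiff (𝓡 n) 𝓘(ℝ, ℝ) ∞ u) (k : ℕ) :
    sobolevNorm n k r (c • u) = ENNReal.ofReal |c| * sobolevNorm n k r u := by
  have hr0 : 0 < r := by linarith
  simp only [sobolevNorm_eq_lintegral hr0, nablaNorm_smul c hu, ENNReal.ofReal_mul (abs_nonneg c),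
    ENNReal.mul_rpow_of_nonneg _ _ hr0.le, ← Finset.mul_sum]
  rw [lintegral_const_mul' _ _ (ENNReal.rpow_ne_top_of_nonneg hr0.le ENNReal.ofReal_ne_top),
    ENNReal.mul_rpow_of_nonneg _ _ (by positivity), ← ENNReal.rpow_mul,
    mul_one_div_cancel hr0.ne', ENNReal.rpow_one]

variable (n X) in
-- Guarantees that `sobolevSeminorm` takes its first branch, so that the completion carries the
-- intended norm and not zero.
lemma exists_seminorm (hvol : riemannianVolume n X univ < (⊤ : ℝ≥0∞)) (k : ℕ) {r : ℝ}
    (hr : 1 ≤ r) : ∃ s : Seminorm ℝ (TestFun n X),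
      ∀ u, ENNReal.ofReal (s u) = sobolevNorm n k r (u : X → ℝ) := by
  have hfin : ∀ u : TestFun n X, sobolevNorm n k r (u : X → ℝ) ≠ (⊤ : ℝ≥0∞) := fun u =>
    (sobolevNorm_lt_top hvol u.2.1 u.2.2 hr k).ne
  refine ⟨Seminorm.of (fun u => (sobolevNorm n k r (u : X → ℝ)).toReal) ?_ ?_, fun u => ?_⟩
  · intro u v
    rw [← ENNReal.toReal_add (hfin u) (hfin v)]
    exact ENNReal.toReal_mono (ENNReal.add_ne_top.2 ⟨hfin u, hfin v⟩)
      (sobolevNorm_add_le hr u.2.1 v.2.1 k)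
  · intro c u
    have : ((c • u : TestFun n X) : X → ℝ) = c • (u : X → ℝ) := rfl
    rw [this, sobolevNorm_smul hr c u.2.1, ENNReal.toReal_mul,
      ENNReal.toReal_ofReal (abs_nonneg c), Real.norm_eq_abs]
  · exact ENNReal.ofReal_toReal (hfin u)

lemma ofReal_sobolevSeminorm (hvol : riemannianVolume n X univ < (⊤ : ℝ≥0∞)) (k : ℕ) {r : ℝ}
    (hr : 1 ≤ r) (u : TestFun n X) :
    ENNReal.ofReal (sobolevSeminorm n X k r u) = sobolevNorm n k r (u : X → ℝ) := by
  have h := exists_seminorm n X hvol k hr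
  rw [sobolevSeminorm, dif_pos h]
  exact h.choose_spec u

lemma ofReal_norm_toSobolev (hvol : riemannianVolume n X univ < (⊤ : ℝ≥0∞)) (k : ℕ) {r : ℝ}
    (hr : 1 ≤ r) (u : TestFun n X) :
    ENNReal.ofReal ‖toSobolev k r u‖ = sobolevNorm n k r (u : X → ℝ) := by
  rw [← ofReal_sobolevSeminorm hvol k hr u, toSobolev, UniformSpace.Completion.norm_coe]
  rfl

end SobolevNorms

/-! ### The Sobolev inequality on a tamely covered manifold -/

section SobolevInequality

variable {n : ℕ} {X : Type*} [TopologicalSpace X] [ChartedSpace (EuclideanSpace ℝ (Fin n)) X]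
  [IsManifold (𝓡 n) ∞ X] [RiemannianBundle (fun y : X => TangentSpace (𝓡 n) y)]
  [IsContMDiffRiemannianBundle (𝓡 n) ∞ (EuclideanSpace ℝ (Fin n))
    (fun y : X => TangentSpace (𝓡 n) y)] [MeasurableSpace X] [BorelSpace X]
  [SecondCountableTopology X]

/-- The Sobolev inequality for the iterated covariant derivatives, in one step. -/
theorem exists_nablaLp_le (hX : IsTamelyCovered n X) {p q : ℝ} (hp : 1 < p) (hpn : p < n)
    (hq : 1 / q = 1 / p - 1 / n) : ∃ C : ℝ, 0 ≤ C ∧ ∀ u ∈ TestFun n X, ∀ i : ℕ,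
      nablaLp n q u i ≤ ENNReal.ofReal C * (nablaLp n p u i + nablaLp n p u (i + 1)) := by
  have hvol := riemannianVolume_univ_lt_top hX
  have hn2 : 2 ≤ n := by
    have : (1 : ℝ) < n := hp.trans hpn
    exact_mod_cast this
  have hn1 : (1 : ℝ) < n := hp.trans hpn
  have hn0 : (0 : ℝ) < n := by linarith
  have hp0 : 0 < p := by linarith
  have hq0 : 0 < q := by
    have : 0 < 1 / q := by rw [hq, sub_pos]; exact one_div_lt_one_div_of_lt hp0 hpn
    exact one_div_pos.1 this
  -- Here `m = n / (n - 1)`, and `γ = q / m` makes the `m`-th power of `|∇^i u|^γ` equal to `|∇^i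
  -- u|^q`. The identity `γ - 1 = q / p'` makes the factor `|∇^i u|^(γ-1)` in Hölder's inequality
  -- yield the same integral `A`.
  set m : ℝ := Real.conjExponent n with hm
  have hmc : Real.HolderConjugate n m := Real.HolderConjugate.conjExponent hn1
  set p' : ℝ := Real.conjExponent p with hp'
  have hpc : Real.HolderConjugate p p' := Real.HolderConjugate.conjExponent hp
  have hm0 : 0 < m := hmc.symm.pos
  set γ : ℝ := q / m with hγ
  have hminv : 1 / m = 1 - 1 / n := by
    have := hmc.inv_add_inv_eq_one
    simp only [one_div]; linarith
  have hpinv : 1 / p' = 1 - 1 / p := by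
    have := hpc.inv_add_inv_eq_one
    simp only [one_div]; linarith
  have hγ1 : γ - 1 = q / p' := by
    rw [hγ, div_eq_mul_one_div, div_eq_mul_one_div q p', hminv, hpinv]
    have : q * (1 / q) = 1 := mul_one_div_cancel hq0.ne'
    rw [hq] at this
    linarith
  have hp'0 : 0 < p' := hpc.symm.pos
  have hγ1' : 1 < γ := by
    have : 0 < q / p' := by positivity
    linarith
  obtain ⟨C, hC, h⟩ := exists_lintegral_rpow_le hX hn2 hmc
  refine ⟨C * γ, by positivity, ?_⟩
  rintro u ⟨hu, hc⟩ i
  set μ := riemannianVolume n X with hμ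
  set a : X → ℝ≥0∞ := fun y => ENNReal.ofReal (nablaNorm n u i y) with ha
  set b : X → ℝ≥0∞ := fun y => ENNReal.ofReal (nablaNorm n u (i + 1) y) with hb
  have ham : Measurable a := (measurable_nablaNorm hu i).ennreal_ofReal
  have hbm : Measurable b := (measurable_nablaNorm hu (i + 1)).ennreal_ofReal
  set A : ℝ≥0∞ := ∫⁻ y, a y ^ q ∂μ with hA
  have hAt : A ≠ (⊤ : ℝ≥0∞) := (lintegral_nablaNorm_rpow_lt_top hvol hu hc hq0.le i).ne
  set B : ℝ≥0∞ := (∫⁻ y, (ENNReal.ofReal γ * b y + a y) ^ p ∂μ) ^ (1 / p) with hB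
  have hcont : Continuous (fun y => γ * nablaNorm n u i y ^ (γ - 1) * nablaNorm n u (i + 1) y) :=
    (continuous_const.mul ((continuous_nablaNorm hu i).rpow_const fun _ => Or.inr (by linarith))).mul
      (continuous_nablaNorm hu (i + 1))
  have s1 := h _ _ (hasSlopeBound_nablaNorm_rpow hu i hγ1') hcont (fun y =>
    mul_nonneg (mul_nonneg (by linarith) (Real.rpow_nonneg (nablaNorm_nonneg _ _) _))
      (nablaNorm_nonneg _ _))
  have e1 : ∀ y, ‖nablaNorm n u i y ^ γ‖ₑ = a y ^ γ := by
    intro y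
    rw [Real.enorm_of_nonneg (Real.rpow_nonneg (nablaNorm_nonneg _ _) _),
      ENNReal.ofReal_rpow_of_nonneg (nablaNorm_nonneg _ _) (by linarith)]
  have e2 : ∀ y, ‖nablaNorm n u i y ^ γ‖ₑ ^ m = a y ^ q := by
    intro y
    rw [e1, ← ENNReal.rpow_mul, hγ, div_mul_cancel₀ _ hm0.ne']
  have e3 : ∀ y, ENNReal.ofReal (γ * nablaNorm n u i y ^ (γ - 1) * nablaNorm n u (i + 1) y) +
      ‖nablaNorm n u i y ^ γ‖ₑ = (a y ^ (γ - 1)) * (ENNReal.ofReal γ * b y + a y) := by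
    intro y
    rw [e1, ENNReal.ofReal_mul (mul_nonneg (by linarith) (Real.rpow_nonneg (nablaNorm_nonneg _ _) _)),
      ENNReal.ofReal_mul (by linarith), ← ENNReal.ofReal_rpow_of_nonneg (nablaNorm_nonneg _ _)
        (by linarith), mul_add]
    congr 1
    · simp only [ha, hb]; ring
    · conv_lhs => rw [show γ = (γ - 1) + 1 by ring, ENNReal.rpow_add_of_nonneg _ _
        (by linarith) zero_le_one, ENNReal.rpow_one]
  simp only [e2, e3] at s1
  have s2 := ENNReal.lintegral_mul_le_Lp_mul_Lq μ hpc.symm (ham.pow_const (γ - 1)).aemeasurable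
    ((hbm.const_mul (ENNReal.ofReal γ)).add ham).aemeasurable
  have e4 : ∀ y, (a y ^ (γ - 1)) ^ p' = a y ^ q := by
    intro y
    rw [← ENNReal.rpow_mul, hγ1, div_mul_cancel₀ _ hp'0.ne']
  simp only [Pi.mul_apply, Pi.add_apply, e4] at s2
  have s3 : A ^ (1 / m) ≤ ENNReal.ofReal C * (A ^ (1 / p') * B) := by
    calc A ^ (1 / m) ≤ ((ENNReal.ofReal C * (A ^ (1 / p') * B)) ^ m) ^ (1 / m) := by
          refine ENNReal.rpow_le_rpow (s1.trans (ENNReal.rpow_le_rpow ?_ hm0.le)) (by positivity)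
          gcongr
      _ = _ := by rw [← ENNReal.rpow_mul, mul_one_div_cancel hm0.ne', ENNReal.rpow_one]
  have s4 : A ^ (1 / q) ≤ ENNReal.ofReal C * B := by
    rcases eq_or_ne A 0 with hA0 | hA0
    · rw [hA0, ENNReal.zero_rpow_of_pos (by positivity)]; exact zero_le
    -- Absorption: `1/m - 1/p' = 1/p - 1/n = 1/q`, and `A ^ (1 / p')` may be cancelled because `A`
    -- is finite and nonzero.
    · have e5 : A ^ (1 / m) = A ^ (1 / p') * A ^ (1 / q) := by
        rw [← ENNReal.rpow_add _ _ hA0 hAt]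
        congr 1
        rw [hminv, hpinv, hq]; ring
      rw [e5, mul_left_comm] at s3
      have hne : A ^ (1 / p') ≠ 0 := (ENNReal.rpow_pos (pos_iff_ne_zero.2 hA0) hAt).ne'
      have hnt : A ^ (1 / p') ≠ (⊤ : ℝ≥0∞) := ENNReal.rpow_ne_top_of_nonneg (by positivity) hAt
      exact (ENNReal.mul_le_mul_iff_right hne hnt).1 s3
  have s5 : B ≤ ENNReal.ofReal γ * (nablaLp n p u i + nablaLp n p u (i + 1)) := by
    refine (ENNReal.lintegral_Lp_add_le (hbm.const_mul (ENNReal.ofReal γ)).aemeasurable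
      ham.aemeasurable hp.le).trans ?_
    simp only [ENNReal.mul_rpow_of_nonneg _ _ hp0.le]
    rw [lintegral_const_mul' _ _ (ENNReal.rpow_ne_top_of_nonneg hp0.le ENNReal.ofReal_ne_top),
      ENNReal.mul_rpow_of_nonneg _ _ (by positivity), ← ENNReal.rpow_mul,
      mul_one_div_cancel hp0.ne', ENNReal.rpow_one, ← nablaLp_eq, ← nablaLp_eq, mul_add, add_comm]
    gcongr
    calc nablaLp n p u i = 1 * nablaLp n p u i := (one_mul _).symm
      _ ≤ _ := by gcongr; rw [ENNReal.one_le_ofReal]; exact hγ1'.le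
  rw [nablaLp_eq, ENNReal.ofReal_mul hC, mul_assoc]
  exact s4.trans (by gcongr)

/-- The Sobolev inequality for Sobolev norms, in one step. -/
lemma exists_sobolevNorm_le_succ (hX : IsTamelyCovered n X) {p q : ℝ} (hp : 1 < p) (hpn : p < n)
    (hq : 1 / q = 1 / p - 1 / n) (l : ℕ) : ∃ C : ℝ, 0 ≤ C ∧ ∀ u ∈ TestFun n X,
      sobolevNorm n l q u ≤ ENNReal.ofReal C * sobolevNorm n (l + 1) p u := by
  obtain ⟨C, hC, h⟩ := exists_nablaLp_le hX hp hpn hq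
  have hp0 : 0 < p := by linarith
  have hn0 : (0 : ℝ) < n := by linarith
  have hq1 : 1 ≤ q := by
    have h0 : 0 < 1 / q := by rw [hq, sub_pos]; exact one_div_lt_one_div_of_lt hp0 hpn
    have h1 : 1 / q ≤ 1 := by
      rw [hq]
      have : 1 / p ≤ 1 := by rw [div_le_one hp0]; exact hp.le
      have : 0 ≤ 1 / (n : ℝ) := by positivity
      linarith
    have hq0 := one_div_pos.1 h0
    rwa [div_le_one hq0] at h1
  refine ⟨(l + 1) * (C * 2), by positivity, fun u hu => ?_⟩
  calc sobolevNorm n l q u ≤ ∑ i ∈ Finset.range (l + 1), nablaLp n q u i :=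
        sobolevNorm_le_sum hq1 hu.1 l
    _ ≤ ∑ i ∈ Finset.range (l + 1), ENNReal.ofReal (C * 2) * sobolevNorm n (l + 1) p u := by
        refine Finset.sum_le_sum fun i hi => (h u hu i).trans ?_
        have hi' := Finset.mem_range.1 hi
        rw [ENNReal.ofReal_mul hC, mul_assoc]
        gcongr
        rw [show ENNReal.ofReal 2 = 2 by simp, two_mul]
        exact add_le_add (nablaLp_le_sobolevNorm hp0 hu.1 (by omega))
          (nablaLp_le_sobolevNorm hp0 hu.1 (by omega))
    _ = _ := by
        rw [Finset.sum_const, Finset.card_range, nsmul_eq_mul,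
          ENNReal.ofReal_mul (p := (l : ℝ) + 1) (by positivity),
          mul_assoc]
        congr 1
        rw [show ((l : ℝ) + 1) = ((l + 1 : ℕ) : ℝ) by push_cast; ring, ENNReal.ofReal_natCast]

/-- One derivative is traded at a time. The intermediate exponent `r` satisfies `1/r = 1/q + 1/n >
1/n`, so it stays below `n` and the one-step inequality applies. -/
lemma exists_sobolevNorm_le_add (hX : IsTamelyCovered n X) {p : ℝ} (hp : 1 < p) (hpn : p < n)
    (s : ℕ) : ∀ (q : ℝ), 1 / q = 1 / p - s / n → 0 < 1 / q → ∀ l : ℕ, ∃ C : ℝ, 0 ≤ C ∧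
      ∀ u ∈ TestFun n X, sobolevNorm n l q u ≤ ENNReal.ofReal C * sobolevNorm n (l + s) p u := by
  have hp0 : 0 < p := by linarith
  have hn0 : (0 : ℝ) < n := by linarith
  induction s with
  | zero =>
    intro q hq _ l
    have : q = p := by
      have h1 : 1 / q = 1 / p := by simpa using hq
      exact inv_injective (by simpa only [one_div] using h1)
    subst this
    exact ⟨1, zero_le_one, fun u _ => by simp⟩
  | succ s ih =>
    intro q hq hq0 l
    set r : ℝ := (1 / p - s / n)⁻¹ with hr
    have hrinv : 1 / r = 1 / p - s / n := by rw [hr, one_div, inv_inv]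
    have hqr : 1 / q = 1 / r - 1 / n := by
      rw [hq, hrinv]; push_cast; ring
    have hr1 : 1 / (n : ℝ) < 1 / r := by linarith
    have hr0 : 0 < 1 / r := lt_trans (by positivity) hr1
    have hrp : 0 < r := one_div_pos.1 hr0
    have hrn : r < n := (one_div_lt_one_div hn0 hrp).1 hr1
    have hr2 : 1 < r := by
      have h1 : 1 / r ≤ 1 / p := by
        rw [hrinv]
        have : 0 ≤ (s : ℝ) / n := by positivity
        linarith
      exact hp.trans_le ((one_div_le_one_div hrp hp0).1 h1)
    obtain ⟨C, hC, h⟩ := exists_sobolevNorm_le_succ hX hr2 hrn hqr l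
    obtain ⟨C', hC', h'⟩ := ih r hrinv hr0 (l + 1)
    refine ⟨C * C', by positivity, fun u hu => (h u hu).trans ?_⟩
    rw [ENNReal.ofReal_mul hC, mul_assoc]
    gcongr
    have := h' u hu
    rwa [show l + 1 + s = l + (s + 1) by ring] at this

/-- Hölder's inequality on a space of finite volume `V`. The constant is independent of both
exponents because `1/q - 1/r` lies in `[0, 1]`, whence `V ^ (1/q - 1/r) ≤ 1 + V`. -/
lemma sobolevNorm_le_of_exponent_le (hvol : riemannianVolume n X univ < (⊤ : ℝ≥0∞)) (l : ℕ) :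
    ∃ C : ℝ, 0 ≤ C ∧ ∀ q r : ℝ, 1 ≤ q → q ≤ r → ∀ u ∈ TestFun n X,
      sobolevNorm n l q u ≤ ENNReal.ofReal C * sobolevNorm n l r u := by
  set V := (riemannianVolume n X univ).toReal with hV
  have hVr : riemannianVolume n X univ = ENNReal.ofReal V := (ENNReal.ofReal_toReal hvol.ne).symm
  have hV0 : 0 ≤ V := ENNReal.toReal_nonneg
  refine ⟨(l + 1) * (1 + V), by positivity, fun q r hq hqr u hu => ?_⟩
  have hq0 : 0 < q := by linarith
  have hr0 : 0 < r := by linarith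
  have h1 : ∀ i, nablaLp n q u i ≤ nablaLp n r u i * ENNReal.ofReal (1 + V) := by
    intro i
    refine (eLpNorm'_le_eLpNorm'_mul_rpow_measure_univ hq0 hqr
      (continuous_nablaNorm hu.1 i).measurable.aestronglyMeasurable).trans ?_
    gcongr
    · exact le_rfl
    · have he0 : 0 ≤ 1 / q - 1 / r := sub_nonneg.2 (one_div_le_one_div_of_le hq0 hqr)
      have he1 : 1 / q - 1 / r ≤ 1 := by
        have h2 : 1 / q ≤ 1 := by rw [div_le_one hq0]; exact hq
        have h3 : 0 ≤ 1 / r := by positivity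
        linarith
      rw [hVr]
      calc ENNReal.ofReal V ^ (1 / q - 1 / r) ≤ ENNReal.ofReal (1 + V) ^ (1 / q - 1 / r) :=
            ENNReal.rpow_le_rpow (ENNReal.ofReal_le_ofReal (by linarith)) he0
        _ ≤ ENNReal.ofReal (1 + V) ^ (1 : ℝ) := ENNReal.rpow_le_rpow_of_exponent_le
            (by rw [ENNReal.one_le_ofReal]; linarith) he1
        _ = _ := ENNReal.rpow_one _
  calc sobolevNorm n l q u ≤ ∑ i ∈ Finset.range (l + 1), nablaLp n q u i :=
        sobolevNorm_le_sum hq hu.1 l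
    _ ≤ ∑ i ∈ Finset.range (l + 1), ENNReal.ofReal (1 + V) * sobolevNorm n l r u := by
        refine Finset.sum_le_sum fun i hi => (h1 i).trans ?_
        have hi' := Finset.mem_range.1 hi
        rw [mul_comm]
        gcongr
        exact nablaLp_le_sobolevNorm hr0 hu.1 (by omega)
    _ = _ := by
        rw [Finset.sum_const, Finset.card_range, nsmul_eq_mul,
          ENNReal.ofReal_mul (p := (l : ℝ) + 1) (by positivity),
          mul_assoc]
        congr 1
        rw [show ((l : ℝ) + 1) = ((l + 1 : ℕ) : ℝ) by push_cast; ring, ENNReal.ofReal_natCast]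

/-- The Sobolev inequality for Sobolev norms. -/
theorem exists_sobolevNorm_le (hX : IsTamelyCovered n X) {p : ℝ} (hp : 1 < p) (hpn : p < n)
    (k : ℕ) : ∃ C : ℝ, 0 < C ∧ ∀ (l : ℕ) (ql : ℝ), l < k →
      1 / ql = 1 / p - ((k : ℝ) - l) / n → 0 < 1 / ql → ∀ q : ℝ, 1 ≤ q → q ≤ ql →
        ∀ u ∈ TestFun n X, sobolevNorm n l q u ≤ ENNReal.ofReal C * sobolevNorm n k p u := by
  have hvol := riemannianVolume_univ_lt_top hX
  have h1 : ∀ l : ℕ, ∃ C : ℝ, 0 ≤ C ∧ (l < k → ∀ ql : ℝ,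
      1 / ql = 1 / p - ((k : ℝ) - l) / n → 0 < 1 / ql → ∀ q : ℝ, 1 ≤ q → q ≤ ql →
        ∀ u ∈ TestFun n X, sobolevNorm n l q u ≤ ENNReal.ofReal C * sobolevNorm n k p u) := by
    intro l
    by_cases hc : l < k ∧ 0 < 1 / p - ((k : ℝ) - l) / n
    · obtain ⟨hlk, hpos⟩ := hc
      obtain ⟨C', hC', h'⟩ := sobolevNorm_le_of_exponent_le hvol l
      have hcast : ((k - l : ℕ) : ℝ) = (k : ℝ) - l := Nat.cast_sub hlk.le
      set r : ℝ := (1 / p - ((k : ℝ) - l) / n)⁻¹ with hr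
      have hrinv : 1 / r = 1 / p - ((k : ℝ) - l) / n := by rw [hr, one_div, inv_inv]
      obtain ⟨C, hC, h⟩ := exists_sobolevNorm_le_add hX hp hpn (k - l) r
        (by rw [hcast, hrinv]) (by rw [hrinv]; exact hpos) l
      rw [Nat.add_sub_cancel' hlk.le] at h
      refine ⟨C' * C, by positivity, fun _ ql hql _ q hq hqq u hu => ?_⟩
      have : ql = r :=
        inv_injective (by simpa only [one_div] using hql.trans hrinv.symm)
      subst this
      refine (h' q _ hq hqq u hu).trans ?_
      rw [ENNReal.ofReal_mul hC', mul_assoc]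
      gcongr
      exact h u hu
    · refine ⟨0, le_rfl, fun hlk ql hql hql0 => ?_⟩
      exact absurd ⟨hlk, hql ▸ hql0⟩ hc
  choose C hC h using h1
  -- One constant serves every `l < k`; the summand `1` only ensures positivity.
  refine ⟨1 + ∑ l ∈ Finset.range k, C l,
    add_pos_of_pos_of_nonneg one_pos (Finset.sum_nonneg fun l _ => hC l), ?_⟩
  intro l ql hlk hql hql0 q hq hqq u hu
  refine (h l hlk ql hql hql0 q hq hqq u hu).trans ?_
  gcongr
  have := Finset.single_le_sum (f := C) (fun l _ => hC l) (Finset.mem_range.2 hlk)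
  linarith

end SobolevInequality

/-! ### `L¹`-Cauchy sequences with vanishing weak limit -/

section WeakLimits

attribute [-instance] Bundle.instInnerProductSpaceReal
  Bundle.instNormedAddCommGroupOfRiemannianBundleOfIsTopologicalAddGroupOfContinuousConstSMulReal

variable {α : Type*} [MeasurableSpace α] {μ : Measure α}

lemma tendsto_integral_mul_of_bounded {g : ℕ → α → ℝ}
    (hg : Tendsto (fun m => ∫⁻ z, ‖g m z‖ₑ ∂μ) atTop (𝓝 0)) {b : α → ℝ} {K : ℝ}
    (hb : ∀ᵐ z ∂μ, |b z| ≤ K) :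
    Tendsto (fun m => ∫ z, b z * g m z ∂μ) atTop (𝓝 0) := by
  have h1 : Tendsto (fun m => ENNReal.ofReal K * ∫⁻ z, ‖g m z‖ₑ ∂μ) atTop (𝓝 0) := by
    simpa using ENNReal.Tendsto.const_mul hg (Or.inr ENNReal.ofReal_ne_top)
  have h2 : ∀ m, ‖∫ z, b z * g m z ∂μ‖ₑ ≤ ENNReal.ofReal K * ∫⁻ z, ‖g m z‖ₑ ∂μ := by
    intro m
    refine (enorm_integral_le_lintegral_enorm _).trans ?_
    rw [← lintegral_const_mul' _ _ ENNReal.ofReal_ne_top]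
    refine lintegral_mono_ae ?_
    filter_upwards [hb] with z hz
    rw [enorm_mul]
    gcongr
    rw [← ofReal_norm]
    exact ENNReal.ofReal_le_ofReal hz
  have h3 : Tendsto (fun m => ‖∫ z, b z * g m z ∂μ‖ₑ) atTop (𝓝 0) :=
    tendsto_of_tendsto_of_tendsto_of_le_of_le tendsto_const_nhds h1 (fun _ => zero_le) h2
  rw [tendsto_zero_iff_norm_tendsto_zero]
  have h4 := (ENNReal.tendsto_toReal ENNReal.zero_ne_top).comp h3
  simpa [Function.comp_def] using h4

variable {E : Type*} [NormedAddCommGroup E] [NormedSpace ℝ E] [FiniteDimensional ℝ E]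
  [MeasurableSpace E] [BorelSpace E] {μ : Measure E}

/-- An `L¹`-Cauchy sequence which converges weakly to zero converges to zero in `L¹`. -/
lemma tendsto_lintegral_of_cauchy {Q : Set E} (hQ : IsOpen Q) {g : ℕ → E → ℝ}
    (hg : ∀ m, IntegrableOn (g m) Q μ)
    (hcau : Tendsto (fun m : ℕ × ℕ => ∫⁻ z in Q, ‖g m.1 z - g m.2 z‖ₑ ∂μ) atTop (𝓝 0))
    (hζ : ∀ ζ : E → ℝ, ContDiff ℝ ∞ ζ → HasCompactSupport ζ → tsupport ζ ⊆ Q →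
      Tendsto (fun m => ∫ z in Q, ζ z * g m z ∂μ) atTop (𝓝 0)) :
    Tendsto (fun m => ∫⁻ z in Q, ‖g m z‖ₑ ∂μ) atTop (𝓝 0) := by
  set ν := μ.restrict Q with hν
  have hg' : ∀ m, Integrable (g m) ν := hg
  have hC : CauchySeq (fun m => (hg' m).toL1 (g m)) := by
    rw [cauchySeq_iff_tendsto_dist_atTop_0]
    have h1 := (ENNReal.tendsto_toReal ENNReal.zero_ne_top).comp hcau
    refine h1.congr fun m => ?_
    rw [dist_edist, Integrable.edist_toL1_toL1]
    simp only [Function.comp_apply, edist_eq_enorm_sub]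
  -- Completeness of `L¹` supplies a limit `G`; testing against smooth `ζ` shows that all integrals
  -- of `ζ G` vanish, so `G = 0` almost everywhere on `Q`.
  obtain ⟨G, hG⟩ := cauchySeq_tendsto_of_complete hC
  have hGi : Integrable G ν := L1.integrable_coeFn G
  have hG2 : Tendsto (fun m => ∫⁻ z, ‖g m z - G z‖ₑ ∂ν) atTop (𝓝 0) := by
    rw [tendsto_iff_edist_tendsto_0] at hG
    refine hG.congr fun m => ?_
    rw [← Integrable.toL1_coeFn G hGi, Integrable.edist_toL1_toL1]
    refine lintegral_congr_ae ?_
    filter_upwards [hGi.coeFn_toL1] with z hz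
    rw [edist_eq_enorm_sub, hz]
  have hzero : ∀ᵐ z ∂μ, z ∈ Q → G z = 0 := by
    refine hQ.ae_eq_zero_of_integral_contDiff_smul_eq_zero
      (IntegrableOn.locallyIntegrableOn hGi) fun ζ h1 h2 h3 => ?_
    obtain ⟨K, hK⟩ := h1.continuous.bounded_above_of_compact_support h2
    have hζm : AEStronglyMeasurable ζ ν := h1.continuous.aestronglyMeasurable
    have h4 := tendsto_integral_mul_of_bounded hG2 (b := ζ) (K := K) (ae_of_all _ hK)
    have h5 : ∀ m, ∫ z, ζ z * (g m z - G z) ∂ν = ∫ z, ζ z * g m z ∂ν - ∫ z, ζ z * G z ∂ν := by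
      intro m
      rw [← integral_sub ((hg' m).bdd_mul hζm (ae_of_all _ hK)) (hGi.bdd_mul hζm (ae_of_all _ hK))]
      simp only [mul_sub]
    simp only [h5] at h4
    have h6 := (hζ ζ h1 h2 h3).sub h4
    simp only [sub_sub_cancel, sub_zero] at h6
    have h7 := tendsto_nhds_unique h6 tendsto_const_nhds
    have h8 : ∫ x, ζ x • G x ∂μ = ∫ x in Q, ζ x • G x ∂μ := by
      rw [setIntegral_eq_integral_of_forall_compl_eq_zero]
      intro x hx
      rw [image_eq_zero_of_notMem_tsupport fun h => hx (h3 h), zero_smul]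
    rw [h8]
    simpa using h7.symm
  have hzero' : ∀ᵐ z ∂ν, G z = 0 := (ae_restrict_iff' hQ.measurableSet).2 hzero
  refine hG2.congr fun m => lintegral_congr_ae ?_
  filter_upwards [hzero'] with z hz
  rw [hz, sub_zero]

lemma continuous_mul_of_tsupport_subset {E : Type*} [TopologicalSpace E] {ζ b : E → ℝ} {U : Set E}
    (hUo : IsOpen U) (hζ : Continuous ζ) (hU : tsupport ζ ⊆ U) (hb : ContinuousOn b U) :
    Continuous (fun z => ζ z * b z) := by
  refine continuous_iff_continuousAt.2 fun z => ?_
  by_cases hz : z ∈ tsupport ζ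
  · exact hζ.continuousAt.mul (hb.continuousAt (hUo.mem_nhds (hU hz)))
  · have : (fun z => ζ z * b z) =ᶠ[𝓝 z] fun _ => 0 := by
      filter_upwards [notMem_tsupport_iff_eventuallyEq.1 hz] with x hx
      rw [hx]; simp
    exact this.continuousAt

end WeakLimits

/-! ### Covariant derivatives as weak derivatives in a tame cube -/

section Closability

variable {n : ℕ} {X : Type*} [TopologicalSpace X] [ChartedSpace (EuclideanSpace ℝ (Fin n)) X]
  [IsManifold (𝓡 n) ∞ X] [RiemannianBundle (fun y : X => TangentSpace (𝓡 n) y)]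
  [IsContMDiffRiemannianBundle (𝓡 n) ∞ (EuclideanSpace ℝ (Fin n))
    (fun y : X => TangentSpace (𝓡 n) y)] [MeasurableSpace X] [BorelSpace X]
  [SecondCountableTopology X]

lemma nablaRepr_sub {u v : X → ℝ} {e : OpenPartialHomeomorph X (Eu n)} (he : IsSmoothChart e)
    (hu : ContMDiff (𝓡 n) 𝓘(ℝ, ℝ) ∞ u) (hv : ContMDiff (𝓡 n) 𝓘(ℝ, ℝ) ∞ v)
    (i : ℕ) {z : Eu n} (hz : z ∈ e.target) :
    nablaRepr e (u - v) i z = nablaRepr e u i z - nablaRepr e v i z := by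
  have hs : ContMDiff (𝓡 n) 𝓘(ℝ, ℝ) ∞ (u - v) := hu.sub hv
  have h := nablaRepr_add he hs hv i z hz
  have h2 : (u - v) + v = u := sub_add_cancel u v
  rw [h2] at h
  rw [h, add_sub_cancel_right]

lemma contDiffAt_nablaRepr_apply {u : X → ℝ} {e : OpenPartialHomeomorph X (Eu n)}
    (he : IsSmoothChart e) (hu : ContMDiff (𝓡 n) 𝓘(ℝ, ℝ) ∞ u) (i : ℕ) (w : Fin i → Eu n) {z : Eu n}
    (hz : z ∈ e.target) : ContDiffAt ℝ ∞ (fun z => nablaRepr e u i z w) z :=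
  contDiffAt_tensor_apply (contDiffAt_nablaRepr he hz hu.contMDiffAt i) fun _ => contDiffAt_const

variable {e : OpenPartialHomeomorph X (Eu n)} {a : Fin n → ℝ} {δ lam : ℝ}
  (he : IsTameCube e a δ lam)
include he

/-- Components of covariant derivatives in a tame cube are controlled by the norm. -/
lemma IsTameCube.lintegral_nablaRepr_le {u : X → ℝ} (hu : ContMDiff (𝓡 n) 𝓘(ℝ, ℝ) ∞ u) (i : ℕ)
    (w : Fin i → Eu n) :
    ∫⁻ z in cube a δ, ‖nablaRepr e u i z w‖ₑ ≤
      ENNReal.ofReal ((∏ j, (lam * ‖w j‖)) * lam ^ n) *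
        ∫⁻ y, ENNReal.ofReal (nablaNorm n u i y) ∂(riemannianVolume n X) := by
  have hl0 : 0 < lam := lt_of_lt_of_le one_pos he.one_le
  have hP : 0 ≤ ∏ j, (lam * ‖w j‖) := Finset.prod_nonneg fun _ _ => by positivity
  have hm : Measurable fun y => ENNReal.ofReal (nablaNorm n u i y) :=
    (measurable_nablaNorm hu i).ennreal_ofReal
  have h1 : ∫⁻ z in cube a δ, ‖nablaRepr e u i z w‖ₑ ≤ ENNReal.ofReal (∏ j, (lam * ‖w j‖)) *
      ∫⁻ z in cube a δ, ENNReal.ofReal (nablaNorm n u i (e.symm z)) := by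
    rw [← lintegral_const_mul' _ _ ENNReal.ofReal_ne_top]
    refine setLIntegral_mono' (isOpen_cube a δ).measurableSet fun z hz => ?_
    rw [← ENNReal.ofReal_mul hP, ← ofReal_norm]
    refine ENNReal.ofReal_le_ofReal
      ((abs_nablaRepr_le he.isSmoothChart hu (he.subset_target hz) i w).trans ?_)
    refine mul_le_mul_of_nonneg_right ?_ (nablaNorm_nonneg _ _)
    exact Finset.prod_le_prod (fun _ _ => norm_nonneg _) fun j _ => he.norm_frame_le z hz _
  refine h1.trans ?_
  rw [ENNReal.ofReal_mul hP, mul_assoc]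
  gcongr
  refine (le_lintegral_symm_image he.isSmoothChart (isOpen_cube a δ).measurableSet he.subset_target
    hm hl0 he.le_norm_frame).trans ?_
  gcongr
  exact Measure.restrict_le_self

lemma IsTameCube.lintegral_nablaNorm_le {u : X → ℝ} (hu : ContMDiff (𝓡 n) 𝓘(ℝ, ℝ) ∞ u) (i : ℕ) :
    ∫⁻ y in e.symm '' cube a δ, ENNReal.ofReal (nablaNorm n u i y) ∂(riemannianVolume n X) ≤
      ENNReal.ofReal (lam ^ n * (n ^ i * lam ^ i)) * ∑ J : Fin i → Fin n, ∫⁻ z in cube a δ,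
        ‖nablaRepr e u i z (fun s => EuclideanSpace.single (J s) (1 : ℝ))‖ₑ := by
  have hl0 : 0 < lam := lt_of_lt_of_le one_pos he.one_le
  have hm : Measurable fun y => ENNReal.ofReal (nablaNorm n u i y) :=
    (measurable_nablaNorm hu i).ennreal_ofReal
  have hQ := (isOpen_cube a δ).measurableSet
  refine (lintegral_symm_image_le he.isSmoothChart hQ he.subset_target
    hm he.norm_frame_le).trans ?_
  rw [ENNReal.ofReal_mul (by positivity), mul_assoc, ← lintegral_finsetSum',
    ← lintegral_const_mul' (ENNReal.ofReal (n ^ i * lam ^ i)) _ ENNReal.ofReal_ne_top]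
  · gcongr ENNReal.ofReal (lam ^ n) * ?_
    refine setLIntegral_mono' hQ fun z hz => ?_
    refine (ENNReal.ofReal_le_ofReal (nablaNorm_le he.isSmoothChart hu (he.subset_target hz) i
      (he.le_norm_frame z hz))).trans (le_of_eq ?_)
    rw [ENNReal.ofReal_mul (by positivity), ENNReal.ofReal_sum_of_nonneg fun _ _ => abs_nonneg _]
    simp only [← ofReal_norm, Real.norm_eq_abs]
  · intro J _
    refine ContinuousOn.aemeasurable (fun z hz => ?_) hQ
    exact (contDiffAt_nablaRepr_apply he.isSmoothChart hu i _
      (he.subset_target hz)).continuousAt.enorm.continuousWithinAt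

lemma IsTameCube.integrableOn_nablaRepr (hvol : riemannianVolume n X univ < (⊤ : ℝ≥0∞))
    {u : X → ℝ} (hu : u ∈ TestFun n X) (i : ℕ)
    (w : Fin i → Eu n) : IntegrableOn (fun z => nablaRepr e u i z w) (cube a δ) := by
  refine ⟨ContinuousOn.aestronglyMeasurable (fun z hz => ?_) (isOpen_cube a δ).measurableSet, ?_⟩
  · exact (contDiffAt_nablaRepr_apply he.isSmoothChart hu.1 i _
      (he.subset_target hz)).continuousAt.continuousWithinAt
  · refine (he.lintegral_nablaRepr_le hu.1 i w).trans_lt (ENNReal.mul_lt_top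
      ENNReal.ofReal_lt_top ?_)
    simpa using lintegral_nablaNorm_rpow_lt_top hvol hu.1 hu.2 zero_le_one i

/-- In a tame cube, covariant derivatives of a sequence are weak derivatives. -/
lemma IsTameCube.tendsto_lintegral_nablaRepr (hvol : riemannianVolume n X univ < (⊤ : ℝ≥0∞))
    {u : ℕ → X → ℝ} (hu : ∀ m, u m ∈ TestFun n X) {k : ℕ}
    (hcau : ∀ i ≤ k, Tendsto (fun m : ℕ × ℕ => ∫⁻ y,
      ENNReal.ofReal (nablaNorm n (u m.1 - u m.2) i y) ∂(riemannianVolume n X)) atTop (𝓝 0))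
    (h0 : Tendsto (fun m => ∫⁻ y,
      ENNReal.ofReal (nablaNorm n (u m) 0 y) ∂(riemannianVolume n X)) atTop (𝓝 0))
    (i : ℕ) (hi : i ≤ k) (w : Fin i → Eu n) :
    Tendsto (fun m => ∫⁻ z in cube a δ, ‖nablaRepr e (u m) i z w‖ₑ) atTop (𝓝 0) := by
  induction i with
  | zero =>
    have h1 := ENNReal.Tendsto.const_mul h0 (a := ENNReal.ofReal ((∏ j, (lam * ‖w j‖)) * lam ^ n))
      (Or.inr ENNReal.ofReal_ne_top)
    rw [mul_zero] at h1
    exact tendsto_of_tendsto_of_tendsto_of_le_of_le tendsto_const_nhds h1 (fun _ => zero_le)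
      fun m => he.lintegral_nablaRepr_le (hu m).1 0 w
  | succ i ih =>
    have ih := ih (by omega)
    refine tendsto_lintegral_of_cauchy (isOpen_cube a δ)
      (fun m => he.integrableOn_nablaRepr hvol (hu m) (i + 1) w) ?_ ?_
    · have h1 := ENNReal.Tendsto.const_mul (hcau (i + 1) hi)
        (a := ENNReal.ofReal ((∏ j, (lam * ‖w j‖)) * lam ^ n)) (Or.inr ENNReal.ofReal_ne_top)
      rw [mul_zero] at h1
      refine tendsto_of_tendsto_of_tendsto_of_le_of_le tendsto_const_nhds h1 (fun _ => zero_le)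
        fun m => ?_
      refine le_trans (le_of_eq ?_)
        (he.lintegral_nablaRepr_le ((hu m.1).1.sub (hu m.2).1) (i + 1) w)
      refine setLIntegral_congr_fun (isOpen_cube a δ).measurableSet fun z hz => ?_
      have := nablaRepr_sub he.isSmoothChart (hu m.1).1 (hu m.2).1 (i + 1) (he.subset_target hz)
      change _ = ‖nablaRepr e (u m.1 - u m.2) (i + 1) z w‖ₑ
      rw [this]
      rfl
    -- A component of order `i + 1` is a partial derivative of a component of order `i` minus
    -- contractions with the Christoffel symbols. After integration by parts only components of
    -- order `i` remain, multiplied by bounded functions, and the induction hypothesis applies.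
    · intro ζ hζ hζc hζQ
      set t : Fin i → Eu n := fun j => w j.succ
      have hch := he.isSmoothChart
      have hQm := (isOpen_cube a δ).measurableSet
      have hζe : tsupport ζ ⊆ e.target := hζQ.trans he.subset_target
      have hΓc : ∀ j (c : Fin n),
          ContinuousOn (fun z => (christoffel e z (w 0) (t j)) c) e.target := by
        intro j c z hz
        have hc := (contDiffAt_christoffel hch hz).continuousAt
        exact ((EuclideanSpace.proj c : Eu n →L[ℝ] ℝ).continuous.continuousAt.comp
          ((hc.clm_apply continuousAt_const).clm_apply continuousAt_const)).continuousWithinAt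
      have hTc : ∀ m, ContinuousOn (fun z => nablaRepr e (u m) i z t) e.target := fun m z hz =>
        (contDiffAt_nablaRepr_apply hch (hu m).1 i t hz).continuousAt.continuousWithinAt
      have hTd : ∀ m, ContinuousOn (fun z => fderiv ℝ (fun z => nablaRepr e (u m) i z t) z (w 0))
          e.target := fun m z hz =>
        (((contDiffAt_nablaRepr_apply hch (hu m).1 i t hz).fderiv_right (m := 0)
          (by simp)).continuousAt.clm_apply continuousAt_const).continuousWithinAt
      have hTΓ : ∀ m j, Integrable (fun z => ζ z * nablaRepr e (u m) i z
          (Function.update t j (christoffel e z (w 0) (t j)))) := by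
        intro m j
        refine (continuous_mul_of_tsupport_subset e.open_target hζ.continuous hζe
          (fun z hz => ?_)).integrable_of_hasCompactSupport hζc.mul_right
        have h1 := contDiffAt_tensor_apply (m := 0) (V := fun j' z =>
            Function.update t j (christoffel e z (w 0) (t j)) j')
          ((contDiffAt_nablaRepr hch hz (hu m).1.contMDiffAt i).of_le (by simp)) (fun j' => by
            by_cases hj : j' = j
            · subst hj
              simp only [Function.update_self]
              exact (((contDiffAt_christoffel hch hz).of_le (by simp)).clm_apply
                contDiffAt_const).clm_apply contDiffAt_const
            · simp only [Function.update_of_ne hj]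
              exact contDiffAt_const)
        exact h1.continuousAt.continuousWithinAt
      -- A tame cube bounds the metric but not its derivatives, so the Christoffel symbols may be
      -- unbounded on it; the compact support of `ζ` restores a bound.
      have hΓ : ∀ j (c : Fin n), ∃ K, ∀ z ∈ cube a δ,
          |ζ z * (christoffel e z (w 0) (t j)) c| ≤ K := by
        intro j c
        have hcont := continuous_mul_of_tsupport_subset e.open_target hζ.continuous hζe (hΓc j c)
        obtain ⟨K, hK⟩ := hcont.bounded_above_of_compact_support
          (hζc.mul_right (f' := fun z => (christoffel e z (w 0) (t j)) c))
        exact ⟨K, fun z _ => hK z⟩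
      have hT2 : ∀ j, Tendsto (fun m => ∫ z in cube a δ, ζ z * nablaRepr e (u m) i z
          (Function.update t j (christoffel e z (w 0) (t j)))) atTop (𝓝 0) := by
        intro j
        -- The inserted vector depends on `z`. Expanding it in the constant basis reduces to
        -- components along fixed vectors, as in the induction hypothesis.
        have h1 : ∀ m z, ζ z * nablaRepr e (u m) i z
            (Function.update t j (christoffel e z (w 0) (t j))) =
            ∑ c, (ζ z * (christoffel e z (w 0) (t j)) c) * nablaRepr e (u m) i z
              (Function.update t j (EuclideanSpace.single c (1 : ℝ))) := by
          intro m z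
          have h2 : christoffel e z (w 0) (t j) =
              ∑ c, (christoffel e z (w 0) (t j)) c • EuclideanSpace.single c (1 : ℝ) := by
            simpa using ((EuclideanSpace.basisFun (Fin n) ℝ).sum_repr
              (christoffel e z (w 0) (t j))).symm
          conv_lhs => rw [h2]
          have h3 : ∀ x, nablaRepr e (u m) i z (Function.update t j x) =
            (nablaRepr e (u m) i z).toContinuousLinearMap t j x := fun _ => rfl
          simp only [h3, map_sum, map_smul, smul_eq_mul, Finset.mul_sum]
          refine Finset.sum_congr rfl fun c _ => ?_
          ring
        simp only [h1]
        have h3 : ∀ m, ∫ z in cube a δ, ∑ c, (ζ z * (christoffel e z (w 0) (t j)) c) *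
            nablaRepr e (u m) i z (Function.update t j (EuclideanSpace.single c (1 : ℝ))) =
            ∑ c, ∫ z in cube a δ, (ζ z * (christoffel e z (w 0) (t j)) c) *
            nablaRepr e (u m) i z (Function.update t j (EuclideanSpace.single c (1 : ℝ))) := by
          intro m
          refine integral_finsetSum _ fun c _ => ?_
          obtain ⟨K, hK⟩ := hΓ j c
          refine (he.integrableOn_nablaRepr hvol (hu m) i _).bdd_mul (c := K) ?_ ?_
          · exact (continuous_mul_of_tsupport_subset e.open_target hζ.continuous hζe (hΓc j c)).aestronglyMeasurable
          · exact (ae_restrict_iff' hQm).2 (ae_of_all _ hK)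
        simp only [h3]
        rw [show (0 : ℝ) = ∑ _c : Fin n, (0 : ℝ) by simp]
        refine tendsto_finsetSum _ fun c _ => ?_
        obtain ⟨K, hK⟩ := hΓ j c
        exact tendsto_integral_mul_of_bounded (ih _) ((ae_restrict_iff' hQm).2 (ae_of_all _ hK))
      have hT1 : Tendsto (fun m => ∫ z in cube a δ, ζ z *
          fderiv ℝ (fun z => nablaRepr e (u m) i z t) z (w 0)) atTop (𝓝 0) := by
        have hζ'c : HasCompactSupport (fun z => fderiv ℝ ζ z (w 0)) := hζc.fderiv_apply ℝ (w 0)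
        have hζ' : Continuous (fun z => fderiv ℝ ζ z (w 0)) :=
          (hζ.continuous_fderiv (by simp)).clm_apply continuous_const
        have hζ'Q : tsupport (fun z => fderiv ℝ ζ z (w 0)) ⊆ tsupport ζ :=
          tsupport_fderiv_apply_subset ℝ (w 0)
        obtain ⟨K, hK⟩ := hζ'.bounded_above_of_compact_support hζ'c
        have h1 := (tendsto_integral_mul_of_bounded (ih t) (b := fun z => fderiv ℝ ζ z (w 0))
          (K := K) (ae_of_all _ hK)).neg
        rw [neg_zero] at h1
        refine h1.congr fun m => ?_
        rw [setIntegral_eq_integral_of_forall_compl_eq_zero,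
          setIntegral_eq_integral_of_forall_compl_eq_zero]
        · refine (integral_mul_fderiv_eq_neg_fderiv_mul_of_integrable ?_ ?_ ?_ ?_ ?_).symm
          · exact (continuous_mul_of_tsupport_subset e.open_target hζ' (hζ'Q.trans hζe)
              (hTc m)).integrable_of_hasCompactSupport hζ'c.mul_right
          · exact (continuous_mul_of_tsupport_subset e.open_target hζ.continuous hζe
              (hTd m)).integrable_of_hasCompactSupport hζc.mul_right
          · exact (continuous_mul_of_tsupport_subset e.open_target hζ.continuous hζe
              (hTc m)).integrable_of_hasCompactSupport hζc.mul_right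
          · exact fun x _ => hζ.contDiffAt.differentiableAt (by simp)
          · exact fun x hx => (contDiffAt_nablaRepr_apply hch (hu m).1 i t
              (hζe hx)).differentiableAt (by simp)
        · intro x hx
          rw [image_eq_zero_of_notMem_tsupport fun h => hx (hζQ h), zero_mul]
        · intro x hx
          rw [image_eq_zero_of_notMem_tsupport (f := fun z => fderiv ℝ ζ z (w 0))
            fun h => hx (hζQ (hζ'Q h)), zero_mul]
      have hT := hT1.sub (tendsto_finsetSum Finset.univ fun j _ => hT2 j)
      simp only [Finset.sum_const_zero, sub_zero] at hT
      refine hT.congr fun m => ?_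
      rw [← integral_finsetSum, ← integral_sub]
      · refine setIntegral_congr_fun hQm fun z hz => ?_
        have hd := (contDiffAt_nablaRepr hch (he.subset_target hz) (hu m).1.contMDiffAt
          i).differentiableAt (by simp)
        have h1 : fderiv ℝ (fun z => nablaRepr e (u m) i z t) z (w 0) =
            fderiv ℝ (nablaRepr e (u m) i) z (w 0) t := by
          have h2 := ((ContinuousMultilinearMap.apply ℝ (fun _ : Fin i => Eu n) ℝ
            t).hasFDerivAt.comp z hd.hasFDerivAt).fderiv
          have h3 : (⇑(ContinuousMultilinearMap.apply ℝ (fun _ : Fin i => Eu n) ℝ t) ∘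
            nablaRepr e (u m) i) = fun z => nablaRepr e (u m) i z t := rfl
          rw [h3] at h2
          rw [h2]
          rfl
        simp only [nablaRepr, covDeriv_apply, mul_sub, Finset.mul_sum]
        rw [h1]
      · exact ((continuous_mul_of_tsupport_subset e.open_target hζ.continuous hζe
          (hTd m)).integrable_of_hasCompactSupport hζc.mul_right).integrableOn
      · exact (integrable_finsetSum _ fun j _ => hTΓ m j).integrableOn
      · exact fun j _ => (hTΓ m j).integrableOn

end Closability

/-! ### Closability of Sobolev norms and the embedding of completions -/

section Embedding

variable {n : ℕ} {X : Type*} [TopologicalSpace X] [ChartedSpace (EuclideanSpace ℝ (Fin n)) X]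
  [IsManifold (𝓡 n) ∞ X] [RiemannianBundle (fun y : X => TangentSpace (𝓡 n) y)]
  [IsContMDiffRiemannianBundle (𝓡 n) ∞ (EuclideanSpace ℝ (Fin n))
    (fun y : X => TangentSpace (𝓡 n) y)] [MeasurableSpace X] [BorelSpace X]
  [SecondCountableTopology X]

/-- Covariant derivatives of a sequence are weak derivatives. -/
lemma tendsto_lintegral_nablaNorm (hX : IsTamelyCovered n X)
    {u : ℕ → X → ℝ} (hu : ∀ m, u m ∈ TestFun n X) {k : ℕ}
    (hcau : ∀ i ≤ k, Tendsto (fun m : ℕ × ℕ => ∫⁻ y,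
      ENNReal.ofReal (nablaNorm n (u m.1 - u m.2) i y) ∂(riemannianVolume n X)) atTop (𝓝 0))
    (h0 : Tendsto (fun m => ∫⁻ y,
      ENNReal.ofReal (nablaNorm n (u m) 0 y) ∂(riemannianVolume n X)) atTop (𝓝 0))
    {i : ℕ} (hi : i ≤ k) :
    Tendsto (fun m => ∫⁻ y, ENNReal.ofReal (nablaNorm n (u m) i y) ∂(riemannianVolume n X))
      atTop (𝓝 0) := by
  have hvol := riemannianVolume_univ_lt_top hX
  suffices H : Tendsto (fun m => ∫⁻ y in univ,
      ENNReal.ofReal (nablaNorm n (u m) i y) ∂(riemannianVolume n X)) atTop (𝓝 0) by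
    simpa only [Measure.restrict_univ] using H
  refine hX (fun W => Tendsto (fun m => ∫⁻ y in W,
      ENNReal.ofReal (nablaNorm n (u m) i y) ∂(riemannianVolume n X)) atTop (𝓝 0)) ?_ ?_ ?_ ?_
  · simp
  · intro s t hst ht
    exact tendsto_of_tendsto_of_tendsto_of_le_of_le tendsto_const_nhds ht (fun _ => zero_le)
      fun m => lintegral_mono_set hst
  · intro s t hs ht
    have h1 := hs.add ht
    rw [add_zero] at h1
    exact tendsto_of_tendsto_of_tendsto_of_le_of_le tendsto_const_nhds h1 (fun _ => zero_le)
      fun m => lintegral_union_le _ _ _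
  · intro e a δ lam he
    have h1 := tendsto_finsetSum Finset.univ fun (J : Fin i → Fin n) _ =>
      he.tendsto_lintegral_nablaRepr hvol hu hcau h0 i hi
        (fun s => EuclideanSpace.single (J s) (1 : ℝ))
    rw [Finset.sum_const_zero] at h1
    have h2 := ENNReal.Tendsto.const_mul h1 (a := ENNReal.ofReal (lam ^ n * (n ^ i * lam ^ i)))
      (Or.inr ENNReal.ofReal_ne_top)
    rw [mul_zero] at h2
    exact tendsto_of_tendsto_of_tendsto_of_le_of_le tendsto_const_nhds h2 (fun _ => zero_le)
      fun m => he.lintegral_nablaNorm_le (hu m).1 i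

lemma nablaNorm_sub_le {u v : X → ℝ} (hu : ContMDiff (𝓡 n) 𝓘(ℝ, ℝ) ∞ u)
    (hv : ContMDiff (𝓡 n) 𝓘(ℝ, ℝ) ∞ v) (i : ℕ) (y : X) :
    |nablaNorm n (u - v) i y - nablaNorm n u i y| ≤ nablaNorm n v i y := by
  have hs : ContMDiff (𝓡 n) 𝓘(ℝ, ℝ) ∞ (u - v) := hu.sub hv
  have h1 := nablaNorm_add_le hs hv i y
  rw [sub_add_cancel] at h1
  have hnv : ContMDiff (𝓡 n) 𝓘(ℝ, ℝ) ∞ ((-1 : ℝ) • v) := contMDiff_const.mul hv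
  have h2 := nablaNorm_add_le hnv hu i y
  have h3 : (-1 : ℝ) • v + u = u - v := by ext y; simp; ring
  rw [h3, nablaNorm_smul _ hv] at h2
  rw [abs_le]
  constructor
  · linarith
  · simp at h2; linarith

/-- Closability of the iterated covariant derivatives in `L^p`. -/
lemma tendsto_nablaLp {p : ℝ} (hp : 1 ≤ p)
    {u : ℕ → X → ℝ} (hu : ∀ m, u m ∈ TestFun n X) {i : ℕ}
    (hcau : Tendsto (fun m : ℕ × ℕ => nablaLp n p (u m.1 - u m.2) i) atTop (𝓝 0))
    (h1 : Tendsto (fun m => ∫⁻ y, ENNReal.ofReal (nablaNorm n (u m) i y) ∂(riemannianVolume n X))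
      atTop (𝓝 0)) :
    Tendsto (fun m => nablaLp n p (u m) i) atTop (𝓝 0) := by
  have hp0 : 0 < p := by linarith
  have hmeas : TendstoInMeasure (riemannianVolume n X) (fun m => nablaNorm n (u m) i) atTop
      (fun _ => (0 : ℝ)) := by
    refine tendstoInMeasure_of_tendsto_eLpNorm (p := 1) one_ne_zero
      (fun m => (measurable_nablaNorm (hu m).1 i).aestronglyMeasurable)
      aestronglyMeasurable_const ?_
    refine h1.congr fun m => ?_
    rw [eLpNorm_one_eq_lintegral_enorm]
    refine lintegral_congr fun y => ?_
    simp [Real.enorm_of_nonneg (nablaNorm_nonneg _ _)]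
  obtain ⟨ns, hns, hae⟩ := hmeas.exists_seq_tendsto_ae
  rw [ENNReal.tendsto_atTop_zero]
  intro ε hε
  rw [ENNReal.tendsto_nhds_zero] at hcau
  have h2 := hcau ε hε
  rw [Filter.eventually_atTop] at h2
  obtain ⟨⟨M, M'⟩, hM⟩ := h2
  refine ⟨M, fun m hm => ?_⟩
  -- Along a subsequence `|∇^i u|` tends to zero almost everywhere. Fatou's lemma then bounds the
  -- norm of `u m` by the norms of the differences `u m - u (ns s)`, which the Cauchy condition
  -- makes small.
  have h3 : ∀ᵐ y ∂(riemannianVolume n X), ENNReal.ofReal (nablaNorm n (u m) i y) ^ p ≤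
      liminf (fun s => ENNReal.ofReal (nablaNorm n (u m - u (ns s)) i y) ^ p) atTop := by
    filter_upwards [hae] with y hy
    have h4 : Tendsto (fun s => nablaNorm n (u m - u (ns s)) i y) atTop
        (𝓝 (nablaNorm n (u m) i y)) := by
      rw [tendsto_iff_norm_sub_tendsto_zero]
      exact squeeze_zero (fun _ => norm_nonneg _)
        (fun s => nablaNorm_sub_le (hu m).1 (hu (ns s)).1 i y) hy
    have h5 := (ENNReal.continuous_rpow_const (y := p)).continuousAt.tendsto.comp
      (ENNReal.tendsto_ofReal h4)
    exact h5.liminf_eq.symm.le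
  rw [nablaLp_eq]
  have h6 : ∫⁻ y, ENNReal.ofReal (nablaNorm n (u m) i y) ^ p ∂(riemannianVolume n X) ≤ ε ^ p := by
    refine (lintegral_mono_ae h3).trans ((lintegral_liminf_le fun s => ?_).trans ?_)
    · exact ((measurable_nablaNorm (u := u m - u (ns s)) ((hu m).1.sub (hu (ns s)).1)
        i).ennreal_ofReal.pow_const p)
    · refine liminf_le_of_frequently_le' (Eventually.frequently ?_)
      filter_upwards [hns.tendsto_atTop.eventually_ge_atTop M'] with s hs
      rw [← nablaLp_rpow hp0]
      exact ENNReal.rpow_le_rpow (hM (m, ns s) ⟨hm, hs⟩) hp0.le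
  refine (ENNReal.rpow_le_rpow h6 (by positivity)).trans (le_of_eq ?_)
  rw [← ENNReal.rpow_mul, mul_one_div_cancel hp0.ne', ENNReal.rpow_one]

/-- The Sobolev norms are closable with respect to each other. -/
theorem tendsto_sobolevNorm (hX : IsTamelyCovered n X) {p q : ℝ} (hp : 1 ≤ p) (hq : 1 ≤ q)
    {k l : ℕ} {u : ℕ → X → ℝ} (hu : ∀ m, u m ∈ TestFun n X)
    (hcau : Tendsto (fun m : ℕ × ℕ => sobolevNorm n k p (u m.1 - u m.2)) atTop (𝓝 0))
    (h0 : Tendsto (fun m => sobolevNorm n l q (u m)) atTop (𝓝 0)) :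
    Tendsto (fun m => sobolevNorm n k p (u m)) atTop (𝓝 0) := by
  have hvol := riemannianVolume_univ_lt_top hX
  have hp0 : 0 < p := by linarith
  have hq0 : 0 < q := by linarith
  obtain ⟨C, hC, h⟩ := sobolevNorm_le_of_exponent_le (n := n) (X := X) hvol k
  obtain ⟨C', hC', h'⟩ := sobolevNorm_le_of_exponent_le (n := n) (X := X) hvol l
  have hone : ∀ (v : X → ℝ) i, ∫⁻ y, ENNReal.ofReal (nablaNorm n v i y) ∂(riemannianVolume n X) =
      nablaLp n 1 v i := by
    intro v i; rw [nablaLp_eq]; simp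
  have hs : ∀ m : ℕ × ℕ, u m.1 - u m.2 ∈ TestFun n X := fun m =>
    Submodule.sub_mem _ (hu m.1) (hu m.2)
  have hcau1 : ∀ i ≤ k, Tendsto (fun m : ℕ × ℕ => ∫⁻ y,
      ENNReal.ofReal (nablaNorm n (u m.1 - u m.2) i y) ∂(riemannianVolume n X)) atTop (𝓝 0) := by
    intro i hi
    have h1 := ENNReal.Tendsto.const_mul hcau (a := ENNReal.ofReal C)
      (Or.inr ENNReal.ofReal_ne_top)
    rw [mul_zero] at h1
    refine tendsto_of_tendsto_of_tendsto_of_le_of_le tendsto_const_nhds h1 (fun _ => zero_le)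
      fun m => ?_
    simp only [hone]
    exact (nablaLp_le_sobolevNorm one_pos (hs m).1 hi).trans (h 1 p le_rfl hp _ (hs m))
  -- Of the convergence in `W^{l,q}` only the `L¹` convergence of the functions themselves is used.
  have h00 : Tendsto (fun m => ∫⁻ y,
      ENNReal.ofReal (nablaNorm n (u m) 0 y) ∂(riemannianVolume n X)) atTop (𝓝 0) := by
    have h1 := ENNReal.Tendsto.const_mul h0 (a := ENNReal.ofReal C')
      (Or.inr ENNReal.ofReal_ne_top)
    rw [mul_zero] at h1
    refine tendsto_of_tendsto_of_tendsto_of_le_of_le tendsto_const_nhds h1 (fun _ => zero_le)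
      fun m => ?_
    simp only [hone]
    exact (nablaLp_le_sobolevNorm one_pos (hu m).1 (Nat.zero_le l)).trans (h' 1 q le_rfl hq _ (hu m))
  have h2 : ∀ i ∈ Finset.range (k + 1), Tendsto (fun m => nablaLp n p (u m) i) atTop (𝓝 0) := by
    intro i hi
    have hi' : i ≤ k := by have := Finset.mem_range.1 hi; omega
    refine tendsto_nablaLp hp hu ?_ (tendsto_lintegral_nablaNorm hX hu hcau1 h00 hi')
    exact tendsto_of_tendsto_of_tendsto_of_le_of_le tendsto_const_nhds hcau (fun _ => zero_le)
      fun m => nablaLp_le_sobolevNorm hp0 (hs m).1 hi'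
  have h3 := tendsto_finsetSum _ h2
  rw [Finset.sum_const_zero] at h3
  exact tendsto_of_tendsto_of_tendsto_of_le_of_le tendsto_const_nhds h3 (fun _ => zero_le)
    fun m => sobolevNorm_le_sum hp (hu m).1 k

/-- The canonical map into the Sobolev space as a linear map. -/
def toSobolevₗ (n : ℕ) (X : Type*) [TopologicalSpace X]
    [ChartedSpace (EuclideanSpace ℝ (Fin n)) X]
    [IsManifold (𝓡 n) ∞ X] [RiemannianBundle (fun y : X => TangentSpace (𝓡 n) y)]
    [MeasurableSpace X] [BorelSpace X] (k : ℕ) (p : ℝ) :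
    TestFun n X →ₗ[ℝ] SobolevSpace n X k p where
  toFun := toSobolev k p
  map_add' u v := UniformSpace.Completion.coe_add
    (α := WithSeminorm (sobolevSeminorm n X k p)) u v
  map_smul' c u := UniformSpace.Completion.coe_smul
    (X := WithSeminorm (sobolevSeminorm n X k p)) c u

lemma toSobolevₗ_apply (k : ℕ) (p : ℝ) (u : TestFun n X) :
    toSobolevₗ n X k p u = toSobolev k p u := rfl

lemma denseRange_toSobolev (k : ℕ) (p : ℝ) :
    DenseRange (toSobolev k p : TestFun n X → SobolevSpace n X k p) :=
  UniformSpace.Completion.denseRange_coe (α := WithSeminorm (sobolevSeminorm n X k p))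

/-- The continuous embedding of Sobolev spaces induced by an inequality of Sobolev norms. -/
theorem exists_embedding (hX : IsTamelyCovered n X) {p q : ℝ} (hp : 1 ≤ p) (hq : 1 ≤ q)
    {k l : ℕ} {C : ℝ} (hC : 0 ≤ C) (h : ∀ u ∈ TestFun n X,
      sobolevNorm n l q u ≤ ENNReal.ofReal C * sobolevNorm n k p u) :
    ∃ J : SobolevSpace n X k p →L[ℝ] SobolevSpace n X l q, Function.Injective J ∧
      ∀ u : TestFun n X, J (toSobolev k p u) = toSobolev l q u := by
  have hvol := riemannianVolume_univ_lt_top hX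
  have hnorm : ∀ u : TestFun n X, ‖toSobolevₗ n X l q u‖ ≤ C * ‖toSobolevₗ n X k p u‖ := by
    intro u
    rw [← ENNReal.ofReal_le_ofReal_iff (by positivity), ENNReal.ofReal_mul hC, toSobolevₗ_apply,
      toSobolevₗ_apply, ofReal_norm_toSobolev hvol l hq, ofReal_norm_toSobolev hvol k hp]
    exact h u u.2
  have hdense : DenseRange (toSobolevₗ n X k p) := denseRange_toSobolev k p
  let J := (toSobolevₗ n X l q).extendOfNorm (toSobolevₗ n X k p)
  have hJ : ∀ u : TestFun n X, J (toSobolev k p u) = toSobolev l q u := fun u =>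
    LinearMap.extendOfNorm_eq hdense ⟨C, hnorm⟩ u
  refine ⟨J, ?_, hJ⟩
  -- An element of the kernel is a limit of test functions that are Cauchy in `W^{k,p}` and tend to
  -- zero in `W^{l,q}`; closability makes the limit zero.
  rw [injective_iff_map_eq_zero]
  intro z hz
  obtain ⟨w, hw, hwz⟩ := mem_closure_iff_seq_limit.1 (hdense z)
  choose u hu using hw
  have hcau : CauchySeq w := hwz.cauchySeq
  have e1 : ∀ m : ℕ × ℕ, ENNReal.ofReal (dist (w m.1) (w m.2)) =
      sobolevNorm n k p ((u m.1 : X → ℝ) - (u m.2 : X → ℝ)) := by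
    intro m
    rw [dist_eq_norm, ← hu, ← hu, ← map_sub, toSobolevₗ_apply, ofReal_norm_toSobolev hvol k hp]
    rfl
  have h1 : Tendsto (fun m : ℕ × ℕ => sobolevNorm n k p ((u m.1 : X → ℝ) - (u m.2 : X → ℝ)))
      atTop (𝓝 0) := by
    have := ENNReal.tendsto_ofReal (cauchySeq_iff_tendsto_dist_atTop_0.1 hcau)
    rw [ENNReal.ofReal_zero] at this
    exact this.congr e1
  have h2 : Tendsto (fun m => sobolevNorm n l q (u m : X → ℝ)) atTop (𝓝 0) := by
    have h3 := ((J.continuous.tendsto z).comp hwz).norm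
    rw [hz, norm_zero] at h3
    have h4 := ENNReal.tendsto_ofReal h3
    rw [ENNReal.ofReal_zero] at h4
    refine h4.congr fun m => ?_
    rw [Function.comp_apply, ← hu, toSobolevₗ_apply, hJ, ofReal_norm_toSobolev hvol l hq]
  have h5 := tendsto_sobolevNorm hX hp hq (fun m => (u m).2) h1 h2
  have h6 : Tendsto (fun m => ENNReal.ofReal ‖w m‖) atTop (𝓝 0) := by
    refine h5.congr fun m => ?_
    rw [← hu, toSobolevₗ_apply, ofReal_norm_toSobolev hvol k hp]
  have h7 := tendsto_nhds_unique (ENNReal.tendsto_ofReal hwz.norm) h6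
  rw [ENNReal.ofReal_eq_zero] at h7
  exact norm_le_zero_iff.1 h7

end Embedding

/-! ### Tame cubes around regular points -/

section LocalTame

variable {n : ℕ} {X : Type*} [TopologicalSpace X] [ChartedSpace (EuclideanSpace ℝ (Fin n)) X]
  [IsManifold (𝓡 n) ∞ X] [RiemannianBundle (fun y : X => TangentSpace (𝓡 n) y)]
  [IsContMDiffRiemannianBundle (𝓡 n) ∞ (EuclideanSpace ℝ (Fin n))
    (fun y : X => TangentSpace (𝓡 n) y)]

/-- Near each point of the target of a smooth chart the metric is comparable to the Euclidean
metric. -/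
lemma eventually_frame_comparable {e : OpenPartialHomeomorph X (Eu n)} (he : IsSmoothChart e)
    {z₀ : Eu n} (hz₀ : z₀ ∈ e.target) : ∃ lam : ℝ, 1 ≤ lam ∧ ∀ᶠ z in 𝓝 z₀,
      (∀ w, ‖frame e z w‖ ≤ lam * ‖w‖) ∧ ∀ w, ‖w‖ ≤ lam * ‖frame e z w‖ := by
  obtain ⟨K, hK0, hK⟩ : ∃ K : ℝ, 0 ≤ K ∧ ∀ w, ‖w‖ ≤ K * ‖frame e z₀ w‖ := by
    refine ⟨‖coframe e (e.symm z₀)‖, norm_nonneg _, fun w => ?_⟩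
    have := (coframe e (e.symm z₀)).le_opNorm (frame e z₀ w)
    rwa [he.coframe_frame hz₀] at this
  have hc : ContinuousAt (gram e) z₀ := (contDiffAt_gram he hz₀).continuousAt
  have hε : 0 < 1 / (2 * (K ^ 2 + 1)) := by positivity
  set A := ‖gram e z₀‖ with hA
  have hA0 : 0 ≤ A := norm_nonneg _
  -- Near `z₀` the quadratic form is at most `A + 1` and at least `1 / (2 (K² + 1))` times `‖w‖²`:
  -- the perturbation is chosen as half the lower bound at `z₀`.
  refine ⟨A + 2 * (K ^ 2 + 1), by nlinarith [sq_nonneg K], ?_⟩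
  filter_upwards [Metric.continuousAt_iff'.1 hc _ hε] with z hz
  rw [dist_eq_norm] at hz
  have hsq : ∀ w, ‖frame e z w‖ ^ 2 = gram e z w w := fun w => by
    rw [gram_apply, real_inner_self_eq_norm_sq]
  have hsq0 : ∀ w, ‖frame e z₀ w‖ ^ 2 = gram e z₀ w w := fun w => by
    rw [gram_apply, real_inner_self_eq_norm_sq]
  have hdiff : ∀ w, |gram e z w w - gram e z₀ w w| ≤ 1 / (2 * (K ^ 2 + 1)) * ‖w‖ ^ 2 := by
    intro w
    have h1 := (gram e z - gram e z₀).le_opNorm₂ w w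
    rw [Real.norm_eq_abs] at h1
    refine h1.trans ?_
    rw [mul_assoc, ← sq ‖w‖]
    gcongr
  have hle : 1 / (2 * (K ^ 2 + 1)) ≤ 1 := by
    rw [div_le_one (by positivity)]; nlinarith [sq_nonneg K]
  constructor
  · intro w
    have h1 : gram e z₀ w w ≤ A * ‖w‖ ^ 2 := by
      refine (le_abs_self _).trans (((gram e z₀).le_opNorm₂ w w).trans ?_)
      rw [mul_assoc, ← sq ‖w‖]
    refine abs_le_of_sq_le_sq' ?_ (by positivity) |>.2
    rw [hsq, mul_pow]
    have h2 := (abs_le.1 (hdiff w)).2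
    have h3 : A + 1 ≤ (A + 2 * (K ^ 2 + 1)) ^ 2 := by nlinarith [sq_nonneg K]
    nlinarith [sq_nonneg ‖w‖]
  · intro w
    refine abs_le_of_sq_le_sq' ?_ (by positivity) |>.2
    rw [mul_pow, hsq]
    have h1 : ‖w‖ ^ 2 ≤ K ^ 2 * gram e z₀ w w := by
      rw [← hsq0, ← mul_pow]
      exact pow_le_pow_left₀ (norm_nonneg _) (hK w) 2
    have h2 := (abs_le.1 (hdiff w)).1
    have hg0 : 0 ≤ gram e z₀ w w := by rw [← hsq0]; positivity
    have h4 : ‖w‖ ^ 2 / (K ^ 2 + 1) ≤ gram e z₀ w w := by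
      rw [div_le_iff₀ (by positivity)]; nlinarith
    have h5 : ‖w‖ ^ 2 / (2 * (K ^ 2 + 1)) ≤ gram e z w w := by
      have : ‖w‖ ^ 2 / (K ^ 2 + 1) = 2 * (1 / (2 * (K ^ 2 + 1)) * ‖w‖ ^ 2) := by
        field_simp
      have h6 : ‖w‖ ^ 2 / (2 * (K ^ 2 + 1)) = 1 / (2 * (K ^ 2 + 1)) * ‖w‖ ^ 2 := by ring
      linarith
    rw [div_le_iff₀ (by positivity)] at h5
    refine h5.trans ?_
    rw [mul_comm]
    have hg : 0 ≤ gram e z w w := by rw [← hsq]; positivity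
    gcongr
    nlinarith [sq_nonneg K]

lemma exists_cube_subset {z₀ : Eu n} {s : Set (Eu n)} (hs : s ∈ 𝓝 z₀) :
    ∃ (a : Fin n → ℝ) (δ : ℝ), 0 < δ ∧ cube a δ ⊆ s ∧ z₀ ∈ cube a δ := by
  have h1 : (WithLp.toLp 2 : (Fin n → ℝ) → Eu n) ⁻¹' s ∈ 𝓝 (WithLp.ofLp z₀) :=
    (PiLp.continuous_toLp 2 _).continuousAt.preimage_mem_nhds hs
  obtain ⟨δ, hδ, h2⟩ := Metric.mem_nhds_iff.1 h1
  refine ⟨fun i => z₀ i - δ / 2, δ, hδ, fun z hz => ?_, fun i => ⟨by simp [hδ], by linarith⟩⟩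
  have h3 : WithLp.ofLp z ∈ Metric.ball (WithLp.ofLp z₀) δ := by
    rw [Metric.mem_ball, dist_pi_lt_iff hδ]
    intro i
    have := hz i
    rw [Real.dist_eq, abs_lt]
    constructor <;> linarith [this.1, this.2]
  exact h2 h3

/-- Each point has a neighbourhood which is a tame cube. -/
lemma exists_isTameCube (y : X) : ∃ (e : OpenPartialHomeomorph X (Eu n)) (a : Fin n → ℝ)
    (δ lam : ℝ), IsTameCube e a δ lam ∧ e.symm '' cube a δ ∈ 𝓝 y := by
  set e := chartAt (Eu n) y
  have he : IsSmoothChart e := isSmoothChart_chartAt y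
  have hy : y ∈ e.source := mem_chart_source _ y
  obtain ⟨lam, hlam, h⟩ := eventually_frame_comparable he (e.map_source hy)
  obtain ⟨a, δ, hδ, hsub, hmem⟩ :=
    exists_cube_subset (h.and (e.open_target.mem_nhds (e.map_source hy)))
  refine ⟨e, a, δ, lam, ⟨he, hδ, hlam, fun z hz => (hsub hz).2, fun z hz => (hsub hz).1.1,
    fun z hz => (hsub hz).1.2⟩, ?_⟩
  refine (e.symm.isOpen_image_of_subset_source (isOpen_cube a δ)
    fun z hz => (hsub hz).2).mem_nhds ⟨e y, hmem, e.left_inv hy⟩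

end LocalTame

/-! ### Sector charts of a conical neighbourhood -/

section Conical

variable {n : ℕ} {M : Type*} [MetricSpace M] {x : M}
  [ChartedSpace (EuclideanSpace ℝ (Fin n)) {y : M // y ≠ x}]
  [IsManifold (𝓡 n) ∞ {y : M // y ≠ x}]
  [RiemannianBundle (fun y : {y : M // y ≠ x} => TangentSpace (𝓡 n) y)]
  {N : Type*} [TopologicalSpace N]
  [ChartedSpace (EuclideanSpace ℝ (Fin (n - 1))) N] [IsManifold (𝓡 (n - 1)) ∞ N]

lemma ConicalNeighborhood.h_inner_self_nonneg (c : ConicalNeighborhood n x N) (r : ℝ) (θ : N)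
    (v : TangentSpace (𝓡 (n - 1)) θ) : 0 ≤ (c.h r).inner θ v v := by
  rcases eq_or_ne v 0 with rfl | hv
  · simp
  · exact ((c.h r).pos θ v hv).le

/-- The metrics `h r` converge to `h 0`. -/
lemma ConicalNeighborhood.eventually_abs_h_sub_le (c : ConicalNeighborhood n x N) :
    ∀ᶠ r in 𝓝[>] (0 : ℝ), ∀ (θ : N) (v : TangentSpace (𝓡 (n - 1)) θ),
      |(c.h r).inner θ v v - (c.h 0).inner θ v v| ≤ 1 / 2 * (c.h 0).inner θ v v := by
  obtain ⟨α, hα, has⟩ := c.asymptotic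
  -- The exponent `α` is a natural number here. Only `r ^ α → 0` matters: uniform convergence of
  -- `h_r` suffices, at any rate.
  have h2 : Tendsto (fun r : ℝ => r ^ α) (𝓝[>] 0) (𝓝 0) := by
    have := (continuous_pow (M := ℝ) α).tendsto 0
    rw [zero_pow hα.ne'] at this
    exact this.mono_left nhdsWithin_le_nhds
  filter_upwards [has 1 one_pos, h2.eventually_lt_const (show (0 : ℝ) < 1 / 2 by norm_num)]
    with r hr hr' θ v
  refine (hr θ v).trans ?_
  rw [one_mul]
  have := c.h_inner_self_nonneg 0 θ v
  gcongr

/-- Near a point of the cross section the metrics `h r`, for small `r`, are uniformly comparable to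
the Euclidean metric in a chart. -/
lemma ConicalNeighborhood.eventually_h_comparable (c : ConicalNeighborhood n x N)
    {e : OpenPartialHomeomorph N (Eu (n - 1))} (he : IsSmoothChart e)
    {z₀ : Eu (n - 1)} (hz₀ : z₀ ∈ e.target) : ∃ lam : ℝ, 1 ≤ lam ∧ ∃ r₀ > 0,
      ∀ᶠ z in 𝓝 z₀, ∀ r ∈ Ioo 0 r₀, ∀ w,
      (c.h r).inner (e.symm z) (frame e z w) (frame e z w) ≤ (lam * ‖w‖) ^ 2 ∧
      ‖w‖ ^ 2 ≤ lam ^ 2 * (c.h r).inner (e.symm z) (frame e z w) (frame e z w) := by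
  -- With `h_0` as the metric of `N`, the comparison at regular points applies to `N`. Doubling
  -- `lam` absorbs the passage from `h_0` to `h_r`, which differ by at most half of `h_0`.
  let : RiemannianBundle (fun θ : N => TangentSpace (𝓡 (n - 1)) θ) := ⟨(c.h 0).toRiemannianMetric⟩
  obtain ⟨lam, hlam, h⟩ := eventually_frame_comparable he hz₀
  obtain ⟨r₀, hr₀, h3⟩ := mem_nhdsGT_iff_exists_Ioo_subset.1 c.eventually_abs_h_sub_le
  refine ⟨2 * lam, by linarith, r₀, hr₀, ?_⟩
  filter_upwards [h] with z hz r hr w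
  have h6 := h3 hr (e.symm z) (frame e z w)
  have h7 : (c.h 0).inner (e.symm z) (frame e z w) (frame e z w) = ‖frame e z w‖ ^ 2 :=
    real_inner_self_eq_norm_sq (frame e z w)
  rw [h7, abs_le] at h6
  have h8 := pow_le_pow_left₀ (norm_nonneg _) (hz.1 w) 2
  have h9 := pow_le_pow_left₀ (norm_nonneg _) (hz.2 w) 2
  rw [mul_pow] at h8 h9
  generalize (c.h r).inner (e.symm z) (frame e z w) (frame e z w) = I at *
  have := sq_nonneg ‖w‖
  have := sq_nonneg ‖frame e z w‖
  constructor
  · rw [mul_pow]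
    nlinarith [mul_nonneg (sq_nonneg lam) (sq_nonneg ‖w‖)]
  · have : ‖frame e z w‖ ^ 2 ≤ 2 * I := by linarith
    nlinarith [mul_le_mul_of_nonneg_left this (sq_nonneg lam), mul_nonneg (sq_nonneg lam)
      (sq_nonneg ‖frame e z w‖)]

/-- The map `(r, s) ↦ (r, r (s - s₀))` on the half space `0 < r`. -/
def coneHomeo {F : Type*} [NormedAddCommGroup F] [NormedSpace ℝ F] (s₀ : F) :
    OpenPartialHomeomorph (ℝ × F) (ℝ × F) where
  toFun z := (z.1, z.1 • (z.2 - s₀))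
  invFun z := (z.1, s₀ + z.1⁻¹ • z.2)
  source := {z | 0 < z.1}
  target := {z | 0 < z.1}
  map_source' z hz := hz
  map_target' z hz := hz
  left_inv' z hz := by
    have : z.1 ≠ 0 := ne_of_gt hz
    ext <;> simp [smul_smul, this]
  right_inv' z hz := by
    have : z.1 ≠ 0 := ne_of_gt hz
    ext <;> simp [smul_smul, this]
  open_source := isOpen_lt continuous_const continuous_fst
  open_target := isOpen_lt continuous_const continuous_fst
  continuousOn_toFun := by fun_prop
  continuousOn_invFun := by
    refine continuousOn_fst.prodMk (continuousOn_const.add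
      ((continuousOn_fst.inv₀ fun z hz => ne_of_gt hz).smul continuousOn_snd))

/-- The chart of a sector of a conical neighbourhood given by a chart of the cross section and
linear coordinates. -/
def ConicalNeighborhood.sectorChart (c : ConicalNeighborhood n x N)
    (e : OpenPartialHomeomorph N (Eu (n - 1))) (s₀ : Eu (n - 1))
    (T : Eu n ≃L[ℝ] ℝ × Eu (n - 1)) : OpenPartialHomeomorph {y : M // y ≠ x} (Eu n) :=
  c.φ.symm.trans (((OpenPartialHomeomorph.refl ℝ).prod e).trans
    ((coneHomeo s₀).trans T.symm.toHomeomorph.toOpenPartialHomeomorph))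

namespace ConicalNeighborhood

variable (c : ConicalNeighborhood n x N)
    {e : OpenPartialHomeomorph N (Eu (n - 1))} (s₀ : Eu (n - 1))
    (T : Eu n ≃L[ℝ] ℝ × Eu (n - 1))

/-- The point of the cross section chart below a point of the sector chart. -/
def sectorAngle (t : Eu n) : Eu (n - 1) := s₀ + (T t).1⁻¹ • (T t).2

lemma sectorChart_symm_apply (t : Eu n) : (c.sectorChart e s₀ T).symm t =
    c.φ ((T t).1, e.symm (sectorAngle s₀ T t)) := rfl

lemma mem_sectorChart_target {t : Eu n} : t ∈ (c.sectorChart e s₀ T).target ↔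
    (T t).1 ∈ Ioo 0 c.ε ∧ sectorAngle s₀ T t ∈ e.target := by
  simp only [sectorChart, OpenPartialHomeomorph.trans_target, OpenPartialHomeomorph.symm_target,
    c.source_eq, sectorAngle, coneHomeo]
  simp
  tauto

lemma sectorChart_source_subset : (c.sectorChart e s₀ T).source ⊆ c.φ.target ∩
    c.φ.symm ⁻¹' (univ ×ˢ e.source) := by
  intro y hy
  simp only [sectorChart, OpenPartialHomeomorph.trans_source] at hy
  simp at hy
  simp
  tauto

variable {s₀ T}

lemma contDiffAt_sectorAngle {t : Eu n} (ht : (T t).1 ≠ 0) : ContDiffAt ℝ ∞ (sectorAngle s₀ T) t := by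
  have h1 : ContDiffAt ℝ ∞ (fun t => (T t).1) t := (contDiff_fst.comp T.contDiff).contDiffAt
  have h2 : ContDiffAt ℝ ∞ (fun t => (T t).2) t := (contDiff_snd.comp T.contDiff).contDiffAt
  exact contDiffAt_const.add ((h1.inv ht).smul h2)

variable (s₀ T) in
lemma isSmoothChart_sectorChart (he : IsSmoothChart e) :
    IsSmoothChart (c.sectorChart e s₀ T) := by
  constructor
  · have hsub := c.sectorChart_source_subset (e := e) s₀ T
    have h0 : ContMDiffOn (𝓡 n) (𝓘(ℝ, ℝ).prod (𝓡 (n - 1))) ∞ c.φ.symm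
      (c.sectorChart e s₀ T).source := c.contMDiffOn_symm.mono fun y hy => (hsub hy).1
    have h1 : ContMDiffOn (𝓡 n) 𝓘(ℝ, ℝ) ∞ (fun y => (c.φ.symm y).1)
      (c.sectorChart e s₀ T).source := contMDiff_fst.comp_contMDiffOn h0
    have h2 : ContMDiffOn (𝓡 n) (𝓡 (n - 1)) ∞ (fun y => e (c.φ.symm y).2)
      (c.sectorChart e s₀ T).source :=
      he.contMDiffOn.comp (contMDiff_snd.comp_contMDiffOn h0) fun y hy => (hsub hy).2.2
    have h3 : ContMDiffOn (𝓡 n) (𝓡 (n - 1)) ∞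
        (fun y => (c.φ.symm y).1 • (e (c.φ.symm y).2 - s₀)) (c.sectorChart e s₀ T).source :=
      h1.smul (h2.sub contMDiffOn_const)
    have h4 := T.symm.contDiff.contMDiff.comp_contMDiffOn (h1.prodMk_space h3) (n := ∞)
    exact h4
  · have h1 : ContMDiffOn (𝓡 n) (𝓘(ℝ, ℝ).prod (𝓡 (n - 1))) ∞
        (fun t => ((T t).1, e.symm (sectorAngle s₀ T t))) (c.sectorChart e s₀ T).target := by
      refine ContMDiffOn.prodMk ?_ ?_
      · exact (contDiff_fst.comp T.contDiff).contMDiff.contMDiffOn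
      · refine he.contMDiffOn_symm.comp (t := e.target) ?_ fun t ht =>
          ((c.mem_sectorChart_target s₀ T).1 ht).2
        intro t ht
        refine ContMDiffAt.contMDiffWithinAt (contMDiffAt_iff_contDiffAt.2 ?_)
        exact contDiffAt_sectorAngle ((c.mem_sectorChart_target s₀ T).1 ht).1.1.ne'
    refine c.contMDiffOn_φ.comp h1 fun t ht => ?_
    show _ ∈ c.φ.source
    rw [c.source_eq]
    exact ⟨((c.mem_sectorChart_target s₀ T).1 ht).1, mem_univ _⟩

/-- The factor `(T t).1⁻¹`, that is `r⁻¹`, is what cancels the `r²` in `r² h_r` and makes the metric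
nondegenerate up to the tip in these coordinates. -/
lemma fderiv_sectorAngle {t : Eu n} (ht : (T t).1 ≠ 0) (v : Eu n) :
    fderiv ℝ (sectorAngle s₀ T) t v =
      (T t).1⁻¹ • ((T v).2 - (T v).1 • (sectorAngle s₀ T t - s₀)) := by
  have h1 : HasFDerivAt (fun t => (T t).1)
    ((ContinuousLinearMap.fst ℝ ℝ (Eu (n - 1))).comp (T : Eu n →L[ℝ] ℝ × Eu (n - 1))) t :=
    ((ContinuousLinearMap.fst ℝ ℝ (Eu (n - 1))).comp (T : Eu n →L[ℝ] ℝ × Eu (n - 1))).hasFDerivAt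
  have h2 : HasFDerivAt (fun t => (T t).2)
    ((ContinuousLinearMap.snd ℝ ℝ (Eu (n - 1))).comp (T : Eu n →L[ℝ] ℝ × Eu (n - 1))) t :=
    ((ContinuousLinearMap.snd ℝ ℝ (Eu (n - 1))).comp (T : Eu n →L[ℝ] ℝ × Eu (n - 1))).hasFDerivAt
  have h3 := (((hasDerivAt_inv ht).comp_hasFDerivAt t h1).smul h2).const_add s₀
  have h4 : fderiv ℝ (sectorAngle s₀ T) t = _ := h3.fderiv
  rw [h4]
  show (T t).1⁻¹ • (T v).2 + (-((T t).1 ^ 2)⁻¹ * (T v).1) • (T t).2 = _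
  rw [sectorAngle, add_sub_cancel_left]
  match_scalars <;> field_simp

/-- The metric of a conical neighbourhood in a sector chart. -/
lemma norm_frame_sectorChart_sq (he : IsSmoothChart e) {t : Eu n}
    (ht : t ∈ (c.sectorChart e s₀ T).target) (v : Eu n) :
    ‖frame (c.sectorChart e s₀ T) t v‖ ^ 2 = (T v).1 ^ 2 +
      (c.h (T t).1).inner (e.symm (sectorAngle s₀ T t))
        (frame e (sectorAngle s₀ T t) ((T v).2 - (T v).1 • (sectorAngle s₀ T t - s₀)))
        (frame e (sectorAngle s₀ T t) ((T v).2 - (T v).1 • (sectorAngle s₀ T t - s₀))) := by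
  obtain ⟨hr, hs⟩ := (c.mem_sectorChart_target s₀ T).1 ht
  have hr0 : (T t).1 ≠ 0 := hr.1.ne'
  have hφ : MDifferentiableAt (𝓘(ℝ, ℝ).prod (𝓡 (n - 1))) (𝓡 n) c.φ
      ((T t).1, e.symm (sectorAngle s₀ T t)) := by
    refine (c.contMDiffOn_φ.contMDiffAt (c.φ.open_source.mem_nhds ?_)).mdifferentiableAt (by simp)
    rw [c.source_eq]; exact ⟨hr, mem_univ _⟩
  have hang : MDifferentiableAt (𝓡 n) (𝓡 (n - 1)) (sectorAngle s₀ T) t :=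
    ((contDiffAt_sectorAngle hr0).differentiableAt (by simp)).mdifferentiableAt
  have hsymm : MDifferentiableAt (𝓡 (n - 1)) (𝓡 (n - 1)) e.symm (sectorAngle s₀ T t) :=
    (he.contMDiffAt_symm hs).mdifferentiableAt (by simp)
  have hfst : MDifferentiableAt (𝓡 n) 𝓘(ℝ, ℝ) (fun t => (T t).1) t :=
    ((contDiff_fst.comp T.contDiff).differentiable (by simp) (n := 1) t).mdifferentiableAt
  have hpair := hfst.prodMk (hsymm.comp t hang)
  have e1 : frame (c.sectorChart e s₀ T) t v = mfderiv (𝓘(ℝ, ℝ).prod (𝓡 (n - 1))) (𝓡 n) c.φ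
      ((T t).1, e.symm (sectorAngle s₀ T t)) ((T v).1, frame e (sectorAngle s₀ T t)
        ((T t).1⁻¹ • ((T v).2 - (T v).1 • (sectorAngle s₀ T t - s₀)))) := by
    have h1 : frame (c.sectorChart e s₀ T) t = mfderiv (𝓡 n) (𝓡 n)
      (c.φ ∘ fun t => ((T t).1, (e.symm ∘ sectorAngle s₀ T) t)) t := rfl
    rw [h1, mfderiv_comp t hφ hpair]
    refine congrArg (mfderiv (𝓘(ℝ, ℝ).prod (𝓡 (n - 1))) (𝓡 n) c.φ
      ((T t).1, e.symm (sectorAngle s₀ T t))) ?_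
    rw [mfderiv_prodMk hfst (hsymm.comp t hang), mfderiv_comp t hsymm hang]
    refine Prod.ext ?_ ?_
    · have : mfderiv (𝓡 n) 𝓘(ℝ, ℝ) (fun t => (T t).1) t =
        ((ContinuousLinearMap.fst ℝ ℝ (Eu (n - 1))).comp (T : Eu n →L[ℝ] ℝ × Eu (n - 1))) := by
        rw [mfderiv_eq_fderiv]
        exact ((ContinuousLinearMap.fst ℝ ℝ (Eu (n - 1))).comp
          (T : Eu n →L[ℝ] ℝ × Eu (n - 1))).hasFDerivAt.fderiv
      show mfderiv (𝓡 n) 𝓘(ℝ, ℝ) (fun t => (T t).1) t v = _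
      rw [this]; rfl
    · rw [← fderiv_sectorAngle hr0]
      show frame e (sectorAngle s₀ T t) (mfderiv (𝓡 n) (𝓡 (n - 1)) (sectorAngle s₀ T) t v) = _
      rw [mfderiv_eq_fderiv]
      rfl
  rw [← real_inner_self_eq_norm_sq, e1]
  refine (c.isometry _ hr _ _ _ _ _).trans ?_
  rw [map_smul, map_smul, map_smul, smul_apply, smul_eq_mul, smul_eq_mul,
    ← sq]
  congr 1
  field_simp

end ConicalNeighborhood

end Conical

/-! ### Linear coordinates adapted to a thin cone -/

/-- Linear coordinates in which the positive orthant is a thin cone around the first axis. -/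
lemma exists_sector_coordinates {n : ℕ} (hn : 1 ≤ n) {ρ : ℝ} (hρ : 0 < ρ) :
    ∃ T : Eu n ≃L[ℝ] ℝ × Eu (n - 1), (∀ t, (T t).1 = ∑ i, t i) ∧
      (∀ t, (∀ i, 0 < t i) → ‖(T t).2‖ ≤ ρ * (T t).1) ∧ ∀ i, T.symm (1, 0) i ∈ Ioo (0 : ℝ) 2 := by
  have hn0 : (0 : ℝ) < n := by exact_mod_cast hn
  let κ : ℝ := ρ / n
  have hκ : 0 < κ := by positivity
  let f : Fin (n - 1) → Fin n := fun i => ⟨i + 1, by omega⟩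
  let o : Fin n := ⟨0, by omega⟩
  -- The radial coordinate is the sum of the entries. On the positive orthant differences of entries
  -- are bounded by that sum, so the scale `κ = ρ / n` makes the cone as thin as required.
  let L : Eu n →ₗ[ℝ] ℝ × Eu (n - 1) :=
    { toFun := fun t => (∑ i, t i, WithLp.toLp 2 fun i => κ * (t (f i) - t o))
      map_add' := fun t t' => by
        refine Prod.ext (by simp [Finset.sum_add_distrib]) ?_
        ext i; simp; ring
      map_smul' := fun a t => by
        refine Prod.ext (by simp [Finset.mul_sum]) ?_
        ext i; simp; ring }
  have hL : Function.Injective L := by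
    refine (injective_iff_map_eq_zero _).2 fun t ht => ?_
    have h1 : ∑ i, t i = 0 := congrArg Prod.fst ht
    have h2 : ∀ i, t i = t o := by
      intro i
      rcases Nat.eq_zero_or_pos i.1 with h | h
      · exact congrArg _ (Fin.ext h)
      · have h3 : κ * (t (f ⟨i - 1, by omega⟩) - t o) = 0 :=
          congrFun (congrArg WithLp.ofLp (congrArg Prod.snd ht)) ⟨i - 1, by omega⟩
        have h4 : f ⟨i - 1, by omega⟩ = i := Fin.ext (by simp [f]; omega)
        rw [h4] at h3
        have := (mul_eq_zero.1 h3).resolve_left hκ.ne'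
        linarith
    simp only [h2, Finset.sum_const, Finset.card_univ, Fintype.card_fin, nsmul_eq_mul] at h1
    have h5 := (mul_eq_zero.1 h1).resolve_left hn0.ne'
    ext i
    rw [h2 i, h5]; rfl
  have hdim : Module.finrank ℝ (Eu n) = Module.finrank ℝ (ℝ × Eu (n - 1)) := by
    simp [Eu]; omega
  let T : Eu n ≃L[ℝ] ℝ × Eu (n - 1) :=
    (LinearEquiv.ofBijective L ⟨hL, (LinearMap.injective_iff_surjective_of_finrank_eq_finrank
      hdim).1 hL⟩).toContinuousLinearEquiv
  have hT : ∀ t, T t = (∑ i, t i, WithLp.toLp 2 fun i => κ * (t (f i) - t o)) := fun t => rfl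
  refine ⟨T, fun t => rfl, fun t ht => ?_, fun i => ?_⟩
  · have hsum : 0 ≤ ∑ i, t i := Finset.sum_nonneg fun i _ => (ht i).le
    have hle : ∀ i, t i ≤ ∑ i, t i := fun i =>
      Finset.single_le_sum (fun j _ => (ht j).le) (Finset.mem_univ i)
    refine abs_le_of_sq_le_sq' ?_ (by rw [hT]; positivity) |>.2
    rw [EuclideanSpace.real_norm_sq_eq, hT]
    have h1 : ∀ i : Fin (n - 1), (κ * (t (f i) - t o)) ^ 2 ≤ (κ * ∑ i, t i) ^ 2 := by
      intro i
      rw [mul_pow, mul_pow]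
      refine mul_le_mul_of_nonneg_left ?_ (sq_nonneg _)
      refine sq_le_sq' ?_ ?_ <;> linarith [hle (f i), hle o, ht (f i), ht o]
    refine (Finset.sum_le_sum fun i _ => h1 i).trans ?_
    simp only [Finset.sum_const, Finset.card_univ, Fintype.card_fin, nsmul_eq_mul, mul_pow]
    rw [← mul_assoc]
    refine mul_le_mul_of_nonneg_right ?_ (sq_nonneg _)
    have h2 : ((n - 1 : ℕ) : ℝ) ≤ n := by exact_mod_cast Nat.sub_le _ _
    have h3 : (1 : ℝ) ≤ n := by exact_mod_cast hn
    have h4 : ρ ^ 2 = (n : ℝ) ^ 2 * κ ^ 2 := by simp only [κ]; field_simp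
    rw [h4]
    refine mul_le_mul_of_nonneg_right ?_ (sq_nonneg _)
    nlinarith
  -- The axis of the cone is the diagonal of the orthant. The upper bound `2` is slack, making the
  -- condition open.
  · have h1 : T.symm (1, 0) = WithLp.toLp 2 fun _ => 1 / (n : ℝ) := by
      rw [ContinuousLinearEquiv.symm_apply_eq, hT]
      refine Prod.ext ?_ ?_
      · simp [hn0.ne']
      · ext i; simp
    rw [h1]
    have h3 : (1 : ℝ) ≤ n := by exact_mod_cast hn
    refine ⟨by simp [hn0], ?_⟩
    have : 1 / (n : ℝ) ≤ 1 := by rw [div_le_one hn0]; exact h3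
    show 1 / (n : ℝ) < 2
    linarith

/-- Applied with `F` the length of a vector, `a` its radial part, `W` the Euclidean length of its
angular part and `I` the `h_r`-square of that part. -/
lemma bounds_of_sq_eq {F a W I l : ℝ} (hl : 1 ≤ l) (hF : 0 ≤ F) (hW : 0 ≤ W)
    (h1 : F ^ 2 = a ^ 2 + I) (h2 : I ≤ (l * W) ^ 2) (h3 : W ^ 2 ≤ l ^ 2 * I) :
    F ≤ |a| + l * W ∧ |a| ≤ F ∧ W ≤ l * F := by
  have hl2 : 0 < l ^ 2 := by positivity
  have hI : 0 ≤ I := by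
    have := (sq_nonneg W).trans h3
    exact nonneg_of_mul_nonneg_right this hl2
  refine ⟨abs_le_of_sq_le_sq' ?_ (by positivity) |>.2, abs_le_of_sq_le_sq ?_ hF,
      abs_le_of_sq_le_sq' ?_ (by positivity) |>.2⟩
  · rw [h1, add_sq, sq_abs]
    have : 0 ≤ 2 * |a| * (l * W) := by positivity
    linarith
  · rw [h1]; linarith
  · rw [mul_pow, h1]
    nlinarith [mul_nonneg hl2.le (sq_nonneg a)]

/-! ### Tame cubes with a corner at the tip -/

section Conical

variable {n : ℕ} {M : Type*} [MetricSpace M] {x : M}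
  [ChartedSpace (EuclideanSpace ℝ (Fin n)) {y : M // y ≠ x}]
  [IsManifold (𝓡 n) ∞ {y : M // y ≠ x}]
  [RiemannianBundle (fun y : {y : M // y ≠ x} => TangentSpace (𝓡 n) y)]
  {N : Type*} [TopologicalSpace N]
  [ChartedSpace (EuclideanSpace ℝ (Fin (n - 1))) N] [IsManifold (𝓡 (n - 1)) ∞ N]

namespace ConicalNeighborhood

/-- Truncated sectors over a neighbourhood of each point of the cross section are contained in
tame cubes. -/
lemma exists_isTameCube_sector (c : ConicalNeighborhood n x N) (hn : 1 ≤ n) (θ₀ : N) :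
    ∃ (e : OpenPartialHomeomorph {y : M // y ≠ x} (Eu n)) (a : Fin n → ℝ) (δ lam : ℝ),
      IsTameCube e a δ lam ∧ ∃ η > 0, ∃ W ∈ 𝓝 θ₀, c.φ '' (Ioo 0 η ×ˢ W) ⊆ e.symm '' cube a δ := by
  have hn0 : (0 : ℝ) < n := by exact_mod_cast hn
  set e₀ := chartAt (Eu (n - 1)) θ₀
  have he₀ : IsSmoothChart e₀ := isSmoothChart_chartAt θ₀
  have hθ₀ : θ₀ ∈ e₀.source := mem_chart_source _ θ₀
  set s₀ := e₀ θ₀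
  obtain ⟨lam₀, hlam₀, r₀, hr₀, hcomp⟩ := c.eventually_h_comparable he₀ (e₀.map_source hθ₀)
  obtain ⟨ρ', hρ', hball⟩ := Metric.eventually_nhds_iff.1
    (hcomp.and (e₀.open_target.mem_nhds (e₀.map_source hθ₀)))
  -- Opening of the cone: below `ρ'` the metrics `h_r` are comparable in the chart of `N`, and `ρ ≤
  -- 1` bounds the shear by the radial component.
  set ρ := min 1 (ρ' / 2)
  have hρ : 0 < ρ := by positivity
  have hρ1 : ρ ≤ 1 := min_le_left _ _
  have hρ2 : ρ < ρ' := (min_le_right _ _).trans_lt (by linarith)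
  obtain ⟨T, hT1, hT2, hT3⟩ := exists_sector_coordinates hn hρ
  set E := c.sectorChart e₀ s₀ T
  -- On the cube the radius is a sum of `n` entries below `δ`, hence less than `min c.ε r₀`.
  set δ := min c.ε r₀ / n
  have hm : 0 < min c.ε r₀ := lt_min c.ε_pos hr₀
  have hδ : 0 < δ := by positivity
  have key : ∀ t ∈ cube 0 δ, (T t).1 ∈ Ioo 0 (min c.ε r₀) ∧
      ‖sectorAngle s₀ T t - s₀‖ ≤ ρ := by
    intro t ht
    have hpos : ∀ i, 0 < t i := fun i => (ht i).1
    have hlt : ∀ i, t i < δ := fun i => by simpa using (ht i).2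
    have hne : (Finset.univ : Finset (Fin n)).Nonempty := ⟨⟨0, by omega⟩, Finset.mem_univ _⟩
    have h1 : 0 < (T t).1 := by rw [hT1]; exact Finset.sum_pos (fun i _ => hpos i) hne
    have h2 : (T t).1 < min c.ε r₀ := by
      rw [hT1]
      refine (Finset.sum_lt_sum_of_nonempty hne fun i _ => hlt i).trans_eq ?_
      simp only [Finset.sum_const, Finset.card_univ, Fintype.card_fin, nsmul_eq_mul, δ]
      field_simp
    refine ⟨⟨h1, h2⟩, ?_⟩
    rw [sectorAngle, add_sub_cancel_left, norm_smul, norm_inv, Real.norm_of_nonneg h1.le,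
      inv_mul_le_iff₀ h1, mul_comm]
    exact hT2 t hpos
  have hang : ∀ t ∈ cube 0 δ, dist (sectorAngle s₀ T t) s₀ < ρ' := fun t ht => by
    rw [dist_eq_norm]; exact (key t ht).2.trans_lt hρ2
  have htar : ∀ t ∈ cube 0 δ, t ∈ E.target := fun t ht =>
    (c.mem_sectorChart_target s₀ T).2 ⟨⟨(key t ht).1.1, (key t ht).1.2.trans_le (min_le_left _ _)⟩,
      (hball (hang t ht)).2⟩
  set A := ‖(T : Eu n →L[ℝ] ℝ × Eu (n - 1))‖
  set B := ‖(T.symm : ℝ × Eu (n - 1) →L[ℝ] Eu n)‖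
  have hA : 0 ≤ A := norm_nonneg _
  have hB : 0 ≤ B := norm_nonneg _
  -- The middle term bounds the metric from above, using the norm of `T`; the last bounds it from
  -- below, using the norm of its inverse.
  set lam := 1 + A * (1 + 2 * lam₀) + B * (2 + lam₀)
  have hl0 : 0 ≤ lam₀ := by linarith
  have hw : ∀ t ∈ cube 0 δ, ∀ v, |‖(T v).2 - (T v).1 • (sectorAngle s₀ T t - s₀)‖ - ‖(T v).2‖| ≤
      |(T v).1| := by
    intro t ht v
    refine (abs_norm_sub_norm_le _ _).trans ?_
    rw [sub_sub_cancel_left, norm_neg, norm_smul, Real.norm_eq_abs]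
    exact mul_le_of_le_one_right (abs_nonneg _) ((key t ht).2.trans hρ1)
  have hsq : ∀ t ∈ cube 0 δ, ∀ v,
      ‖frame E t v‖ ≤ |(T v).1| + lam₀ * ‖(T v).2 - (T v).1 • (sectorAngle s₀ T t - s₀)‖ ∧
      |(T v).1| ≤ ‖frame E t v‖ ∧
      ‖(T v).2 - (T v).1 • (sectorAngle s₀ T t - s₀)‖ ≤ lam₀ * ‖frame E t v‖ := by
    intro t ht v
    have h1 := c.norm_frame_sectorChart_sq he₀ (htar t ht) v
    obtain ⟨h2, h3⟩ := (hball (hang t ht)).1 (T t).1 ⟨(key t ht).1.1,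
      (key t ht).1.2.trans_le (min_le_right _ _)⟩ ((T v).2 - (T v).1 • (sectorAngle s₀ T t - s₀))
    exact bounds_of_sq_eq hlam₀ (norm_nonneg _) (norm_nonneg _) h1 h2 h3
  have hT : ∀ v, |(T v).1| ≤ A * ‖v‖ ∧ ‖(T v).2‖ ≤ A * ‖v‖ := fun v => by
    have h1 : ‖T v‖ ≤ A * ‖v‖ := (T : Eu n →L[ℝ] ℝ × Eu (n - 1)).le_opNorm v
    exact ⟨(norm_fst_le (T v)).trans h1, (norm_snd_le (T v)).trans h1⟩
  have hTs : ∀ v, ‖v‖ ≤ B * (|(T v).1| + ‖(T v).2‖) := fun v => by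
    have h1 := (T.symm : ℝ × Eu (n - 1) →L[ℝ] Eu n).le_opNorm (T v)
    rw [ContinuousLinearEquiv.coe_coe, T.symm_apply_apply] at h1
    refine h1.trans (mul_le_mul_of_nonneg_left ?_ hB)
    rw [Prod.norm_def, Real.norm_eq_abs]
    exact max_le (by linarith [norm_nonneg (T v).2]) (by linarith [abs_nonneg (T v).1])
  -- The cube is `(0, δ)^n`, its corner being the tip. The set `W` consists of the angles whose ray
  -- has direction with entries in `(0, 2)`; scaled by `r < δ / 2` these land in `(0, δ)`.
  refine ⟨E, 0, δ, lam, ⟨c.isSmoothChart_sectorChart s₀ T he₀, hδ, ?_, htar, ?_, ?_⟩, δ / 2,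
    by positivity, e₀.source ∩ {θ | ∀ i, T.symm (1, e₀ θ - s₀) i ∈ Ioo (0 : ℝ) 2}, ?_, ?_⟩
  · have : 0 ≤ A * (1 + 2 * lam₀) + B * (2 + lam₀) := by positivity
    linarith
  · intro t ht v
    have h1 := (hsq t ht v).1
    have h2 := (abs_le.1 (hw t ht v)).2
    obtain ⟨h3, h4⟩ := hT v
    have h5 : lam₀ * ‖(T v).2 - (T v).1 • (sectorAngle s₀ T t - s₀)‖ ≤ lam₀ * (2 * (A * ‖v‖)) :=
      mul_le_mul_of_nonneg_left (by linarith) hl0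
    have h6 : A * (1 + 2 * lam₀) * ‖v‖ ≤ lam * ‖v‖ := by
      refine mul_le_mul_of_nonneg_right ?_ (norm_nonneg _)
      have : 0 ≤ B * (2 + lam₀) := by positivity
      linarith
    linarith
  · intro t ht v
    obtain ⟨-, h1, h2⟩ := hsq t ht v
    have h3 := (abs_le.1 (hw t ht v)).1
    have h4 : ‖v‖ ≤ B * ((2 + lam₀) * ‖frame E t v‖) :=
      (hTs v).trans (mul_le_mul_of_nonneg_left (by linarith) hB)
    have h6 : B * (2 + lam₀) * ‖frame E t v‖ ≤ lam * ‖frame E t v‖ := by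
      refine mul_le_mul_of_nonneg_right ?_ (norm_nonneg _)
      have : 0 ≤ A * (1 + 2 * lam₀) := by positivity
      linarith
    linarith
  · refine inter_mem (e₀.open_source.mem_nhds hθ₀) ?_
    refine eventually_all.2 fun i => ?_
    have hc : ContinuousAt (fun θ => T.symm (1, e₀ θ - s₀) i) θ₀ := by
      have h1 : ContinuousAt (fun θ => ((1 : ℝ), e₀ θ - s₀)) θ₀ :=
        continuousAt_const.prodMk ((e₀.continuousAt hθ₀).sub continuousAt_const)
      have h2 : Continuous (fun z : ℝ × Eu (n - 1) => T.symm z i) := by fun_prop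
      exact h2.continuousAt.comp h1
    refine hc.preimage_mem_nhds (isOpen_Ioo.mem_nhds ?_)
    show T.symm (1, e₀ θ₀ - s₀) i ∈ _
    rw [sub_self]
    exact hT3 i
  · rintro _ ⟨⟨r, θ⟩, ⟨hr, hθ, hθ2⟩, rfl⟩
    have hr : r ∈ Ioo 0 (δ / 2) := hr
    refine ⟨T.symm (r, r • (e₀ θ - s₀)), fun i => ?_, ?_⟩
    · have h1 : ((r, r • (e₀ θ - s₀)) : ℝ × Eu (n - 1)) = r • (1, e₀ θ - s₀) := by simp
      have h2 := hθ2 i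
      rw [h1, map_smul]
      show r * _ ∈ _
      simp only [Pi.zero_apply, zero_add]
      constructor
      · exact mul_pos hr.1 h2.1
      · refine (mul_lt_mul_of_pos_left h2.2 hr.1).trans ?_
        linarith [hr.2]
    · rw [sectorChart_symm_apply, sectorAngle, T.apply_symm_apply]
      simp only [smul_smul, inv_mul_cancel₀ hr.1.ne', one_smul, add_sub_cancel]
      rw [e₀.left_inv hθ]

end ConicalNeighborhood

end Conical

/-! ### Lipschitz estimates along curves -/

section Length

variable {n : ℕ} {X : Type*} [TopologicalSpace X] [ChartedSpace (EuclideanSpace ℝ (Fin n)) X]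
  [IsManifold (𝓡 n) ∞ X] [RiemannianBundle (fun y : X => TangentSpace (𝓡 n) y)]

/-- A function with bounded differential is Lipschitz for the Riemannian distance. -/
lemma enorm_sub_le_riemannianEDist {F : X → ℝ} (hF : ContMDiff (𝓡 n) 𝓘(ℝ, ℝ) 1 F) {C : ℝ}
    (hC : 0 < C) (hb : ∀ y v, |mvfderiv (𝓡 n) F y v| ≤ C * ‖v‖) (a b : X) :
    ‖F b - F a‖ₑ ≤ ENNReal.ofReal C * riemannianEDist (𝓡 n) a b := by
  have hC0 : ENNReal.ofReal C ≠ 0 := by simpa using hC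
  rw [mul_comm, ← ENNReal.div_le_iff hC0 ENNReal.ofReal_ne_top]
  refine le_of_forall_gt fun r hr => ?_
  obtain ⟨γ, h0, h1, hγ, hlen⟩ := exists_lt_of_riemannianEDist_lt hr
  refine lt_of_le_of_lt ?_ hlen
  rw [ENNReal.div_le_iff hC0 ENNReal.ofReal_ne_top, mul_comm]
  have hcd : ContDiffOn ℝ 1 (F ∘ γ) (Icc 0 1) :=
    contMDiffOn_iff_contDiffOn.1 (hF.comp_contMDiffOn hγ)
  have h2 := enorm_sub_le_lintegral_derivWithin_Icc_of_contDiffOn_Icc hcd zero_le_one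
  rw [Function.comp_apply, Function.comp_apply, h0, h1] at h2
  refine h2.trans ?_
  rw [pathELength_eq_lintegral_mfderivWithin_Icc,
    ← lintegral_const_mul' _ _ ENNReal.ofReal_ne_top]
  refine setLIntegral_mono' measurableSet_Icc fun t ht => ?_
  have hud : UniqueMDiffWithinAt 𝓘(ℝ, ℝ) (Icc (0 : ℝ) 1) t :=
    (uniqueDiffOn_Icc zero_lt_one t ht).uniqueMDiffWithinAt
  have h3 := mfderivWithin_comp (I := 𝓘(ℝ, ℝ)) (I' := 𝓡 n) (I'' := 𝓘(ℝ, ℝ)) (u := univ) t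
    ((hF.mdifferentiable one_ne_zero) (γ t)).mdifferentiableWithinAt
    (hγ.mdifferentiableOn one_ne_zero t ht) (fun _ _ => mem_univ _) hud
  rw [mfderivWithin_univ, mfderivWithin_eq_fderivWithin] at h3
  have h4 : derivWithin (F ∘ γ) (Icc 0 1) t =
      mvfderiv (𝓡 n) F (γ t) (mfderivWithin 𝓘(ℝ, ℝ) (𝓡 n) γ (Icc 0 1) t (1 : ℝ)) := by
    rw [← fderivWithin_derivWithin, h3]
    rfl
  rw [h4, ← ofReal_norm, ← ofReal_norm, ← ENNReal.ofReal_mul hC.le]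
  exact ENNReal.ofReal_le_ofReal (hb _ _)

end Length

/-! ### Neighbourhoods of the tip and the finite cover -/

section Conical

variable {n : ℕ} {M : Type*} [MetricSpace M] {x : M}
  [ChartedSpace (EuclideanSpace ℝ (Fin n)) {y : M // y ≠ x}]
  [IsManifold (𝓡 n) ∞ {y : M // y ≠ x}]
  [RiemannianBundle (fun y : {y : M // y ≠ x} => TangentSpace (𝓡 n) y)]
  {N : Type*} [TopologicalSpace N]
  [ChartedSpace (EuclideanSpace ℝ (Fin (n - 1))) N] [IsManifold (𝓡 (n - 1)) ∞ N]

namespace ConicalNeighborhood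

lemma mem_source (c : ConicalNeighborhood n x N) {z : ℝ × N} :
    z ∈ c.φ.source ↔ z.1 ∈ Ioo 0 c.ε := by
  rw [c.source_eq]; simp

lemma exists_forall_dist_lt (c : ConicalNeighborhood n x N) {d : ℝ} (hd : 0 < d) :
    ∃ ρ > 0, ∀ r ∈ Ioo 0 ρ, ∀ θ, dist (c.φ (r, θ) : M) x < d := by
  have h1 := c.tendsto_tip.eventually (Metric.ball_mem_nhds x hd)
  rw [eventually_comap] at h1
  obtain ⟨ρ, hρ, h⟩ := mem_nhdsGT_iff_exists_Ioo_subset.1 h1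
  exact ⟨ρ, hρ, fun r hr θ => h hr (r, θ) rfl⟩

/-- A point `y ≠ x` stays away from the part with small `r`, which lies close to `x`; the remaining
part is compact, being the image of a closed interval times `N`. -/
lemma isClosed_truncation [CompactSpace N] (c : ConicalNeighborhood n x N) {δ : ℝ}
    (hδ : δ < c.ε) : IsClosed (c.φ '' (Ioc 0 δ ×ˢ univ)) := by
  rw [← isOpen_compl_iff, isOpen_iff_mem_nhds]
  intro y hy
  have hd : 0 < dist (y : M) x / 2 := by
    have := dist_pos.2 y.2
    positivity
  obtain ⟨ρ, hρ, h⟩ := c.exists_forall_dist_lt hd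
  have hB : IsCompact (c.φ '' (Icc (ρ / 2) δ ×ˢ univ)) := by
    refine (isCompact_Icc.prod isCompact_univ).image_of_continuousOn
      (c.φ.continuousOn.mono fun z hz => c.mem_source.2 ?_)
    exact ⟨(by positivity : 0 < ρ / 2).trans_le hz.1.1, hz.1.2.trans_lt hδ⟩
  have hsub : c.φ '' (Icc (ρ / 2) δ ×ˢ univ) ⊆ c.φ '' (Ioc 0 δ ×ˢ univ) :=
    image_mono (prod_mono (fun r hr => ⟨(by positivity : 0 < ρ / 2).trans_le hr.1, hr.2⟩)
      subset_rfl)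
  have hU : {z : {y : M // y ≠ x} | dist (z : M) y < dist (y : M) x / 2} ∈ 𝓝 y :=
    (isOpen_lt (by fun_prop) continuous_const).mem_nhds (by simpa using hd)
  filter_upwards [hU, hB.isClosed.isOpen_compl.mem_nhds fun h => hy (hsub h)] with z hz1 hz2
  rintro ⟨⟨r, θ⟩, ⟨hr, -⟩, rfl⟩
  have hr : r ∈ Ioc 0 δ := hr
  rcases lt_or_ge r ρ with h1 | h1
  · have h2 := h r ⟨hr.1, h1⟩ θ
    have h3 := dist_triangle_left (y : M) x (c.φ (r, θ))
    have hz1 : dist (c.φ (r, θ) : M) y < dist (y : M) x / 2 := hz1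
    linarith
  · exact hz2 ⟨(r, θ), ⟨⟨by linarith, hr.2⟩, mem_univ _⟩, rfl⟩

/-- The radial component of a tangent vector is bounded by its length. -/
lemma abs_fst_mfderiv_symm_le (c : ConicalNeighborhood n x N) {y : {y : M // y ≠ x}}
    (hy : y ∈ c.φ.target) (v : TangentSpace (𝓡 n) y) :
    |(mfderiv (𝓡 n) (𝓘(ℝ, ℝ).prod (𝓡 (n - 1))) c.φ.symm y v : ℝ × Eu (n - 1)).1| ≤ ‖v‖ := by
  obtain ⟨z, hz, rfl⟩ : ∃ z ∈ c.φ.source, c.φ z = y := ⟨c.φ.symm y, c.φ.map_target hy, c.φ.right_inv hy⟩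
  have h1 : MDifferentiableAt (𝓘(ℝ, ℝ).prod (𝓡 (n - 1))) (𝓡 n) c.φ (c.φ.symm (c.φ z)) := by
    rw [c.φ.left_inv hz]
    exact (c.contMDiffOn_φ.contMDiffAt (c.φ.open_source.mem_nhds hz)).mdifferentiableAt (by simp)
  have h2 : MDifferentiableAt (𝓡 n) (𝓘(ℝ, ℝ).prod (𝓡 (n - 1))) c.φ.symm (c.φ z) :=
    (c.contMDiffOn_symm.contMDiffAt (c.φ.open_target.mem_nhds hy)).mdifferentiableAt (by simp)
  have h3 := mfderiv_comp (c.φ z) h1 h2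
  have h4 : mfderiv (𝓡 n) (𝓡 n) (c.φ ∘ c.φ.symm) (c.φ z) =
      mfderiv (𝓡 n) (𝓡 n) id (c.φ z) := by
    refine Filter.EventuallyEq.mfderiv_eq ?_
    filter_upwards [c.φ.open_target.mem_nhds hy] with w hw
    exact c.φ.right_inv hw
  have h5 : ∀ q, q = z → ∀ w : ℝ × Eu (n - 1),
      (mfderiv (𝓘(ℝ, ℝ).prod (𝓡 (n - 1))) (𝓡 n) c.φ q w : Eu n) =
      (mfderiv (𝓘(ℝ, ℝ).prod (𝓡 (n - 1))) (𝓡 n) c.φ z w : Eu n) := by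
    rintro _ rfl w; rfl
  rw [h4, mfderiv_id] at h3
  have h6 := (DFunLike.congr_fun h3 v).trans (h5 _ (c.φ.left_inv hz) _)
  obtain ⟨r, θ⟩ := z
  set w : ℝ × Eu (n - 1) := mfderiv (𝓡 n) (𝓘(ℝ, ℝ).prod (𝓡 (n - 1))) c.φ.symm (c.φ (r, θ)) v
  have h7 : v = mfderiv (𝓘(ℝ, ℝ).prod (𝓡 (n - 1))) (𝓡 n) c.φ (r, θ) w := h6
  have h8 := c.isometry r (c.mem_source.1 hz) θ w.1 w.1 w.2 w.2
  have h9 : ‖v‖ ^ 2 = w.1 * w.1 + r ^ 2 * (c.h r).inner θ w.2 w.2 := by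
    rw [← real_inner_self_eq_norm_sq, h7]
    exact h8
  have h10 : 0 ≤ (c.h r).inner θ w.2 w.2 := c.h_inner_self_nonneg r θ w.2
  refine abs_le_of_sq_le_sq ?_ (norm_nonneg _)
  rw [h9]
  have := mul_nonneg (sq_nonneg r) h10
  linarith

open Classical in
/-- A smooth function which vanishes near the tip of the cone and equals one away from it. -/
def cutoff (c : ConicalNeighborhood n x N) (δ : ℝ) (y : {y : M // y ≠ x}) : ℝ :=
  -- The transition vanishes for `r ≤ δ / 4` and equals one for `r ≥ δ / 2`.
  if y ∈ c.φ.target then Real.smoothTransition (4 * (c.φ.symm y).1 / δ - 1) else 1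

lemma cutoff_eq_one [CompactSpace N] (c : ConicalNeighborhood n x N) {δ : ℝ} (hδ : 0 < δ)
    {y : {y : M // y ≠ x}} (hy : y ∉ c.φ '' (Ioc 0 (δ / 2) ×ˢ univ)) : c.cutoff δ y = 1 := by
  unfold cutoff
  split_ifs with h
  · apply Real.smoothTransition.one_of_one_le
    by_contra! h1
    refine hy ⟨c.φ.symm y, ⟨⟨(c.mem_source.1 (c.φ.map_target h)).1, ?_⟩, mem_univ _⟩,
      c.φ.right_inv h⟩
    have h2 : 4 * (c.φ.symm y).1 / δ < 2 := by linarith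
    rw [div_lt_iff₀ hδ] at h2
    linarith
  · rfl

lemma contDiff_smoothTransition_comp (δ : ℝ) :
    ContDiff ℝ 1 fun r : ℝ => Real.smoothTransition (4 * r / δ - 1) :=
  (Real.smoothTransition.contDiff (n := 1)).comp (by fun_prop)

/-- Off the cone the cutoff is locally constant, since the truncation at `δ / 2` is closed. On the
cone it is a function of `r` alone with bounded derivative, and the differential of `r` has norm at
most one. -/
lemma contMDiff_cutoff [CompactSpace N] (c : ConicalNeighborhood n x N) {δ : ℝ} (hδ : 0 < δ)
    (hδε : δ ≤ c.ε) : ContMDiff (𝓡 n) 𝓘(ℝ, ℝ) 1 (c.cutoff δ) ∧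
      ∃ C : ℝ, 0 < C ∧ ∀ y v, |mvfderiv (𝓡 n) (c.cutoff δ) y v| ≤ C * ‖v‖ := by
  set f : ℝ → ℝ := fun r => Real.smoothTransition (4 * r / δ - 1) with hf
  have hfd : ContDiff ℝ 1 f := contDiff_smoothTransition_comp δ
  obtain ⟨C, hC⟩ := isCompact_Icc.exists_bound_of_continuousOn (s := Icc (0 : ℝ) c.ε)
    (hfd.continuous_deriv le_rfl).continuousOn
  have hout : ∀ y ∉ c.φ.target, c.cutoff δ =ᶠ[𝓝 y] fun _ => 1 := by
    intro y hy
    have hcl := c.isClosed_truncation (δ := δ / 2) (by linarith)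
    have hyK : y ∉ c.φ '' (Ioc 0 (δ / 2) ×ˢ univ) := by
      rintro ⟨z, ⟨hz, -⟩, rfl⟩
      exact hy (c.φ.map_source (c.mem_source.2 ⟨hz.1, by linarith [hz.2]⟩))
    filter_upwards [hcl.isOpen_compl.mem_nhds hyK] with w hw using c.cutoff_eq_one hδ hw
  have hin : ∀ y ∈ c.φ.target, c.cutoff δ =ᶠ[𝓝 y] f ∘ fun y => (c.φ.symm y).1 := by
    intro y hy
    filter_upwards [c.φ.open_target.mem_nhds hy] with w hw
    simp [cutoff, hw, hf]
  have hr : ∀ y ∈ c.φ.target, ContMDiffAt (𝓡 n) 𝓘(ℝ, ℝ) 1 (fun y => (c.φ.symm y).1) y := by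
    intro y hy
    exact contMDiffAt_fst.comp y
      ((c.contMDiffOn_symm.contMDiffAt (c.φ.open_target.mem_nhds hy)).of_le (by simp))
  refine ⟨fun y => ?_, max C 1, by positivity, fun y v => ?_⟩
  · by_cases hy : y ∈ c.φ.target
    · exact ContMDiffAt.congr_of_eventuallyEq
        (hfd.contMDiff.contMDiffAt.comp y (hr y hy)) (hin y hy)
    · exact contMDiffAt_const.congr_of_eventuallyEq (hout y hy)
  · by_cases hy : y ∈ c.φ.target
    · have h1 : mfderiv (𝓡 n) 𝓘(ℝ, ℝ) (c.cutoff δ) y = _ := (hin y hy).mfderiv_eq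
      have h2 : MDifferentiableAt (𝓡 n) (𝓘(ℝ, ℝ).prod (𝓡 (n - 1))) c.φ.symm y :=
        (c.contMDiffOn_symm.contMDiffAt (c.φ.open_target.mem_nhds hy)).mdifferentiableAt (by simp)
      have h3 : MDifferentiableAt 𝓘(ℝ, ℝ) 𝓘(ℝ, ℝ) f (c.φ.symm y).1 :=
        (hfd.differentiable one_ne_zero _).mdifferentiableAt
      rw [mfderiv_comp y h3 ((hr y hy).mdifferentiableAt one_ne_zero)] at h1
      have h4 : mfderiv (𝓡 n) 𝓘(ℝ, ℝ) (fun y => (c.φ.symm y).1) y =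
        (mfderiv (𝓘(ℝ, ℝ).prod (𝓡 (n - 1))) 𝓘(ℝ, ℝ) Prod.fst (c.φ.symm y)).comp
          (mfderiv (𝓡 n) (𝓘(ℝ, ℝ).prod (𝓡 (n - 1))) c.φ.symm y) :=
        mfderiv_comp y mdifferentiableAt_fst h2
      rw [mfderiv_fst] at h4
      set a := (mfderiv (𝓡 n) (𝓘(ℝ, ℝ).prod (𝓡 (n - 1))) c.φ.symm y v : ℝ × Eu (n - 1)).1
        with ha
      have h5 : mvfderiv (𝓡 n) (c.cutoff δ) y v = a * deriv f (c.φ.symm y).1 := by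
        have h6 : mvfderiv (𝓡 n) (c.cutoff δ) y v = fderiv ℝ f (c.φ.symm y).1 a := by
          rw [← mfderiv_eq_fderiv]
          exact (DFunLike.congr_fun h1 v).trans (congrArg
            (mfderiv 𝓘(ℝ, ℝ) 𝓘(ℝ, ℝ) f (c.φ.symm y).1) (DFunLike.congr_fun h4 v))
        rw [h6, fderiv_eq_smul_deriv, smul_eq_mul]
      rw [h5, abs_mul, mul_comm]
      have h7 := c.mem_source.1 (c.φ.map_target hy)
      gcongr
      · exact (hC _ ⟨h7.1.le, h7.2.le⟩).trans (le_max_left _ _)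
      · exact c.abs_fst_mfderiv_symm_le hy v
    · have h1 : mfderiv (𝓡 n) 𝓘(ℝ, ℝ) (c.cutoff δ) y = _ := (hout y hy).mfderiv_eq
      have h2 : mvfderiv (𝓡 n) (c.cutoff δ) y v = 0 := by
        rw [mfderiv_const] at h1
        exact DFunLike.congr_fun h1 v
      rw [h2, abs_zero]
      positivity

/-- The truncations of the cone are neighbourhoods of the tip. -/
lemma insert_truncation_mem_nhds [CompactSpace N] [IsRiemannianManifold (𝓡 n) {y : M // y ≠ x}]
    (c : ConicalNeighborhood n x N) {δ : ℝ} (hδ : 0 < δ) :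
    insert x (Subtype.val '' (c.φ '' (Ioo 0 δ ×ˢ univ))) ∈ 𝓝 x := by
  rcases isEmpty_or_nonempty N with hN | ⟨⟨θ⟩⟩
  · refine mem_of_superset c.mem_nhds (insert_subset_insert (image_mono fun y hy => ?_))
    exact (hN.false (c.φ.symm y).2).elim
  wlog hδε : δ ≤ c.ε generalizing δ
  · refine mem_of_superset (this c.ε_pos le_rfl) (insert_subset_insert (image_mono (image_mono ?_)))
    exact prod_mono (Ioo_subset_Ioo_right (le_of_not_ge hδε)) subset_rfl
  obtain ⟨hF, C, hC, hb⟩ := c.contMDiff_cutoff hδ hδε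
  have hd : 0 < 1 / (2 * C) := by positivity
  obtain ⟨ρ, hρ, h⟩ := c.exists_forall_dist_lt hd
  filter_upwards [Metric.ball_mem_nhds x hd] with y hy
  rcases eq_or_ne y x with rfl | hyx
  · exact mem_insert _ _
  refine mem_insert_of_mem _ ⟨⟨y, hyx⟩, ?_, rfl⟩
  -- A point off the truncation has cutoff value one, while points with `r` near zero have value
  -- zero. If both were within `1 / (2 C)` of the tip, their Riemannian distance would be less than
  -- `1 / C`, contradicting the Lipschitz bound.
  by_contra hy'
  have hF1 : c.cutoff δ ⟨y, hyx⟩ = 1 := c.cutoff_eq_one hδ fun ⟨z, hz, hz'⟩ =>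
    hy' ⟨z, ⟨⟨hz.1.1, by linarith [hz.1.2]⟩, hz.2⟩, hz'⟩
  set r := min ρ (δ / 4) / 2
  have hm : 0 < min ρ (δ / 4) := by positivity
  have hr : r ∈ Ioo 0 ρ := ⟨by positivity, by
    have : min ρ (δ / 4) ≤ ρ := min_le_left _ _
    simp only [r]; linarith⟩
  have hr2 : r < δ / 4 := by
    have : min ρ (δ / 4) ≤ δ / 4 := min_le_right _ _
    simp only [r]; linarith
  have hs : (r, θ) ∈ c.φ.source := c.mem_source.2 ⟨hr.1, by show r < _; linarith⟩
  have hF0 : c.cutoff δ (c.φ (r, θ)) = 0 := by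
    rw [cutoff, if_pos (c.φ.map_source hs), c.φ.left_inv hs]
    apply Real.smoothTransition.zero_of_nonpos
    rw [sub_nonpos, div_le_one hδ]
    show 4 * r ≤ δ
    linarith
  have h1 := enorm_sub_le_riemannianEDist hF hC hb (c.φ (r, θ)) ⟨y, hyx⟩
  rw [← IsRiemannianManifold.out, hF0, hF1, sub_zero, enorm_one, edist_dist,
    ← ENNReal.ofReal_mul hC.le, ENNReal.one_le_ofReal] at h1
  have h2 := h r hr θ
  have h3 : dist (c.φ (r, θ)) ⟨y, hyx⟩ ≤ dist (c.φ (r, θ) : M) x + dist y x :=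
    dist_triangle_right (c.φ (r, θ) : M) y x
  have h4 : dist y x < 1 / (2 * C) := hy
  have h5 : C * dist (c.φ (r, θ)) ⟨y, hyx⟩ < C * (1 / (2 * C) + 1 / (2 * C)) := by
    gcongr
    linarith
  have h6 : C * (1 / (2 * C) + 1 / (2 * C)) = 1 := by field_simp; norm_num
  linarith

/-- Manifolds with a conical singularity are tamely covered. -/
theorem isTamelyCovered [CompactSpace M] [CompactSpace N]
    [IsContMDiffRiemannianBundle (𝓡 n) ∞ (EuclideanSpace ℝ (Fin n))
      (fun y : {y : M // y ≠ x} => TangentSpace (𝓡 n) y)]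
    [IsRiemannianManifold (𝓡 n) {y : M // y ≠ x}] (hn : 1 ≤ n)
    (c : ConicalNeighborhood n x N) : IsTamelyCovered n {y : M // y ≠ x} := by
  intro P h0 hmono hunion hcube
  obtain ⟨δ, hδ, hP⟩ : ∃ δ > 0, P (c.φ '' (Ioo 0 δ ×ˢ univ)) := by
    -- Compactness of `N`: the radius may shrink with the angular set, and a finite union takes the
    -- minimum.
    refine isCompact_univ.induction_on (p := fun W => ∃ δ > 0, P (c.φ '' (Ioo 0 δ ×ˢ W)))
      ⟨1, one_pos, by simpa using h0⟩ ?_ ?_ fun θ _ => ?_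
    · rintro s t hst ⟨δ, hδ, h⟩
      exact ⟨δ, hδ, hmono _ _ (image_mono (prod_mono subset_rfl hst)) h⟩
    · rintro s t ⟨δ, hδ, h⟩ ⟨δ', hδ', h'⟩
      refine ⟨min δ δ', lt_min hδ hδ', ?_⟩
      rw [prod_union, image_union]
      refine hunion _ _ (hmono _ _ (image_mono (prod_mono ?_ subset_rfl)) h)
        (hmono _ _ (image_mono (prod_mono ?_ subset_rfl)) h')
      · exact Ioo_subset_Ioo_right (min_le_left _ _)
      · exact Ioo_subset_Ioo_right (min_le_right _ _)
    · obtain ⟨e, a, δ, lam, hT, η, hη, W, hW, hsub⟩ := c.exists_isTameCube_sector hn θ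
      exact ⟨W, by simpa using hW, η, hη, hmono _ _ hsub (hcube e a δ lam hT)⟩
  -- Compactness of `M`: the truncated cone handles the tip, a single tame cube each other point.
  have hM : P (Subtype.val ⁻¹' (univ : Set M)) := by
    refine isCompact_univ.induction_on
      (p := fun S : Set M => P ((Subtype.val : {y : M // y ≠ x} → M) ⁻¹' S))
      h0 (fun s t hst ht => hmono _ _ (preimage_mono hst) ht)
      (fun s t hs ht => hunion _ _ hs ht) fun m _ => ?_
    rw [nhdsWithin_univ]
    rcases eq_or_ne m x with rfl | hm
    · refine ⟨_, c.insert_truncation_mem_nhds hδ, hmono _ _ ?_ hP⟩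
      rintro ⟨y, hy⟩ (h | ⟨z, hz, hzy⟩)
      · exact (hy h).elim
      · rwa [← Subtype.ext hzy]
    · obtain ⟨e, a, δ', lam, hT, hmem⟩ := exists_isTameCube (n := n) (⟨m, hm⟩ : {y : M // y ≠ x})
      refine ⟨Subtype.val '' (e.symm '' cube a δ'), ?_, ?_⟩
      · exact (isOpen_ne.isOpenEmbedding_subtypeVal).image_mem_nhds.2 hmem
      · rw [preimage_image_eq _ Subtype.val_injective]
        exact hcube e a δ' lam hT
  exact hM

end ConicalNeighborhood

end Conical

end ConicalSobolev

end

theorem mainTheorem5 (n : ℕ) {M : Type*} [MetricSpace M] [CompactSpace M]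
    [MeasurableSpace M] [BorelSpace M] (x : M)
    [ChartedSpace (EuclideanSpace ℝ (Fin n)) {y : M // y ≠ x}]
    [IsManifold (𝓡 n) ∞ {y : M // y ≠ x}]
    [RiemannianBundle (fun y : {y : M // y ≠ x} => TangentSpace (𝓡 n) y)]
    [IsContMDiffRiemannianBundle (𝓡 n) ∞ (EuclideanSpace ℝ (Fin n))
      (fun y : {y : M // y ≠ x} => TangentSpace (𝓡 n) y)]
    [IsRiemannianManifold (𝓡 n) {y : M // y ≠ x}]
    {N : Type*} [TopologicalSpace N] [T2Space N] [CompactSpace N]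
    [ChartedSpace (EuclideanSpace ℝ (Fin (n - 1))) N] [IsManifold (𝓡 (n - 1)) ∞ N]
    (_cone : ConicalSobolev.ConicalNeighborhood n x N)
    (p : ℝ) (hp : 1 < p) (hpn : p < n) (k : ℕ) :
    -- the Sobolev norms are finite norms on test functions, and those of the completions
    (∀ (j : ℕ) (r : ℝ), 1 ≤ r → ∀ u : ConicalSobolev.TestFun n {y : M // y ≠ x},
      ENNReal.ofReal ‖ConicalSobolev.toSobolev j r u‖ =
        ConicalSobolev.sobolevNorm n j r (u : {y : M // y ≠ x} → ℝ)) ∧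
    ∃ C : ℝ, 0 < C ∧
      ∀ (l : ℕ) (ql : ℝ), l < k → 1 / ql = 1 / p - ((k : ℝ) - l) / n → 0 < 1 / ql →
        ∀ q : ℝ, 1 ≤ q → q ≤ ql →
          (∀ u ∈ ConicalSobolev.TestFun n {y : M // y ≠ x},
            ConicalSobolev.sobolevNorm n l q u ≤
              ENNReal.ofReal C * ConicalSobolev.sobolevNorm n k p u) ∧
          ∃ J : ConicalSobolev.SobolevSpace n {y : M // y ≠ x} k p →L[ℝ]
              ConicalSobolev.SobolevSpace n {y : M // y ≠ x} l q,
            Function.Injective J ∧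
            ∀ u : ConicalSobolev.TestFun n {y : M // y ≠ x},
              J (ConicalSobolev.toSobolev k p u) = ConicalSobolev.toSobolev l q u := by
  have hn : 2 ≤ n := by
    have : (1 : ℝ) < n := hp.trans hpn
    exact_mod_cast this
  have hX := _cone.isTamelyCovered (by omega)
  have hvol := ConicalSobolev.riemannianVolume_univ_lt_top hX
  obtain ⟨C, hC, h⟩ := ConicalSobolev.exists_sobolevNorm_le hX hp hpn k
  refine ⟨fun j r hr u => ConicalSobolev.ofReal_norm_toSobolev hvol j hr u, C, hC,
    fun l ql hl hql hql0 q hq hqql => ?_⟩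
  have hle := h l ql hl hql hql0 q hq hqql
  exact ⟨hle, ConicalSobolev.exists_embedding hX hp.le hq hC.le hle⟩
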